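/- Let $1<p,s<\infty$. There is a positive constant $C$, depending only on $p,s,n$ if $s<p$ and only on $p,s$ if $p\le s$, such that the following holds. Let $n\ge 2$, let $\Omega\subseteq\mathbb{R}^n$ be a domain (nonempty, connected, open), and let $a=(a_1,\dots,a_n)$ where $a_1,\dots,a_n$ are positive Lebesgue measurable functions in $\Omega$ which on every domain $\omega\Subset\Omega$ are bounded above and below by positive constants. Put $$|\xi|_{s,a}=\Big(\sum_{i=1}^n a_i(x)|\xi_i|^s\Big)^{1/s},\qquad \mathcal{A}(x,\xi)=\nabla_\xi\Big(\tfrac1p|\xi|_{s,a}^p\Big)\qquad(x\in\Omega,\ \xi\in\mathbb{R}^n).$$ Let $V\in M^q_{\rm loc}(p;\Omega)$, i.e. for every domain $\omega\Subset\Omega$: - if $p<n$: $q>n/p$, $V\in L^1_{\rm loc}(\omega)$ and $\sup_{y\in\omega,\,0<r<\operatorname{diam}\omega} r^{-n(q-1)/q}\int_{\omega\cap B_r(y)}|V|\,dx<\infty$; - if $p=n$: $q>n$, $V\in L^1_{\rm loc}(\omega)$ and $\sup_{y\in\omega,\,0<r<\operatorname{diam}\omega}\big(\log(\operatorname{diam}\omega/r)\big)^{q(n-1)/n}\int_{\omega\cap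 B_r(y)}|V|\,dx<\infty$; - if $p>n$: $q=1$ and $V\in L^1(\omega)$. For $\phi\in W^{1,p}(\Omega)\cap C_c(\Omega)$ let $$Q[\phi]=\int_\Omega\big(|\nabla\phi|_{s,a}^p+V|\phi|^p\big)\,dx .$$ A function $g\in L^1_{\rm loc}(\Omega)$ is a Hardy-weight of $Q$ if for some constant $c>0$, $Q[\phi]\ge c\int_\Omega|g||\phi|^p\,dx$ for all $\phi\in C_c^\infty(\Omega)$; let $\mathcal{H}(\Omega)$ be the set of Hardy-weights (functions equal a.e. in $\Omega$ being identified). Let $u\in W^{1,p}_{\rm loc}(\Omega)\cap C(\Omega)$ be a positive weak solution of $-\operatorname{div}\mathcal{A}(x,\nabla v)+V|v|^{p-2}v=0$ in $\Omega$. For compact $K\subseteq\Omega$ let $$\operatorname{cap}(K,u)=\inf\{Q[\phi] : \phi\in W^{1,p}(\Omega)\cap C_c(\Omega),\ \phi\ge u\text{ on }K\},$$ and for $g\in L^1_{\rm loc}(\Omega)$ let $$\|g\|_u=\inf\Big\{L\in[0,\infty) : \int_K|g|u^p\,dx\le L\operatorname{cap}(K,u)\text{ for all compact }K\subseteq\Omega\Big\}\in[0,\infty]$$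 and $\|g\|_{\mathcal{H}}=1/S_g\in[0,\infty]$, where $$S_g=\inf\Big\{\frac{Q[\phi]}{\int_\Omega|g||\phi|^p\,dx} : \phi\in W^{1,p}(\Omega)\cap C_c(\Omega),\ \int_\Omega|g||\phi|^p\,dx>0\Big\}$$ (with $\inf\emptyset=\infty$, $1/0=\infty$, $1/\infty=0$). Then: 1. for every $g\in L^1_{\rm loc}(\Omega)$, $g\in\mathcal{H}(\Omega)$ if and only if $\|g\|_u<\infty$; 2. for every $g\in\mathcal{H}(\Omega)$, $\|g\|_u\le\|g\|_{\mathcal{H}}\le C\|g\|_u$; 3. $\mathcal{H}(\Omega)$ is a real vector space, $\|\cdot\|_u$ is a norm on it, and $(\mathcal{H}(\Omega),\|\cdot\|_u)$ is a Banach space. -/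

import Mathlib

open MeasureTheory Set
open scoped ENNReal NNReal

noncomputable section

namespace HardyMazya

/-- `ℝⁿ` with the Euclidean norm. -/
abbrev Eu (n : ℕ) : Type := EuclideanSpace ℝ (Fin n)

variable {n : ℕ}

/-- A domain in `ℝⁿ`: a nonempty, connected, open set (`IsConnected` includes nonemptiness). -/
def IsDom (Ω : Set (Eu n)) : Prop := IsOpen Ω ∧ IsConnected Ω

/-- `ω ⋐ Ω` with `ω` a domain: the closure of `ω` is a compact subset of `Ω`. -/
def IsSubdom (ω Ω : Set (Eu n)) : Prop := IsDom ω ∧ IsCompact (closure ω) ∧ closure ω ⊆ Ω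

/-! ### Test functions and Sobolev spaces -/

/-- `C_c(Ω)`, each function being extended by zero to `ℝⁿ`. -/
def IsCc (Ω : Set (Eu n)) (φ : Eu n → ℝ) : Prop :=
  Continuous φ ∧ HasCompactSupport φ ∧ tsupport φ ⊆ Ω

/-- `C_c^∞(Ω)`, each function being extended by zero to `ℝⁿ`. -/
def IsTest (Ω : Set (Eu n)) (φ : Eu n → ℝ) : Prop :=
  ContDiff ℝ ((⊤ : ℕ∞) : WithTop ℕ∞) φ ∧ HasCompactSupport φ ∧ tsupport φ ⊆ Ω

/-- `G` is a weak (distributional) gradient of `f` in `Ω`. -/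
def HasWeakGrad (Ω : Set (Eu n)) (f : Eu n → ℝ) (G : Eu n → Eu n) : Prop :=
  LocallyIntegrableOn f Ω ∧ LocallyIntegrableOn G Ω ∧
    ∀ η : Eu n → ℝ, IsTest Ω η → ∀ i : Fin n,
      ∫ x in Ω, f x * fderiv ℝ η x (EuclideanSpace.single i 1) = - ∫ x in Ω, G x i * η x

open Classical in
/-- The weak gradient `∇f` in `Ω` (unique up to a null subset of `Ω`), and `0` if there is none. -/
def weakGrad (Ω : Set (Eu n)) (f : Eu n → ℝ) : Eu n → Eu n :=
  if h : ∃ G, HasWeakGrad Ω f G then h.choose else 0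

/-- `W^{1,p}(Ω)`. -/
def MemW1p (p : ℝ) (Ω : Set (Eu n)) (f : Eu n → ℝ) : Prop :=
  MemLp f (ENNReal.ofReal p) (volume.restrict Ω) ∧
    ∃ G, HasWeakGrad Ω f G ∧ MemLp G (ENNReal.ofReal p) (volume.restrict Ω)

/-- `W^{1,p}_loc(Ω)`. -/
def MemW1pLoc (p : ℝ) (Ω : Set (Eu n)) (f : Eu n → ℝ) : Prop :=
  ∃ G, HasWeakGrad Ω f G ∧ ∀ K : Set (Eu n), IsCompact K → K ⊆ Ω →
    MemLp f (ENNReal.ofReal p) (volume.restrict K) ∧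
    MemLp G (ENNReal.ofReal p) (volume.restrict K)

/-! ### The local Morrey space -/

/-- `sup_{y ∈ ω, 0 < r < diam ω} w(r) ∫_{ω ∩ B_r(y)} |f| dx`. -/
def morreySup (w : ℝ → ℝ) (ω : Set (Eu n)) (f : Eu n → ℝ) : ℝ≥0∞ :=
  ⨆ (y : Eu n) (_ : y ∈ ω) (r : ℝ) (_ : 0 < r) (_ : r < Metric.diam ω),
    ENNReal.ofReal (w r) * ∫⁻ x in ω ∩ Metric.ball y r, ‖f x‖ₑ

/-- `f ∈ M^q(p; ω)`, with the admissible exponents `q`: `q > n/p` if `p < n`, `q > n` if `p = n`,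
and `q = 1` if `p > n`. Here `n/q' = n / (q/(q-1))` and `q/n' = q / (n/(n-1))`. -/
def MemMorrey (p q : ℝ) (ω : Set (Eu n)) (f : Eu n → ℝ) : Prop :=
  (p < n ∧ n / p < q ∧ LocallyIntegrableOn f ω ∧
      morreySup (fun r => 1 / r ^ ((n : ℝ) / (q / (q - 1)))) ω f < ∞) ∨
  (p = n ∧ n < q ∧ LocallyIntegrableOn f ω ∧
      morreySup (fun r => Real.log (Metric.diam ω / r) ^ (q / ((n : ℝ) / (n - 1)))) ω f < ∞) ∨
  (n < p ∧ q = 1 ∧ IntegrableOn f ω)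

/-- `f ∈ M^q_loc(p; Ω)`. -/
def MemMorreyLoc (p q : ℝ) (Ω : Set (Eu n)) (f : Eu n → ℝ) : Prop :=
  ∀ ω : Set (Eu n), IsSubdom ω Ω → MemMorrey p q ω f

/-! ### The norm family, the energy functional and the equation -/

/-- The coefficients `a = (a₁, …, aₙ)`: positive Lebesgue measurable functions in `Ω` that are
locally bounded above and below by positive constants. -/
def IsCoeff (Ω : Set (Eu n)) (a : Eu n → Fin n → ℝ) : Prop :=
  (∀ i, AEMeasurable (fun x => a x i) (volume.restrict Ω)) ∧
  (∀ x ∈ Ω, ∀ i, 0 < a x i) ∧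
  ∀ ω : Set (Eu n), IsSubdom ω Ω → ∃ c C : ℝ, 0 < c ∧
    ∀ᵐ x ∂(volume.restrict ω), ∀ i, c ≤ a x i ∧ a x i ≤ C

/-- `H(x, ξ) = |ξ|_{s,a} = (∑ᵢ aᵢ(x) |ξᵢ|^s)^{1/s}`. -/
def saNorm (s : ℝ) (a : Eu n → Fin n → ℝ) (x ξ : Eu n) : ℝ :=
  (∑ i, a x i * |ξ i| ^ s) ^ (1 / s)

/-- `𝒜(x, ξ) = ∇_ξ F(x, ξ)` with `F(x, ξ) = H(x, ξ)^p / p`. -/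
def opA (p s : ℝ) (a : Eu n → Fin n → ℝ) (x ξ : Eu n) : Eu n :=
  gradient (fun ζ : Eu n => 1 / p * saNorm s a x ζ ^ p) ξ

/-- The energy `Q[φ] = ∫_Ω (H(x, ∇φ)^p + V |φ|^p) dx`. -/
def energy (p s : ℝ) (Ω : Set (Eu n)) (a : Eu n → Fin n → ℝ) (V φ : Eu n → ℝ) : ℝ :=
  ∫ x in Ω, (saNorm s a x (weakGrad Ω φ x) ^ p + V x * |φ x| ^ p)

/-- `v` is a weak solution of `Q'[v] = -div 𝒜(x, ∇v) + V |v|^{p-2} v = 0` in `Ω`. -/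
def IsWeakSol (p s : ℝ) (Ω : Set (Eu n)) (a : Eu n → Fin n → ℝ) (V v : Eu n → ℝ) : Prop :=
  MemW1pLoc p Ω v ∧ ∀ φ : Eu n → ℝ, IsTest Ω φ →
    (∫ x in Ω, inner ℝ (opA p s a x (weakGrad Ω v x)) (gradient φ x)) +
      ∫ x in Ω, V x * (|v x| ^ (p - 2) * v x) * φ x = 0

/-! ### Hardy-weights, capacity and the two norms -/

/-- `g ∈ L¹_loc(Ω)` is a Hardy-weight: `Q[φ] ≥ C ∫_Ω |g| |φ|^p` for some `C > 0` and all
`φ ∈ C_c^∞(Ω)`. -/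
def IsHardyWeight (p s : ℝ) (Ω : Set (Eu n)) (a : Eu n → Fin n → ℝ) (V g : Eu n → ℝ) : Prop :=
  LocallyIntegrableOn g Ω ∧ ∃ C : ℝ, 0 < C ∧ ∀ φ : Eu n → ℝ, IsTest Ω φ →
    C * ∫ x in Ω, |g x| * |φ x| ^ p ≤ energy p s Ω a V φ

/-- `cap(K, u) = inf {Q[φ] | φ ∈ W^{1,p}(Ω) ∩ C_c(Ω), φ ≥ u on K}`. -/
def capacity (p s : ℝ) (Ω : Set (Eu n)) (a : Eu n → Fin n → ℝ) (V u : Eu n → ℝ)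
    (K : Set (Eu n)) : ℝ :=
  sInf {e : ℝ | ∃ φ : Eu n → ℝ, MemW1p p Ω φ ∧ IsCc Ω φ ∧ (∀ x ∈ K, u x ≤ φ x) ∧
    e = energy p s Ω a V φ}

/-- `‖g‖_u`: the infimum of the `L ∈ [0, ∞)` with `∫_K |g| |u|^p ≤ L cap(K, u)` for all compact
`K ⊆ Ω`; it is `∞` if there is no such `L`. -/
def uNorm (p s : ℝ) (Ω : Set (Eu n)) (a : Eu n → Fin n → ℝ) (V u g : Eu n → ℝ) : ℝ≥0∞ :=
  ⨅ (L : ℝ≥0) (_ : ∀ K : Set (Eu n), IsCompact K → K ⊆ Ω →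
    ∫ x in K, |g x| * |u x| ^ p ≤ L * capacity p s Ω a V u K), (L : ℝ≥0∞)

/-- The Hardy constant `S_g`, the infimum of `Q[φ] / ∫_Ω |g| |φ|^p` over the
`φ ∈ W^{1,p}(Ω) ∩ C_c(Ω)` with `∫_Ω |g| |φ|^p > 0`, as an element of `[0, ∞]` (for a nonnegative
functional `Q`). -/
def hardyConst (p s : ℝ) (Ω : Set (Eu n)) (a : Eu n → Fin n → ℝ) (V g : Eu n → ℝ) : ℝ≥0∞ :=
  ⨅ (φ : Eu n → ℝ) (_ : MemW1p p Ω φ) (_ : IsCc Ω φ)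
    (_ : 0 < ∫⁻ x in Ω, ENNReal.ofReal (|g x| * |φ x| ^ p)),
    ENNReal.ofReal (energy p s Ω a V φ) / ∫⁻ x in Ω, ENNReal.ofReal (|g x| * |φ x| ^ p)

/-- `‖g‖_ℋ = 1 / S_g`. -/
def hNorm (p s : ℝ) (Ω : Set (Eu n)) (a : Eu n → Fin n → ℝ) (V g : Eu n → ℝ) : ℝ≥0∞ :=
  (hardyConst p s Ω a V g)⁻¹

/-- `N` is a norm on the real vector space `X`, and `X` is complete with respect to it. -/
def IsBanachNorm (X : Type*) [AddCommGroup X] [Module ℝ X] (N : X → ℝ) : Prop :=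
  ∃ core : @NormedSpace.Core ℝ X _ _ _ ⟨N⟩,
    @CompleteSpace X
      (@NormedAddCommGroup.ofCore ℝ X _ _ _ ⟨N⟩ core).toMetricSpace.toUniformSpace

end HardyMazya

end

open HardyMazya

/-!
Picone's identity turns the existence of the positive solution `u` into the ground state
representation `Q[φ] = ∫ D(x, (φ/u) ∇u, ∇φ - (φ/u) ∇u)`, where `D(x, ξ, η) ≥ 0` is the Bregman
distance from `ξ` to `ξ + η` of `|·|_{s,a}^p`. Doubling, `D(x, ξ, 2η) ≤ C D(x, ξ, η)` with `C`
depending on `p` and `s` only, controls the energy density of the truncations `u f(φ / (t u))` on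
the shells `{t ≤ |φ/u| < 2t}` by that of `φ`. Summing over dyadic `t` the inequality
`∫_K |g| u^p ≤ L cap(K, u)` for the sets `K = {|φ/u| ≥ 2t}`, as in Maz'ya's capacitary argument,
gives `∫ |g| |φ|^p ≤ C L Q[φ]`. For completeness, a sequence which is Cauchy for `‖·‖_u` is Cauchy
in `L¹(K; u^p dx)` for every compact `K`, and Fatou's lemma passes the capacitary inequality to its
limit.
-/

noncomputable section

namespace HardyMazya

/-! ### Comparison of the gaps between powers and their tangent lines -/

/-- The gap at `t` between `t ↦ t ^ p` and its tangent line at `1`, that is, the Bregman distance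
of the `p`-th power from `1` to `t`. -/
def rpowGap (p t : ℝ) : ℝ := t ^ p - 1 - p * (t - 1)

section RpowGap

variable {p s t T : ℝ}

theorem rpowGap_two (t : ℝ) : rpowGap 2 t = (t - 1) ^ 2 := by
  rw [rpowGap, Real.rpow_two]
  ring

theorem rpowGap_nonneg (hp : 1 ≤ p) (ht : 0 ≤ t) : 0 ≤ rpowGap p t := by
  have h := one_add_mul_self_le_rpow_one_add (s := t - 1) (by linarith) hp
  rw [add_sub_cancel] at h
  rw [rpowGap]
  linarith

theorem rpowGap_div_le_rpowGap_div (hp : 0 < p) (hps : p ≤ s) (ht : 0 ≤ t) :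
    rpowGap p t / p ≤ rpowGap s t / s := by
  have hs : 0 < s := hp.trans_le hps
  -- Bernoulli's inequality for `t ^ s = (t ^ p) ^ (s / p)`
  have h := rpowGap_nonneg ((one_le_div hp).2 hps) (Real.rpow_nonneg ht p)
  rw [rpowGap, ← Real.rpow_mul ht, mul_div_cancel₀ _ hp.ne'] at h
  rw [rpowGap, rpowGap, div_le_div_iff₀ hp hs]
  have h' : 0 ≤ p * (t ^ s - 1 - s / p * (t ^ p - 1)) := mul_nonneg hp.le h
  have e : p * (t ^ s - 1 - s / p * (t ^ p - 1)) = p * (t ^ s - 1) - s * (t ^ p - 1) := by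
    field_simp
  linarith

theorem rpow_sub_one_le_mul_rpow (hp : 1 < p) (ht : 0 ≤ t) :
    t ^ p - 1 ≤ p * t ^ (p - 1) * (t - 1) := by
  rcases ht.eq_or_lt with rfl | ht
  · simp [Real.zero_rpow (show p ≠ 0 by linarith), Real.zero_rpow (show p - 1 ≠ 0 by linarith)]
  have h : 0 ≤ t ^ p * rpowGap p t⁻¹ :=
    mul_nonneg (by positivity) (rpowGap_nonneg hp.le (inv_nonneg.2 ht.le))
  have e : t ^ p = t ^ (p - 1) * t := by rw [← Real.rpow_add_one ht.ne', sub_add_cancel]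
  have h1 : t ^ p * rpowGap p t⁻¹ = 1 - t ^ p - p * (t ^ p * t⁻¹ - t ^ p) := by
    rw [rpowGap, Real.inv_rpow ht.le]
    field_simp
  rw [h1, e, mul_inv_cancel_right₀ ht.ne'] at h
  rw [e]
  linarith

theorem rpowGap_le_mul_sq (hp : 2 < p) (ht : 0 ≤ t) (hT : 1 ≤ T) (htT : t ≤ T) :
    rpowGap p t ≤ p * ((p - 1) * T ^ (p - 1 - 1)) * (t - 1) ^ 2 := by
  have h : rpowGap p t ≤ p * ((t ^ (p - 1) - 1) * (t - 1)) := by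
    have := rpow_sub_one_le_mul_rpow (one_lt_two.trans hp) ht
    rw [rpowGap]
    linarith
  refine h.trans ?_
  rw [mul_assoc p]
  refine mul_le_mul_of_nonneg_left ?_ (by linarith)
  rcases le_total t 1 with h1 | h1
  · have hg : 0 ≤ rpowGap (p - 1) t := rpowGap_nonneg (by linarith) ht
    rw [rpowGap] at hg
    have hT1 : 1 ≤ T ^ (p - 1 - 1) := Real.one_le_rpow hT (by linarith)
    calc (t ^ (p - 1) - 1) * (t - 1) ≤ ((p - 1) * (t - 1)) * (t - 1) :=
          mul_le_mul_of_nonpos_right (by linarith) (by linarith)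
      _ = (p - 1) * 1 * (t - 1) ^ 2 := by ring
      _ ≤ (p - 1) * T ^ (p - 1 - 1) * (t - 1) ^ 2 := by gcongr; linarith
  · calc (t ^ (p - 1) - 1) * (t - 1) ≤ ((p - 1) * t ^ (p - 1 - 1) * (t - 1)) * (t - 1) :=
          mul_le_mul_of_nonneg_right (rpow_sub_one_le_mul_rpow (by linarith) ht) (by linarith)
      _ = (p - 1) * t ^ (p - 1 - 1) * (t - 1) ^ 2 := by ring
      _ ≤ (p - 1) * T ^ (p - 1 - 1) * (t - 1) ^ 2 := by gcongr <;> linarith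

theorem mul_sq_le_rpowGap (hs : 1 < s) (hs2 : s ≤ 2) (ht : 0 ≤ t) (hT : 1 ≤ T) (htT : t ≤ T) :
    (s - 1) ^ 2 * (t - 1) ^ 2 ≤ T * rpowGap s t := by
  have hg := rpowGap_nonneg hs.le ht
  rcases ht.eq_or_lt with rfl | ht
  · rw [rpowGap, Real.zero_rpow (by linarith)] at hg ⊢
    nlinarith
  -- `t ^ s = t ^ 2 / t ^ (2 - s)`, and Bernoulli's inequality bounds the denominator from above
  have hb : t ^ (2 - s) ≤ 1 + (2 - s) * (t - 1) := by
    simpa using rpow_one_add_le_one_add_mul_self (s := t - 1) (by linarith)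
      (p := 2 - s) (by linarith) (by linarith)
  have e : t ^ s * t ^ (2 - s) = t ^ 2 := by
    rw [← Real.rpow_add ht, add_sub_cancel, Real.rpow_two]
  have h1 : t ^ 2 ≤ t ^ s * (1 + (2 - s) * (t - 1)) := by
    rw [← e]
    gcongr
  have h2 : (s - 1) ^ 2 * (t - 1) ^ 2 ≤ (1 + (2 - s) * (t - 1)) * rpowGap s t := by
    rw [rpowGap]
    linarith
  refine h2.trans (mul_le_mul_of_nonneg_right ?_ hg)
  nlinarith

theorem exists_rpowGap_le_mul_sq (hp : 1 < p) (T : ℝ) :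
    ∃ C, 0 < C ∧ ∀ t, 0 ≤ t → t ≤ T → rpowGap p t ≤ C * (t - 1) ^ 2 := by
  rcases le_or_gt p 2 with h | h
  · refine ⟨p / 2, by positivity, fun t ht _ => ?_⟩
    have := rpowGap_div_le_rpowGap_div (by linarith) h ht
    rw [rpowGap_two, div_le_iff₀ (by linarith)] at this
    linarith
  · have hT : 0 < max 1 T := lt_max_of_lt_left one_pos
    exact ⟨p * ((p - 1) * max 1 T ^ (p - 1 - 1)),
      mul_pos (by linarith) (mul_pos (by linarith) (Real.rpow_pos_of_pos hT _)),
      fun t ht htT => rpowGap_le_mul_sq h ht (le_max_left _ _) (htT.trans (le_max_right _ _))⟩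

theorem exists_sq_le_mul_rpowGap (hs : 1 < s) (T : ℝ) :
    ∃ C, 0 < C ∧ ∀ t, 0 ≤ t → t ≤ T → (t - 1) ^ 2 ≤ C * rpowGap s t := by
  rcases le_or_gt s 2 with h | h
  · have hs1 : 0 < (s - 1) ^ 2 := pow_pos (by linarith) 2
    refine ⟨max 1 T / (s - 1) ^ 2, by positivity, fun t ht htT => ?_⟩
    rw [div_mul_eq_mul_div, le_div_iff₀ hs1, mul_comm]
    exact mul_sq_le_rpowGap hs h ht (le_max_left _ _) (htT.trans (le_max_right _ _))
  · refine ⟨2 / s, by positivity, fun t ht _ => ?_⟩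
    have := rpowGap_div_le_rpowGap_div two_pos h.le ht
    rw [rpowGap_two, div_le_iff₀ two_pos] at this
    linarith [show 2 / s * rpowGap s t = rpowGap s t / s * 2 by ring]

theorem exists_rpowGap_le (hp : 1 < p) (hs : 1 < s) (T : ℝ) :
    ∃ C, 0 < C ∧ ∀ t, 0 ≤ t → t ≤ T → rpowGap p t ≤ C * rpowGap s t := by
  obtain ⟨C₁, hC₁, h₁⟩ := exists_rpowGap_le_mul_sq hp T
  obtain ⟨C₂, hC₂, h₂⟩ := exists_sq_le_mul_rpowGap hs T
  refine ⟨C₁ * C₂, mul_pos hC₁ hC₂, fun t ht htT => (h₁ t ht htT).trans ?_⟩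
  rw [mul_assoc]
  exact mul_le_mul_of_nonneg_left (h₂ t ht htT) hC₁.le

end RpowGap

/-! ### Bregman distances of powers of a seminorm -/

section PowBregman

/-- `ℓ` is a supporting functional (a subgradient) of the seminorm `N` at `ξ`. -/
structure IsSupporting {E : Type*} [AddCommGroup E] [Module ℝ E] (N : Seminorm ℝ E)
    (ℓ : E →ₗ[ℝ] ℝ) (ξ : E) : Prop where
  le : ∀ ζ, ℓ ζ ≤ N ζ
  apply_self : ℓ ξ = N ξ

/-- The Bregman distance from `ξ` to `ξ + η` of the `p`-th power of the seminorm `N`, where `ℓ` is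
a supporting functional of `N` at `ξ`: as `p > 1`, the derivative of `N ^ p` at `ξ` is
`p * N ξ ^ (p - 1) • ℓ`. -/
def powBregman {E : Type*} [AddCommGroup E] [Module ℝ E] (p : ℝ) (N : Seminorm ℝ E)
    (ℓ : E →ₗ[ℝ] ℝ) (ξ η : E) : ℝ :=
  N (ξ + η) ^ p - N ξ ^ p - p * (N ξ ^ (p - 1) * ℓ η)

variable {E : Type*} [AddCommGroup E] [Module ℝ E] {N : Seminorm ℝ E} {ℓ : E →ₗ[ℝ] ℝ} {ξ : E}
  {p s : ℝ}

theorem IsSupporting.abs_apply_le (h : IsSupporting N ℓ ξ) (ζ : E) : |ℓ ζ| ≤ N ζ := by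
  rw [abs_le']
  exact ⟨h.le ζ, by simpa using h.le (-ζ)⟩

theorem IsSupporting.apply_le_sub (h : IsSupporting N ℓ ξ) (η : E) : ℓ η ≤ N (ξ + η) - N ξ := by
  have := h.le (ξ + η)
  rw [map_add, h.apply_self] at this
  linarith

theorem powBregman_eq (ℓ : E →ₗ[ℝ] ℝ) (hξ : 0 < N ξ) (η : E) :
    powBregman p N ℓ ξ η = N ξ ^ p * (rpowGap p (N (ξ + η) / N ξ) +
      p * ((N (ξ + η) - N ξ - ℓ η) / N ξ)) := by
  have e : N ξ ^ p = N ξ ^ (p - 1) * N ξ := by rw [← Real.rpow_add_one hξ.ne', sub_add_cancel]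
  have e' : N ξ ^ p * (N (ξ + η) ^ p / N ξ ^ p) = N (ξ + η) ^ p := by field_simp
  have e'' : N ξ ^ p / N ξ = N ξ ^ (p - 1) := by rw [e]; field_simp
  calc powBregman p N ℓ ξ η
      = N ξ ^ p * (N (ξ + η) ^ p / N ξ ^ p) - N ξ ^ p - p * (N ξ ^ p / N ξ * ℓ η) := by
        rw [e', e'', powBregman]
    _ = _ := by
        rw [rpowGap, Real.div_rpow (apply_nonneg N _) hξ.le]
        field_simp
        ring

theorem powBregman_nonneg (hp : 1 < p) (h : IsSupporting N ℓ ξ) (η : E) :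
    0 ≤ powBregman p N ℓ ξ η := by
  have hη := apply_nonneg N (ξ + η)
  rcases (apply_nonneg N ξ).eq_or_lt with h0 | h0
  · rw [powBregman, ← h0, Real.zero_rpow (by linarith), Real.zero_rpow (by linarith)]
    simpa using Real.rpow_nonneg hη p
  · rw [powBregman_eq ℓ h0]
    have h1 := rpowGap_nonneg hp.le (div_nonneg hη h0.le)
    have h2 : 0 ≤ (N (ξ + η) - N ξ - ℓ η) / N ξ :=
      div_nonneg (by linarith [h.apply_le_sub η]) h0.le
    positivity

theorem exists_powBregman_div_le (hp : 1 < p) (hs : 1 < s) (T : ℝ) :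
    ∃ C, 0 < C ∧ ∀ {E : Type*} [AddCommGroup E] [Module ℝ E] {N : Seminorm ℝ E}
      {ℓ : E →ₗ[ℝ] ℝ} {ξ : E}, IsSupporting N ℓ ξ → 0 < N ξ → ∀ η, N (ξ + η) ≤ T * N ξ →
        powBregman p N ℓ ξ η / N ξ ^ p ≤ C * (powBregman s N ℓ ξ η / N ξ ^ s) := by
  obtain ⟨C, hC, h⟩ := exists_rpowGap_le hp hs T
  refine ⟨max C (p / s), lt_max_of_lt_left hC, fun {E} _ _ N ℓ ξ hℓ hξ η hT => ?_⟩
  rw [powBregman_eq ℓ hξ, powBregman_eq ℓ hξ, mul_div_cancel_left₀ _ (by positivity),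
    mul_div_cancel_left₀ _ (by positivity), mul_add]
  have hr : 0 ≤ N (ξ + η) / N ξ := div_nonneg (apply_nonneg N _) hξ.le
  have hslack : 0 ≤ (N (ξ + η) - N ξ - ℓ η) / N ξ :=
    div_nonneg (by linarith [hℓ.apply_le_sub η]) hξ.le
  have hps : p ≤ max C (p / s) * s := by
    rw [← div_le_iff₀ (by linarith)]
    exact le_max_right _ _
  refine add_le_add ((h _ hr ((div_le_iff₀ hξ).2 hT)).trans ?_) ?_
  · exact mul_le_mul_of_nonneg_right (le_max_left _ _) (rpowGap_nonneg hs.le hr)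
  · rw [← mul_assoc]
    exact mul_le_mul_of_nonneg_right hps hslack

theorem exists_half_le_one_sub_rpow (hp : 1 < p) :
    ∃ ε : ℝ, 0 < ε ∧ ε ≤ 1 ∧ 1 / 2 ≤ (1 - ε) ^ p - ε ^ p - p * ε ^ (p - 1) := by
  have hc : ContinuousAt (fun ε : ℝ => (1 - ε) ^ p - ε ^ p - p * ε ^ (p - 1)) 0 := by
    refine ((ContinuousAt.rpow_const (by fun_prop) (Or.inl (by norm_num))).sub
      (ContinuousAt.rpow_const (by fun_prop) (Or.inr (by linarith)))).sub
      (continuousAt_const.mul (ContinuousAt.rpow_const (by fun_prop) (Or.inr (by linarith))))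
  have h0 : (1 / 2 : ℝ) < (1 - 0) ^ p - 0 ^ p - p * 0 ^ (p - 1) := by
    rw [Real.zero_rpow (by linarith), Real.zero_rpow (by linarith)]
    norm_num
  obtain ⟨r, hr, hr'⟩ := Metric.eventually_nhds_iff.1 (hc.eventually (lt_mem_nhds h0))
  refine ⟨min (r / 2) 1, by positivity, min_le_right _ _, (hr' ?_).le⟩
  rw [Real.dist_0_eq_abs, abs_of_pos (by positivity)]
  exact (min_le_left _ _).trans_lt (by linarith)

theorem mul_rpow_le_powBregman {ε : ℝ} (hp : 1 < p) (hε : 0 < ε) (hε1 : ε ≤ 1)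
    (h : IsSupporting N ℓ ξ) {η : E} (hξ : N ξ < ε * N η) :
    ((1 - ε) ^ p - ε ^ p - p * ε ^ (p - 1)) * N η ^ p ≤ powBregman p N ℓ ξ η := by
  have hη : 0 < N η := pos_of_mul_pos_right ((apply_nonneg N ξ).trans_lt hξ) hε.le
  have hstep : N η ≤ N (ξ + η) + N ξ := by simpa using map_sub_le_add N (ξ + η) ξ
  have hend : (1 - ε) ^ p * N η ^ p ≤ N (ξ + η) ^ p := by
    rw [← Real.mul_rpow (by linarith) hη.le]
    exact Real.rpow_le_rpow (mul_nonneg (by linarith) hη.le) (by linarith) (by linarith)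
  have hbase : N ξ ^ p ≤ ε ^ p * N η ^ p := by
    rw [← Real.mul_rpow hε.le hη.le]
    exact Real.rpow_le_rpow (apply_nonneg N ξ) hξ.le (by linarith)
  have hlin : N ξ ^ (p - 1) * ℓ η ≤ ε ^ (p - 1) * N η ^ p := by
    calc N ξ ^ (p - 1) * ℓ η ≤ N ξ ^ (p - 1) * N η := by
          gcongr
          exact h.le η
      _ ≤ (ε * N η) ^ (p - 1) * N η := by
          gcongr
      _ = ε ^ (p - 1) * N η ^ p := by
          rw [Real.mul_rpow hε.le hη.le, mul_assoc, ← Real.rpow_add_one hη.ne', sub_add_cancel]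
  have := mul_le_mul_of_nonneg_left hlin (zero_le_one.trans hp.le)
  rw [powBregman]
  linarith

theorem powBregman_two_smul_le (hp : 1 < p) (h : IsSupporting N ℓ ξ) {η : E} (hξ : N ξ ≤ N η) :
    powBregman p N ℓ ξ ((2 : ℝ) • η) ≤ (3 ^ p + 2 * p) * N η ^ p := by
  have hη := apply_nonneg N η
  have hend : N (ξ + (2 : ℝ) • η) ^ p ≤ 3 ^ p * N η ^ p := by
    rw [← Real.mul_rpow (by norm_num) hη]
    refine Real.rpow_le_rpow (apply_nonneg N _) ((map_add_le_add N _ _).trans ?_) (by linarith)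
    rw [map_smul_eq_mul, Real.norm_two]
    linarith
  have hlin : N ξ ^ (p - 1) * -ℓ η ≤ N η ^ p := by
    calc N ξ ^ (p - 1) * -ℓ η ≤ N ξ ^ (p - 1) * N η := by
          gcongr
          exact (neg_le_abs _).trans (h.abs_apply_le η)
      _ ≤ N η ^ (p - 1) * N η := by
          gcongr
      _ = N η ^ p := by
          rw [← Real.rpow_add_one' hη (by linarith), sub_add_cancel]
  have hbase : 0 ≤ N ξ ^ p := Real.rpow_nonneg (apply_nonneg N ξ) p
  have := mul_le_mul_of_nonneg_left hlin (zero_le_one.trans hp.le)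
  rw [powBregman, map_smul, smul_eq_mul]
  linarith

theorem exists_powBregman_doubling_of_lt (hp : 1 < p) :
    ∃ ε C : ℝ, 0 < ε ∧ 0 < C ∧ ∀ {E : Type*} [AddCommGroup E] [Module ℝ E] {N : Seminorm ℝ E}
      {ℓ : E →ₗ[ℝ] ℝ} {ξ : E}, IsSupporting N ℓ ξ → ∀ η, N ξ < ε * N η →
        powBregman p N ℓ ξ ((2 : ℝ) • η) ≤ C * powBregman p N ℓ ξ η := by
  obtain ⟨ε, hε, hε1, hhalf⟩ := exists_half_le_one_sub_rpow hp
  refine ⟨ε, 2 * (3 ^ p + 2 * p), hε, by positivity, fun {E} _ _ N ℓ ξ h η hξ => ?_⟩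
  have hlow : 1 / 2 * N η ^ p ≤ powBregman p N ℓ ξ η :=
    (mul_le_mul_of_nonneg_right hhalf (Real.rpow_nonneg (apply_nonneg N η) p)).trans
      (mul_rpow_le_powBregman hp hε hε1 h hξ)
  calc powBregman p N ℓ ξ ((2 : ℝ) • η) ≤ (3 ^ p + 2 * p) * N η ^ p :=
        powBregman_two_smul_le hp h (hξ.le.trans (mul_le_of_le_one_left (apply_nonneg N η) hε1))
    _ = 2 * (3 ^ p + 2 * p) * (1 / 2 * N η ^ p) := by ring
    _ ≤ 2 * (3 ^ p + 2 * p) * powBregman p N ℓ ξ η := by gcongr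

/-- Doubling passes from the power `s` to the power `p`: where the step `η` is large in comparison
with `ξ`, it holds for every power, and elsewhere the two Bregman distances are comparable. -/
theorem exists_powBregman_doubling (hp : 1 < p) (hs : 1 < s) {B : ℝ} (hB : 0 ≤ B) :
    ∃ C, 0 < C ∧ ∀ {E : Type*} [AddCommGroup E] [Module ℝ E] {N : Seminorm ℝ E}
      {ℓ : E →ₗ[ℝ] ℝ} {ξ : E}, IsSupporting N ℓ ξ → ∀ η,
        powBregman s N ℓ ξ ((2 : ℝ) • η) ≤ B * powBregman s N ℓ ξ η →
        powBregman p N ℓ ξ ((2 : ℝ) • η) ≤ C * powBregman p N ℓ ξ η := by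
  obtain ⟨ε, C, hε, hC, hlarge⟩ := exists_powBregman_doubling_of_lt hp
  obtain ⟨C₁, hC₁, h₁⟩ := exists_powBregman_div_le hp hs (1 + 2 / ε)
  obtain ⟨C₂, -, h₂⟩ := exists_powBregman_div_le hs hp (1 + 2 / ε)
  refine ⟨max C (C₁ * B * C₂), lt_max_of_lt_left hC, fun {E} _ _ N ℓ ξ h η hdouble => ?_⟩
  have hnonneg := powBregman_nonneg hp h η
  rcases lt_or_ge (N ξ) (ε * N η) with hξη | hξη
  · exact (hlarge h η hξη).trans (mul_le_mul_of_nonneg_right (le_max_left _ _) hnonneg)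
  have hη := apply_nonneg N η
  have hη' : N η ≤ N ξ / ε := by rwa [le_div_iff₀ hε, mul_comm]
  have hξη1 : N (ξ + η) ≤ N ξ + N η := map_add_le_add N _ _
  have hξη2 : N (ξ + (2 : ℝ) • η) ≤ N ξ + 2 * N η := by
    simpa [map_smul_eq_mul] using map_add_le_add N ξ ((2 : ℝ) • η)
  have eT : (1 + 2 / ε) * N ξ = N ξ + 2 * (N ξ / ε) := by ring
  rcases (apply_nonneg N ξ).eq_or_lt with h0 | h0
  · have hη0 : N η = 0 := le_antisymm (by rwa [← h0, zero_div] at hη') hη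
    have hend : N (ξ + (2 : ℝ) • η) = 0 := le_antisymm (by linarith) (apply_nonneg N _)
    refine le_trans (le_of_eq ?_) (mul_nonneg (hC.le.trans (le_max_left _ _)) hnonneg)
    rw [powBregman, ← h0, hend, Real.zero_rpow (by linarith), Real.zero_rpow (by linarith)]
    ring
  · have hchain : powBregman p N ℓ ξ ((2 : ℝ) • η) / N ξ ^ p ≤
        C₁ * B * C₂ * (powBregman p N ℓ ξ η / N ξ ^ p) := by
      calc _ ≤ C₁ * (powBregman s N ℓ ξ ((2 : ℝ) • η) / N ξ ^ s) :=
            h₁ h h0 _ (by rw [eT]; linarith)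
        _ ≤ C₁ * (B * powBregman s N ℓ ξ η / N ξ ^ s) := by gcongr
        _ = C₁ * B * (powBregman s N ℓ ξ η / N ξ ^ s) := by ring
        _ ≤ C₁ * B * (C₂ * (powBregman p N ℓ ξ η / N ξ ^ p)) := by
            gcongr
            exact h₂ h h0 _ (by rw [eT]; linarith)
        _ = _ := by ring
    rw [← mul_div_assoc, div_le_div_iff_of_pos_right (by positivity)] at hchain
    exact hchain.trans (mul_le_mul_of_nonneg_right (le_max_right _ _) hnonneg)

theorem powBregman_smul_le (hp : 1 ≤ p) {c : ℝ} (hc0 : 0 ≤ c) (hc1 : c ≤ 1) (ℓ : E →ₗ[ℝ] ℝ)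
    (ξ η : E) : powBregman p N ℓ ξ (c • η) ≤ c * powBregman p N ℓ ξ η := by
  have hN : N (ξ + c • η) ≤ (1 - c) * N ξ + c * N (ξ + η) := by
    have e : ξ + c • η = (1 - c) • ξ + c • (ξ + η) := by module
    have := map_add_le_add N ((1 - c) • ξ) (c • (ξ + η))
    rwa [← e, map_smul_eq_mul, map_smul_eq_mul, Real.norm_of_nonneg hc0,
      Real.norm_of_nonneg (sub_nonneg.2 hc1)] at this
  have hconv : N (ξ + c • η) ^ p ≤ (1 - c) * N ξ ^ p + c * N (ξ + η) ^ p :=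
    (Real.rpow_le_rpow (apply_nonneg N _) hN (by linarith)).trans
      ((convexOn_rpow hp).2 (mem_Ici.2 (apply_nonneg N ξ)) (mem_Ici.2 (apply_nonneg N (ξ + η)))
        (sub_nonneg.2 hc1) hc0 (by ring))
  rw [powBregman, powBregman, map_smul, smul_eq_mul]
  linear_combination hconv

theorem powBregman_smul_mono (hp : 1 < p) (h : IsSupporting N ℓ ξ) {r l : ℝ} (hr : 0 ≤ r)
    (hrl : r ≤ l) (η : E) : powBregman p N ℓ ξ (r • η) ≤ powBregman p N ℓ ξ (l • η) := by
  rcases hr.eq_or_lt with rfl | hr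
  · simpa [powBregman] using powBregman_nonneg hp h (l • η)
  have hl : 0 < l := hr.trans_le hrl
  have hc1 : r / l ≤ 1 := (div_le_one hl).2 hrl
  calc powBregman p N ℓ ξ (r • η) = powBregman p N ℓ ξ ((r / l) • l • η) := by
        rw [smul_smul, div_mul_cancel₀ _ hl.ne']
    _ ≤ r / l * powBregman p N ℓ ξ (l • η) := powBregman_smul_le hp.le (by positivity) hc1 ℓ ξ _
    _ ≤ powBregman p N ℓ ξ (l • η) :=
        mul_le_of_le_one_left (powBregman_nonneg hp h _) hc1

theorem powBregman_smul_le_of_doubling (hp : 1 < p) (h : IsSupporting N ℓ ξ) {m : ℕ}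
    (hdouble : ∀ η, powBregman p N ℓ ξ ((2 : ℝ) • η) ≤ 2 ^ m * powBregman p N ℓ ξ η) {l : ℝ}
    (hl : 1 ≤ l) (η : E) : powBregman p N ℓ ξ (l • η) ≤ (2 * l) ^ m * powBregman p N ℓ ξ η := by
  have hpow (k : ℕ) : powBregman p N ℓ ξ ((2 : ℝ) ^ k • η) ≤
      ((2 : ℝ) ^ k) ^ m * powBregman p N ℓ ξ η := by
    induction k with
    | zero => simp
    | succ k ih =>
      calc _ = powBregman p N ℓ ξ ((2 : ℝ) • (2 : ℝ) ^ k • η) := by rw [smul_smul, pow_succ']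
        _ ≤ 2 ^ m * powBregman p N ℓ ξ ((2 : ℝ) ^ k • η) := hdouble _
        _ ≤ 2 ^ m * (((2 : ℝ) ^ k) ^ m * powBregman p N ℓ ξ η) := by gcongr
        _ = _ := by rw [pow_succ', mul_pow]; ring
  obtain ⟨k, hkl, hlk⟩ := exists_nat_pow_near hl (one_lt_two (α := ℝ))
  have hnonneg := powBregman_nonneg hp h η
  calc _ ≤ powBregman p N ℓ ξ ((2 : ℝ) ^ (k + 1) • η) :=
        powBregman_smul_mono hp h (by linarith) hlk.le η
    _ ≤ ((2 : ℝ) ^ (k + 1)) ^ m * powBregman p N ℓ ξ η := hpow (k + 1)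
    _ ≤ _ := by
      rw [pow_succ']
      gcongr

end PowBregman

/-! ### The weighted `ℓˢ` norm and its Bregman distances -/

theorem abs_rpow_sub_two_mul_sq {s : ℝ} (hs : 0 < s) (y : ℝ) : |y| ^ (s - 2) * y * y = |y| ^ s := by
  rcases eq_or_ne y 0 with rfl | hy
  · simp [Real.zero_rpow hs.ne']
  · rw [mul_assoc, ← abs_mul_abs_self y, ← sq, ← Real.rpow_natCast, ← Real.rpow_add (by positivity)]
    norm_num

section SaNorm

variable {n : ℕ} {p s : ℝ} {a : Eu n → Fin n → ℝ} {x ξ : Eu n}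

theorem sum_mul_abs_rpow_nonneg (ha : ∀ i, 0 < a x i) (ξ : Eu n) : 0 ≤ ∑ i, a x i * |ξ i| ^ s :=
  Finset.sum_nonneg fun i _ => mul_nonneg (ha i).le (by positivity)

theorem saNorm_nonneg (ha : ∀ i, 0 < a x i) (ξ : Eu n) : 0 ≤ saNorm s a x ξ :=
  Real.rpow_nonneg (sum_mul_abs_rpow_nonneg ha ξ) _

theorem saNorm_rpow (ha : ∀ i, 0 < a x i) (ξ : Eu n) (r : ℝ) :
    saNorm s a x ξ ^ r = (∑ i, a x i * |ξ i| ^ s) ^ (r / s) := by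
  rw [saNorm, ← Real.rpow_mul (sum_mul_abs_rpow_nonneg ha ξ), one_div_mul_eq_div]

theorem saNorm_rpow_self (hs : 0 < s) (ha : ∀ i, 0 < a x i) (ξ : Eu n) :
    saNorm s a x ξ ^ s = ∑ i, a x i * |ξ i| ^ s := by
  rw [saNorm_rpow ha, div_self hs.ne', Real.rpow_one]

theorem saNorm_zero (hs : 0 < s) : saNorm s a x 0 = 0 := by
  simp [saNorm, Real.zero_rpow hs.ne', hs.ne']

theorem saNorm_pos (ha : ∀ i, 0 < a x i) (hξ : ξ ≠ 0) : 0 < saNorm s a x ξ := by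
  obtain ⟨i, hi⟩ : ∃ i, ξ i ≠ 0 := by
    by_contra! h
    exact hξ (by ext i; simpa using h i)
  refine Real.rpow_pos_of_pos (Finset.sum_pos' (fun j _ => ?_) ⟨i, Finset.mem_univ i, ?_⟩) _
  · exact mul_nonneg (ha j).le (by positivity)
  · exact mul_pos (ha i) (Real.rpow_pos_of_pos (abs_pos.2 hi) s)

theorem saNorm_smul (hs : 0 < s) (ha : ∀ i, 0 < a x i) (c : ℝ) (ξ : Eu n) :
    saNorm s a x (c • ξ) = |c| * saNorm s a x ξ := by
  have h : ∑ i, a x i * |(c • ξ) i| ^ s = |c| ^ s * ∑ i, a x i * |ξ i| ^ s := by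
    rw [Finset.mul_sum]
    refine Finset.sum_congr rfl fun i _ => ?_
    rw [PiLp.smul_apply, smul_eq_mul, abs_mul, Real.mul_rpow (abs_nonneg _) (abs_nonneg _)]
    ring
  rw [saNorm, h, Real.mul_rpow (by positivity) (sum_mul_abs_rpow_nonneg ha ξ), ← saNorm,
    one_div, Real.rpow_rpow_inv (abs_nonneg c) hs.ne']

theorem saNorm_add_le (hs : 1 ≤ s) (ha : ∀ i, 0 < a x i) (ξ η : Eu n) :
    saNorm s a x (ξ + η) ≤ saNorm s a x ξ + saNorm s a x η := by
  have h (ζ : Eu n) : saNorm s a x ζ = (∑ i, |a x i ^ (1 / s) * ζ i| ^ s) ^ (1 / s) := by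
    rw [saNorm]
    congr! 2 with i
    rw [abs_mul, Real.mul_rpow (abs_nonneg _) (abs_nonneg _),
      abs_of_nonneg (Real.rpow_nonneg (ha i).le _), one_div,
      Real.rpow_inv_rpow (ha i).le (by linarith)]
  rw [h, h, h]
  simpa only [PiLp.add_apply, mul_add] using Real.Lp_add_le _ _ _ hs

theorem saNorm_le_mul_norm (hs : 0 < s) (ha : ∀ i, 0 < a x i) (ξ : Eu n) :
    saNorm s a x ξ ≤ (∑ i, a x i) ^ (1 / s) * ‖ξ‖ := by
  have hA : 0 ≤ ∑ i, a x i := Finset.sum_nonneg fun i _ => (ha i).le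
  have h : ∑ i, a x i * |ξ i| ^ s ≤ (∑ i, a x i) * ‖ξ‖ ^ s := by
    rw [Finset.sum_mul]
    refine Finset.sum_le_sum fun i _ => mul_le_mul_of_nonneg_left ?_ (ha i).le
    exact Real.rpow_le_rpow (abs_nonneg _) (by simpa using PiLp.norm_apply_le ξ i) hs.le
  calc saNorm s a x ξ ≤ ((∑ i, a x i) * ‖ξ‖ ^ s) ^ (1 / s) :=
        Real.rpow_le_rpow (sum_mul_abs_rpow_nonneg ha ξ) h (by positivity)
    _ = _ := by
        rw [Real.mul_rpow hA (by positivity), one_div, Real.rpow_rpow_inv (norm_nonneg _) hs.ne']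

/-- `|·|_{s,a}` at the point `x`, as a seminorm. -/
def saSeminorm (hs : 1 ≤ s) (ha : ∀ i, 0 < a x i) : Seminorm ℝ (Eu n) :=
  Seminorm.of (saNorm s a x) (saNorm_add_le hs ha) (saNorm_smul (zero_lt_one.trans_le hs) ha)

/-- The gradient of `|·|_{s,a}` at `ξ ≠ 0`; it is `0` at `ξ = 0`. -/
def saGrad (s : ℝ) (a : Eu n → Fin n → ℝ) (x ξ : Eu n) : Eu n :=
  WithLp.toLp 2 fun i => saNorm s a x ξ ^ (1 - s) * (a x i * (|ξ i| ^ (s - 2) * ξ i))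

theorem saGrad_zero : saGrad s a x 0 = 0 := by
  ext i
  simp [saGrad]

theorem inner_saGrad (ξ η : Eu n) : inner ℝ (saGrad s a x ξ) η =
    saNorm s a x ξ ^ (1 - s) * ∑ i, a x i * (|ξ i| ^ (s - 2) * ξ i * η i) := by
  rw [PiLp.inner_apply, Finset.mul_sum]
  refine Finset.sum_congr rfl fun i _ => ?_
  rw [saGrad, RCLike.inner_apply, conj_trivial]
  ring

theorem inner_saGrad_self (hs : 0 < s) (ha : ∀ i, 0 < a x i) (ξ : Eu n) :
    inner ℝ (saGrad s a x ξ) ξ = saNorm s a x ξ := by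
  rcases eq_or_ne ξ 0 with rfl | hξ
  · rw [saGrad_zero, inner_zero_left, saNorm_zero hs]
  · simp only [inner_saGrad, abs_rpow_sub_two_mul_sq hs]
    rw [← saNorm_rpow_self hs ha, ← Real.rpow_add (saNorm_pos ha hξ), sub_add_cancel,
      Real.rpow_one]

theorem sum_mul_rpow_sub_two_mul_le (hs : 1 < s) (ha : ∀ i, 0 < a x i) (ξ η : Eu n) :
    ∑ i, a x i * (|ξ i| ^ (s - 2) * ξ i * η i) ≤ saNorm s a x ξ ^ (s - 1) * saNorm s a x η := by
  have hs0 : 0 < s := by linarith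
  -- Hölder's inequality for the quotients `|ηᵢ| / |ξᵢ|` and the weights `aᵢ |ξᵢ| ^ s`
  have hw (i : Fin n) : 0 ≤ a x i * |ξ i| ^ s := mul_nonneg (ha i).le (by positivity)
  have hterm (i : Fin n) : a x i * (|ξ i| ^ (s - 2) * ξ i * η i) ≤
      a x i * |ξ i| ^ s * (|η i| / |ξ i|) := by
    rw [mul_assoc (a x i)]
    refine mul_le_mul_of_nonneg_left ?_ (ha i).le
    rcases eq_or_ne (ξ i) 0 with h | h
    · simp [h]
    · rw [← abs_rpow_sub_two_mul_sq hs0, mul_assoc, mul_assoc, mul_assoc]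
      refine mul_le_mul_of_nonneg_left ((le_abs_self _).trans (le_of_eq ?_)) (by positivity)
      rw [abs_mul, ← mul_assoc (ξ i), ← abs_mul_abs_self (ξ i)]
      field_simp
  have hpow (i : Fin n) : a x i * |ξ i| ^ s * (|η i| / |ξ i|) ^ s ≤ a x i * |η i| ^ s := by
    rw [mul_assoc, ← Real.mul_rpow (abs_nonneg _) (by positivity)]
    have := (ha i).le
    gcongr
    rw [mul_div_left_comm]
    exact mul_le_of_le_one_right (abs_nonneg _) (div_self_le_one _)
  calc ∑ i, a x i * (|ξ i| ^ (s - 2) * ξ i * η i)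
      ≤ ∑ i, a x i * |ξ i| ^ s * (|η i| / |ξ i|) := Finset.sum_le_sum fun i _ => hterm i
    _ ≤ (∑ i, a x i * |ξ i| ^ s) ^ (1 - s⁻¹) *
        (∑ i, a x i * |ξ i| ^ s * (|η i| / |ξ i|) ^ s) ^ s⁻¹ :=
      Real.inner_le_weight_mul_Lp_of_nonneg _ hs.le _ _ hw fun i => by positivity
    _ ≤ (∑ i, a x i * |ξ i| ^ s) ^ (1 - s⁻¹) * (∑ i, a x i * |η i| ^ s) ^ s⁻¹ := by
      refine mul_le_mul_of_nonneg_left (Real.rpow_le_rpow ?_ ?_ (by positivity))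
        (Real.rpow_nonneg (sum_mul_abs_rpow_nonneg ha ξ) _)
      · exact Finset.sum_nonneg fun i _ => mul_nonneg (hw i) (by positivity)
      · exact Finset.sum_le_sum fun i _ => hpow i
    _ = saNorm s a x ξ ^ (s - 1) * saNorm s a x η := by
      rw [saNorm_rpow ha, saNorm, one_div, sub_div, div_self hs0.ne', one_div]

theorem isSupporting_saGrad (hs : 1 < s) (ha : ∀ i, 0 < a x i) (ξ : Eu n) :
    IsSupporting (saSeminorm hs.le ha) (innerₗ (Eu n) (saGrad s a x ξ)) ξ where
  apply_self := inner_saGrad_self (zero_lt_one.trans hs) ha ξ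
  le η := by
    rw [innerₗ_apply_apply]
    rcases eq_or_ne ξ 0 with rfl | hξ
    · rw [saGrad_zero, inner_zero_left]
      exact saNorm_nonneg ha η
    · have hpos := saNorm_pos (s := s) ha hξ
      calc inner ℝ (saGrad s a x ξ) η
          ≤ saNorm s a x ξ ^ (1 - s) * (saNorm s a x ξ ^ (s - 1) * saNorm s a x η) := by
            rw [inner_saGrad]
            gcongr
            exact sum_mul_rpow_sub_two_mul_le hs ha ξ η
        _ = saNorm s a x η := by
            rw [← mul_assoc, ← Real.rpow_add hpos, sub_add_sub_cancel', sub_self, Real.rpow_zero,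
              one_mul]

theorem hasGradientAt_saNorm_rpow_zero (hp : 1 < p) (hs : 0 < s) (ha : ∀ i, 0 < a x i) :
    HasGradientAt (fun ζ : Eu n => 1 / p * saNorm s a x ζ ^ p) 0 0 := by
  rw [hasGradientAt_iff_hasFDerivAt, map_zero]
  have hnorm := hasFDerivAt_norm_rpow (E := Eu n) 0 hp
  simp only [map_zero, smul_zero] at hnorm
  refine HasFDerivAt.of_isLittleO (Asymptotics.IsBigO.trans_isLittleO ?_ hnorm.isLittleO)
  refine Asymptotics.IsBigO.of_bound (1 / p * ((∑ i, a x i) ^ (1 / s)) ^ p)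
    (Filter.Eventually.of_forall fun ζ => ?_)
  have hp0 : p ≠ 0 := by linarith
  simp only [saNorm_zero hs, Real.zero_rpow hp0, norm_zero, mul_zero, sub_zero,
    zero_apply]
  have hA : 0 ≤ ∑ i, a x i := Finset.sum_nonneg fun i _ => (ha i).le
  have hN := saNorm_nonneg (s := s) ha ζ
  rw [Real.norm_of_nonneg (by positivity), Real.norm_of_nonneg (by positivity), mul_assoc,
    ← Real.mul_rpow (by positivity) (norm_nonneg _)]
  gcongr
  exact saNorm_le_mul_norm hs ha ζ

theorem hasGradientAt_saNorm_rpow (hp : p ≠ 0) (hs : 1 < s) (ha : ∀ i, 0 < a x i) (hξ : ξ ≠ 0) :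
    HasGradientAt (fun ζ : Eu n => 1 / p * saNorm s a x ζ ^ p)
      (saNorm s a x ξ ^ (p - 1) • saGrad s a x ξ) ξ := by
  have hs0 : 0 < s := zero_lt_one.trans hs
  have hpos := saNorm_pos (s := s) ha hξ
  have hsum : HasFDerivAt (fun ζ : Eu n => ∑ i, a x i * |ζ i| ^ s)
      (∑ i, a x i • ((s * |ξ i| ^ (s - 2) * ξ i) • (EuclideanSpace.proj i : Eu n →L[ℝ] ℝ))) ξ := by
    refine HasFDerivAt.fun_sum fun i _ => ?_
    exact ((hasDerivAt_abs_rpow (ξ i) hs).comp_hasFDerivAt ξ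
      (EuclideanSpace.proj i : Eu n →L[ℝ] ℝ).hasFDerivAt).const_mul (a x i)
  have hne : ∑ i, a x i * |ξ i| ^ s ≠ 0 := by
    rw [← saNorm_rpow_self hs0 ha]
    positivity
  simp only [saNorm_rpow ha _ p, hasGradientAt_iff_hasFDerivAt]
  refine ((hsum.rpow_const (p := p / s) (Or.inl hne)).const_mul (1 / p)).congr_fderiv ?_
  ext η
  have e : (∑ i, a x i * |ξ i| ^ s) ^ (p / s - 1) =
      saNorm s a x ξ ^ (p - 1) * saNorm s a x ξ ^ (1 - s) := by
    rw [← Real.rpow_add hpos, saNorm_rpow ha]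
    congr 1
    field_simp
    ring
  rw [InnerProductSpace.toDual_apply_apply, real_inner_smul_left, inner_saGrad, ← mul_assoc, ← e]
  simp only [smul_apply, sum_apply, smul_eq_mul,
    Finset.mul_sum]
  refine Finset.sum_congr rfl fun i _ => ?_
  field_simp
  rfl

theorem opA_eq (hp : 1 < p) (hs : 1 < s) (ha : ∀ i, 0 < a x i) (ξ : Eu n) :
    opA p s a x ξ = saNorm s a x ξ ^ (p - 1) • saGrad s a x ξ := by
  rcases eq_or_ne ξ 0 with rfl | hξ
  · rw [saGrad_zero, smul_zero]
    exact (hasGradientAt_saNorm_rpow_zero hp (zero_lt_one.trans hs) ha).gradient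
  · exact (hasGradientAt_saNorm_rpow (by linarith) hs ha hξ).gradient

theorem inner_opA (hp : 1 < p) (hs : 1 < s) (ha : ∀ i, 0 < a x i) (ξ η : Eu n) :
    inner ℝ (opA p s a x ξ) η = saNorm s a x ξ ^ (p - 1) * inner ℝ (saGrad s a x ξ) η := by
  rw [opA_eq hp hs ha, real_inner_smul_left]

theorem abs_inner_opA_le (hp : 1 < p) (hs : 1 < s) (ha : ∀ i, 0 < a x i) (ξ η : Eu n) :
    |inner ℝ (opA p s a x ξ) η| ≤ saNorm s a x ξ ^ (p - 1) * saNorm s a x η := by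
  have hN := Real.rpow_nonneg (saNorm_nonneg (s := s) ha ξ) (p - 1)
  rw [inner_opA hp hs ha, abs_mul, abs_of_nonneg hN]
  exact mul_le_mul_of_nonneg_left ((isSupporting_saGrad hs ha ξ).abs_apply_le η) hN

theorem inner_opA_self (hp : 1 < p) (hs : 1 < s) (ha : ∀ i, 0 < a x i) (ξ : Eu n) :
    inner ℝ (opA p s a x ξ) ξ = saNorm s a x ξ ^ p := by
  rw [inner_opA hp hs ha, inner_saGrad_self (zero_lt_one.trans hs) ha,
    ← Real.rpow_add_one' (saNorm_nonneg ha ξ) (by linarith), sub_add_cancel]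

theorem opA_smul (hp : 1 < p) (hs : 1 < s) (ha : ∀ i, 0 < a x i) (c : ℝ) (ξ : Eu n) :
    opA p s a x (c • ξ) = (|c| ^ (p - 2) * c) • opA p s a x ξ := by
  rw [opA_eq hp hs ha, opA_eq hp hs ha]
  rcases eq_or_ne c 0 with rfl | hc
  · simp [saGrad_zero]
  ext i
  have hc0 : 0 < |c| := abs_pos.2 hc
  simp only [saGrad, PiLp.smul_apply, smul_eq_mul, saNorm_smul (zero_lt_one.trans hs) ha, abs_mul]
  rw [Real.mul_rpow hc0.le (saNorm_nonneg ha _), Real.mul_rpow hc0.le (saNorm_nonneg ha _),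
    Real.mul_rpow hc0.le (abs_nonneg _), show p - 2 = (p - 1) + ((1 - s) + (s - 2)) by ring,
    Real.rpow_add hc0, Real.rpow_add hc0]
  ring

end SaNorm

/-- The Bregman distance from `ξ` to `ξ + η` of `|·|_{s,a}^p` at the point `x`. -/
def bregman {n : ℕ} (p s : ℝ) (a : Eu n → Fin n → ℝ) (x ξ η : Eu n) : ℝ :=
  saNorm s a x (ξ + η) ^ p - saNorm s a x ξ ^ p - p * inner ℝ (opA p s a x ξ) η

/-- The supporting functional `w ↦ sign y * w` of the absolute value at `y`. -/
def signFunctional (y : ℝ) : ℝ →ₗ[ℝ] ℝ := (SignType.sign y : ℝ) • LinearMap.id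

section Bregman

variable {n : ℕ} {p s : ℝ} {a : Eu n → Fin n → ℝ} {x : Eu n}

theorem bregman_eq_powBregman (hp : 1 < p) (hs : 1 < s) (ha : ∀ i, 0 < a x i) (ξ η : Eu n) :
    bregman p s a x ξ η =
      powBregman p (saSeminorm hs.le ha) (innerₗ (Eu n) (saGrad s a x ξ)) ξ η := by
  rw [bregman, inner_opA hp hs ha]
  rfl

theorem bregman_nonneg (hp : 1 < p) (hs : 1 < s) (ha : ∀ i, 0 < a x i) (ξ η : Eu n) :
    0 ≤ bregman p s a x ξ η := by
  rw [bregman_eq_powBregman hp hs ha]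
  exact powBregman_nonneg hp (isSupporting_saGrad hs ha ξ) η

theorem bregman_zero_right (ξ : Eu n) : bregman p s a x ξ 0 = 0 := by
  simp [bregman]

theorem bregman_smul (hp : 1 < p) (hs : 1 < s) (ha : ∀ i, 0 < a x i) (c : ℝ) (ξ η : Eu n) :
    bregman p s a x (c • ξ) (c • η) = |c| ^ p * bregman p s a x ξ η := by
  have hs0 : 0 < s := zero_lt_one.trans hs
  rw [bregman, bregman, ← smul_add, saNorm_smul hs0 ha, saNorm_smul hs0 ha, opA_smul hp hs ha,
    real_inner_smul_left, inner_smul_right, ← mul_assoc (|c| ^ (p - 2) * c),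
    abs_rpow_sub_two_mul_sq (by linarith), Real.mul_rpow (abs_nonneg _) (saNorm_nonneg ha _),
    Real.mul_rpow (abs_nonneg _) (saNorm_nonneg ha _)]
  ring

theorem isSupporting_signFunctional (y : ℝ) :
    IsSupporting (normSeminorm ℝ ℝ) (signFunctional y) y where
  apply_self := sign_mul_self y
  le w := by
    have hsign : |(SignType.sign y : ℝ)| ≤ 1 := by
      rcases lt_trichotomy y 0 with h | h | h <;> simp [h]
    calc (SignType.sign y : ℝ) * w ≤ |(SignType.sign y : ℝ)| * |w| := by
          rw [← abs_mul]
          exact le_abs_self _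
      _ ≤ |w| := mul_le_of_le_one_left (abs_nonneg w) hsign

theorem powBregman_signFunctional (hs : 1 < s) (y w : ℝ) :
    powBregman s (normSeminorm ℝ ℝ) (signFunctional y) y w =
      |y + w| ^ s - |y| ^ s - s * (|y| ^ (s - 2) * y * w) := by
  have e : |y| ^ (s - 1) * SignType.sign y = |y| ^ (s - 2) * y := by
    rw [show s - 1 = s - 2 + 1 by ring, Real.rpow_add_one' (abs_nonneg y) (by linarith), mul_assoc,
      abs_mul_sign]
  rw [← e, mul_assoc]
  rfl

theorem exists_powBregman_signFunctional_two_mul_le (hs : 1 < s) :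
    ∃ C, 0 < C ∧ ∀ y w : ℝ, powBregman s (normSeminorm ℝ ℝ) (signFunctional y) y ((2 : ℝ) • w) ≤
      C * powBregman s (normSeminorm ℝ ℝ) (signFunctional y) y w := by
  obtain ⟨C, hC, h⟩ := exists_powBregman_doubling hs one_lt_two zero_le_four
  refine ⟨C, hC, fun y w => h (isSupporting_signFunctional y) w (le_of_eq ?_)⟩
  simp only [powBregman_signFunctional one_lt_two, Real.rpow_two, sq_abs, sub_self, Real.rpow_zero,
    smul_eq_mul]
  ring

theorem bregman_self_eq_sum (hs : 1 < s) (ha : ∀ i, 0 < a x i) (ξ η : Eu n) :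
    bregman s s a x ξ η =
      ∑ i, a x i * powBregman s (normSeminorm ℝ ℝ) (signFunctional (ξ i)) (ξ i) (η i) := by
  have hs0 : 0 < s := zero_lt_one.trans hs
  have hinner : inner ℝ (opA s s a x ξ) η = ∑ i, a x i * (|ξ i| ^ (s - 2) * ξ i * η i) := by
    rw [inner_opA hs hs ha, inner_saGrad]
    rcases eq_or_ne ξ 0 with rfl | hξ
    · simp
    · rw [← mul_assoc, ← Real.rpow_add (saNorm_pos ha hξ), sub_add_sub_cancel', sub_self,
        Real.rpow_zero, one_mul]
  rw [bregman, hinner, saNorm_rpow_self hs0 ha, saNorm_rpow_self hs0 ha, Finset.mul_sum,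
    ← Finset.sum_sub_distrib, ← Finset.sum_sub_distrib]
  refine Finset.sum_congr rfl fun i _ => ?_
  rw [powBregman_signFunctional hs, PiLp.add_apply]
  ring

end Bregman

/-- The constant depends neither on the dimension nor on the coefficients: for `p = s` the Bregman
distance is a weighted sum over the coordinates, so that doubling reduces to that of `|·| ^ s`
on `ℝ`, which in turn follows from the quadratic case. -/
theorem exists_bregman_two_smul_le {p s : ℝ} (hp : 1 < p) (hs : 1 < s) :
    ∃ C, 0 < C ∧ ∀ (n : ℕ) (a : Eu n → Fin n → ℝ) (x : Eu n), (∀ i, 0 < a x i) →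
      ∀ ξ η : Eu n, bregman p s a x ξ ((2 : ℝ) • η) ≤ C * bregman p s a x ξ η := by
  obtain ⟨B, hB, hscalar⟩ := exists_powBregman_signFunctional_two_mul_le hs
  obtain ⟨C, hC, hdouble⟩ := exists_powBregman_doubling hp hs hB.le
  refine ⟨C, hC, fun n a x ha ξ η => ?_⟩
  simp only [bregman_eq_powBregman hp hs ha]
  refine hdouble (isSupporting_saGrad hs ha ξ) η ?_
  simp only [← bregman_eq_powBregman hs hs ha, bregman_self_eq_sum hs ha, Finset.mul_sum]
  refine Finset.sum_le_sum fun i _ => ?_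
  rw [mul_left_comm B]
  exact mul_le_mul_of_nonneg_left (hscalar _ _) (ha i).le

theorem exists_bregman_smul_le {p s : ℝ} (hp : 1 < p) (hs : 1 < s) :
    ∃ m : ℕ, ∀ (n : ℕ) (a : Eu n → Fin n → ℝ) (x : Eu n), (∀ i, 0 < a x i) →
      ∀ (ξ η : Eu n) (l : ℝ), 1 ≤ l →
        bregman p s a x ξ (l • η) ≤ (2 * l) ^ m * bregman p s a x ξ η := by
  obtain ⟨C, -, hdouble⟩ := exists_bregman_two_smul_le hp hs
  obtain ⟨m, hm⟩ := pow_unbounded_of_one_lt C (one_lt_two (α := ℝ))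
  refine ⟨m, fun n a x ha ξ η l hl => ?_⟩
  simp only [bregman_eq_powBregman hp hs ha]
  refine powBregman_smul_le_of_doubling hp (isSupporting_saGrad hs ha ξ) (fun ζ => ?_) hl η
  simp only [← bregman_eq_powBregman hp hs ha]
  exact (hdouble n a x ha ξ ζ).trans
    (mul_le_mul_of_nonneg_right hm.le (bregman_nonneg hp hs ha ξ ζ))

theorem bregman_smul_mono {n : ℕ} {p s : ℝ} {a : Eu n → Fin n → ℝ} {x : Eu n} (hp : 1 < p)
    (hs : 1 < s) (ha : ∀ i, 0 < a x i) {r l : ℝ} (hr : 0 ≤ r) (hrl : r ≤ l) (ξ η : Eu n) :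
    bregman p s a x ξ (r • η) ≤ bregman p s a x ξ (l • η) := by
  simp only [bregman_eq_powBregman hp hs ha]
  exact powBregman_smul_mono hp (isSupporting_saGrad hs ha ξ) hr hrl η

/-! ### Smooth cutoffs -/

/-- A smooth cutoff, which vanishes on `|r| ≤ 1` and equals `1` on `2 ≤ |r|`. Raising it to a high
power `k` controls its logarithmic derivative near `|r| = 1`. -/
def cutoff (k : ℕ) (r : ℝ) : ℝ := Real.smoothTransition (r ^ 2 - 1) ^ k

theorem contDiff_cutoff (k : ℕ) : ContDiff ℝ 1 (cutoff k) := by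
  unfold cutoff
  have := Real.smoothTransition.contDiff (n := 1)
  fun_prop

theorem sq_sub_one_nonpos {r : ℝ} (h : |r| ≤ 1) : r ^ 2 - 1 ≤ 0 :=
  sub_nonpos.2 ((sq_le_one_iff_abs_le_one r).2 h)

theorem one_le_sq_sub_one {r : ℝ} (h : 2 ≤ |r|) : 1 ≤ r ^ 2 - 1 := by
  rw [← sq_abs]
  nlinarith

theorem cutoff_eq_zero {k : ℕ} (hk : k ≠ 0) {r : ℝ} (h : |r| ≤ 1) : cutoff k r = 0 := by
  rw [cutoff, Real.smoothTransition.zero_of_nonpos (sq_sub_one_nonpos h), zero_pow hk]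

theorem cutoff_eq_one (k : ℕ) {r : ℝ} (h : 2 ≤ |r|) : cutoff k r = 1 := by
  rw [cutoff, Real.smoothTransition.one_of_one_le (one_le_sq_sub_one h), one_pow]

theorem deriv_smoothTransition_of_nonpos {y : ℝ} (hy : y ≤ 0) :
    deriv Real.smoothTransition y = 0 := by
  refine IsLocalMin.deriv_eq_zero (Filter.Eventually.of_forall fun z => ?_)
  simpa only [Real.smoothTransition.zero_of_nonpos hy] using Real.smoothTransition.nonneg z

theorem deriv_smoothTransition_of_one_le {y : ℝ} (hy : 1 ≤ y) :
    deriv Real.smoothTransition y = 0 := by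
  refine IsLocalMax.deriv_eq_zero (Filter.Eventually.of_forall fun z => ?_)
  simpa only [Real.smoothTransition.one_of_one_le hy] using Real.smoothTransition.le_one z

theorem exists_deriv_smoothTransition_le :
    ∃ B : ℝ, 1 ≤ B ∧ ∀ y, deriv Real.smoothTransition y ≤ B := by
  have hc : Continuous (deriv Real.smoothTransition) :=
    (Real.smoothTransition.contDiff (n := 1)).continuous_deriv le_rfl
  obtain ⟨B, hB⟩ := (isCompact_Icc (a := (0 : ℝ)) (b := 1)).exists_bound_of_continuousOn
    hc.continuousOn
  refine ⟨max 1 B, le_max_left _ _, fun y => ?_⟩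
  rcases le_total y 0 with h0 | h0
  · rw [deriv_smoothTransition_of_nonpos h0]
    positivity
  rcases le_total 1 y with h1 | h1
  · rw [deriv_smoothTransition_of_one_le h1]
    positivity
  · exact (le_abs_self _).trans ((hB y ⟨h0, h1⟩).trans (le_max_right _ _))

theorem hasDerivAt_cutoff (k : ℕ) (r : ℝ) :
    HasDerivAt (cutoff k) (k * Real.smoothTransition (r ^ 2 - 1) ^ (k - 1) *
      (deriv Real.smoothTransition (r ^ 2 - 1) * (2 * r))) r := by
  have hsq : HasDerivAt (fun r : ℝ => r ^ 2 - 1) (2 * r) r := by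
    simpa using (hasDerivAt_pow 2 r).sub_const 1
  have hσ := ((Real.smoothTransition.contDiff (n := 1)).differentiable one_ne_zero
    (r ^ 2 - 1)).hasDerivAt
  exact (hσ.comp r hsq).pow k

theorem deriv_cutoff_eq_zero (k : ℕ) {r : ℝ} (h : |r| ≤ 1 ∨ 2 ≤ |r|) :
    deriv (cutoff k) r = 0 := by
  rw [(hasDerivAt_cutoff k r).deriv]
  rcases h with h | h
  · rw [deriv_smoothTransition_of_nonpos (sq_sub_one_nonpos h), zero_mul, mul_zero]
  · rw [deriv_smoothTransition_of_one_le (one_le_sq_sub_one h), zero_mul, mul_zero]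

/-- The quotient `q = r f'(r) / f(r)` of `f = cutoff k` is `O(f(r) ^ (-1 / k))`. -/
theorem exists_deriv_cutoff_eq {k : ℕ} (hk : k ≠ 0) : ∃ B : ℝ, 1 ≤ B ∧ ∀ r, 1 ≤ |r| → |r| < 2 →
    ∃ q, 0 ≤ q ∧ deriv (cutoff k) r = cutoff k r / r * q ∧
      q * Real.smoothTransition (r ^ 2 - 1) ≤ B := by
  obtain ⟨B, hB1, hB⟩ := exists_deriv_smoothTransition_le
  have hk1 : (1 : ℝ) ≤ k := Nat.one_le_cast.2 (Nat.one_le_iff_ne_zero.2 hk)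
  refine ⟨k * (B * 8), by nlinarith, fun r hr1 hr2 => ?_⟩
  have hr0 : r ≠ 0 := abs_pos.1 (zero_lt_one.trans_le hr1)
  have hσ' : 0 ≤ deriv Real.smoothTransition (r ^ 2 - 1) :=
    Real.smoothTransition.monotone.deriv_nonneg
  have hsq : r ^ 2 ≤ 4 := by nlinarith [sq_abs r]
  rw [(hasDerivAt_cutoff k r).deriv, cutoff]
  rcases (Real.smoothTransition.nonneg (r ^ 2 - 1)).eq_or_lt with hσ | hσ
  · have hy : r ^ 2 - 1 ≤ 0 := not_lt.1 fun h => (Real.smoothTransition.pos_of_pos h).ne hσ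
    refine ⟨0, le_rfl, ?_, by rw [zero_mul]; positivity⟩
    rw [deriv_smoothTransition_of_nonpos hy, zero_mul, mul_zero, mul_zero]
  · refine ⟨k * (deriv Real.smoothTransition (r ^ 2 - 1) * (2 * r ^ 2)) /
      Real.smoothTransition (r ^ 2 - 1), by positivity, ?_, ?_⟩
    · rw [← pow_sub_one_mul hk]
      field_simp
    · rw [div_mul_cancel₀ _ hσ.ne']
      gcongr
      · exact hB _
      · linarith

theorem exists_bregman_cutoff_le {p s : ℝ} (hp : 1 < p) (hs : 1 < s) :
    ∃ (k : ℕ) (C : ℝ), k ≠ 0 ∧ 0 < C ∧ ∀ (n : ℕ) (a : Eu n → Fin n → ℝ) (x : Eu n),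
      (∀ i, 0 < a x i) → ∀ (ξ η : Eu n) (r : ℝ),
        bregman p s a x (cutoff k r • ξ) (deriv (cutoff k) r • η) ≤
          if 1 ≤ |r| ∧ |r| < 2 then C * bregman p s a x (r • ξ) η else 0 := by
  obtain ⟨m, hm⟩ := exists_bregman_smul_le hp hs
  obtain ⟨B, hB1, hB⟩ := exists_deriv_cutoff_eq m.succ_ne_zero
  refine ⟨m + 1, (2 * B) ^ m, m.succ_ne_zero, by positivity, fun n a x ha ξ η r => ?_⟩
  split_ifs with hr
  swap
  · rw [deriv_cutoff_eq_zero, zero_smul, bregman_zero_right]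
    by_contra! h
    exact hr ⟨h.1.le, h.2⟩
  obtain ⟨q, hq0, hdq, hqB⟩ := hB r hr.1 hr.2
  set g := Real.smoothTransition (r ^ 2 - 1)
  have hg0 : 0 ≤ g := Real.smoothTransition.nonneg _
  have hg1 : g ≤ 1 := Real.smoothTransition.le_one _
  have hr0 : r ≠ 0 := abs_pos.1 (zero_lt_one.trans_le hr.1)
  have hscale : bregman p s a x (cutoff (m + 1) r • ξ) (deriv (cutoff (m + 1)) r • η) =
      (g ^ (m + 1) / |r|) ^ p * bregman p s a x (r • ξ) (q • η) := by
    rw [show g ^ (m + 1) / |r| = |cutoff (m + 1) r / r| by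
        rw [abs_div, cutoff, abs_of_nonneg (pow_nonneg hg0 _)],
      ← bregman_smul hp hs ha, smul_smul, smul_smul, div_mul_cancel₀ _ hr0, hdq]
  rw [hscale]
  rcases hg0.eq_or_lt with hgz | hgpos
  · rw [← hgz, zero_pow m.succ_ne_zero, zero_div, Real.zero_rpow (by linarith), zero_mul]
    exact mul_nonneg (by positivity) (bregman_nonneg hp hs ha _ _)
  have hfactor : (g ^ (m + 1) / |r|) ^ p ≤ g ^ m := by
    have h1 : g ^ (m + 1) / |r| ≤ g ^ (m + 1) := div_le_self (by positivity) hr.1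
    calc (g ^ (m + 1) / |r|) ^ p ≤ g ^ (m + 1) / |r| :=
          Real.rpow_le_self_of_le_one (by positivity) (h1.trans (pow_le_one₀ hg0 hg1)) hp.le
      _ ≤ g ^ (m + 1) := h1
      _ ≤ g ^ m := pow_le_pow_of_le_one hg0 hg1 m.le_succ
  have hgrowth : bregman p s a x (r • ξ) (q • η) ≤
      (2 * (B / g)) ^ m * bregman p s a x (r • ξ) η :=
    (bregman_smul_mono hp hs ha hq0 ((le_div_iff₀ hgpos).2 hqB) _ _).trans
      (hm n a x ha _ _ _ ((one_le_div hgpos).2 (hg1.trans hB1)))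
  calc (g ^ (m + 1) / |r|) ^ p * bregman p s a x (r • ξ) (q • η)
      ≤ g ^ m * ((2 * (B / g)) ^ m * bregman p s a x (r • ξ) η) :=
        mul_le_mul hfactor hgrowth (bregman_nonneg hp hs ha _ _) (by positivity)
    _ = (2 * B) ^ m * bregman p s a x (r • ξ) η := by
        rw [← mul_assoc, ← mul_pow, mul_left_comm, mul_div_cancel₀ _ hgpos.ne']

/-! ### Mollification in `Lᵖ` -/

section Mollification

open scoped Convolution Topology
open ContinuousLinearMap Filter Measure

variable {E F : Type*} [NormedAddCommGroup E] [NormedSpace ℝ E] [FiniteDimensional ℝ E]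
  [MeasurableSpace E] [BorelSpace E] {ν : Measure E} [ν.IsAddHaarMeasure]
  [NormedAddCommGroup F]

theorem tendsto_eLpNorm_translate_sub {p : ℝ≥0∞} (hp1 : 1 ≤ p) (hp : p ≠ ∞) {G : E → F}
    (hG : MemLp G p ν) : Tendsto (fun y => eLpNorm (fun x => G (x - y) - G x) p ν) (𝓝 0) (𝓝 0) := by
  have : Fact (1 ≤ p) := ⟨hp1⟩
  let τ : E → C(E, E) := fun y => ⟨fun x => x - y, by fun_prop⟩
  have hτ : Continuous τ := ContinuousMap.continuous_of_continuous_uncurry _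
    (continuous_snd.sub continuous_fst)
  have hm : ∀ y, MeasurePreserving (τ y) ν ν := measurePreserving_sub_right ν
  have hT : Continuous fun y => Lp.compMeasurePreserving (τ y) (hm y) (hG.toLp G) :=
    continuous_const.compMeasurePreservingLp hτ hm hp
  refine ((tendsto_iff_edist_tendsto_0).1 (hT.tendsto 0)).congr fun y => ?_
  have hτG : ∀ y, (Lp.compMeasurePreserving (τ y) (hm y) (hG.toLp G) : E → F) =ᵐ[ν] G ∘ τ y :=
    fun y => (Lp.coeFn_compMeasurePreserving _ (hm y)).trans
      ((hm y).quasiMeasurePreserving.ae_eq_comp hG.coeFn_toLp)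
  rw [Lp.edist_def]
  refine eLpNorm_congr_ae (((hτG y).sub (hτG 0)).trans (ae_of_all _ fun x => ?_))
  simp [τ]

theorem lintegral_enorm_normed (φ : ContDiffBump (0 : E)) : ∫⁻ y, ‖φ.normed ν y‖ₑ ∂ν = 1 := by
  rw [← ofReal_integral_norm_eq_lintegral_enorm φ.integrable_normed]
  simp [abs_of_nonneg (φ.nonneg_normed _), φ.integral_normed]

variable [NormedSpace ℝ F]

theorem enorm_integral_smul_rpow_le {α : Type*} [MeasurableSpace α] {μ : Measure α} {ρ : α → ℝ}
    (hρ : AEStronglyMeasurable ρ μ) (hρ1 : ∫⁻ y, ‖ρ y‖ₑ ∂μ ≤ 1) {H : α → F}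
    (hH : AEStronglyMeasurable H μ) {r : ℝ} (hr : 1 ≤ r) :
    ‖∫ y, ρ y • H y ∂μ‖ₑ ^ r ≤ ∫⁻ y, ‖ρ y‖ₑ * ‖H y‖ₑ ^ r ∂μ := by
  have hr0 : 0 < r := by linarith
  have hr' : 0 ≤ 1 - r⁻¹ := sub_nonneg.2 (inv_le_one_of_one_le₀ hr)
  rw [← ENNReal.le_rpow_inv_iff hr0]
  calc ‖∫ y, ρ y • H y ∂μ‖ₑ
      ≤ ∫⁻ y, ‖ρ y‖ₑ ^ (1 - r⁻¹) * (‖ρ y‖ₑ * ‖H y‖ₑ ^ r) ^ r⁻¹ ∂μ := by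
        refine (enorm_integral_le_lintegral_enorm _).trans_eq (lintegral_congr fun y => ?_)
        rw [enorm_smul, ENNReal.mul_rpow_of_nonneg _ _ (by positivity),
          ENNReal.rpow_rpow_inv hr0.ne', ← mul_assoc,
          ← ENNReal.rpow_add_of_nonneg _ _ hr' (by positivity), sub_add_cancel, ENNReal.rpow_one]
    _ ≤ (∫⁻ y, ‖ρ y‖ₑ ∂μ) ^ (1 - r⁻¹) * (∫⁻ y, ‖ρ y‖ₑ * ‖H y‖ₑ ^ r ∂μ) ^ r⁻¹ :=
        ENNReal.lintegral_mul_norm_pow_le hρ.enorm (hρ.enorm.mul (hH.enorm.pow_const r)) hr'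
          (by positivity) (sub_add_cancel _ _)
    _ ≤ (∫⁻ y, ‖ρ y‖ₑ * ‖H y‖ₑ ^ r ∂μ) ^ r⁻¹ :=
        mul_le_of_le_one_left' (ENNReal.rpow_le_one hρ1 hr')

variable [CompleteSpace F]

theorem enorm_normed_convolution_sub_rpow_le (φ : ContDiffBump (0 : E)) {G : E → F}
    (hG : LocallyIntegrable G ν) {r : ℝ} (hr : 1 ≤ r) (x : E) :
    ‖(φ.normed ν ⋆[lsmul ℝ ℝ, ν] G) x - G x‖ₑ ^ r ≤
      ∫⁻ y, ‖φ.normed ν y‖ₑ * ‖G (x - y) - G x‖ₑ ^ r ∂ν := by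
  have hInt : Integrable (fun y => φ.normed ν y • G (x - y)) ν :=
    φ.hasCompactSupport_normed.convolutionExists_left (lsmul ℝ ℝ) φ.continuous_normed hG x
  have heq : (φ.normed ν ⋆[lsmul ℝ ℝ, ν] G) x - G x =
      ∫ y, φ.normed ν y • (G (x - y) - G x) ∂ν := by
    simp only [smul_sub]
    rw [integral_sub hInt (φ.integrable_normed.smul_const _), φ.integral_normed_smul]
    rfl
  have hmeas : AEStronglyMeasurable (fun y => G (x - y) - G x) ν :=
    (hG.aestronglyMeasurable.comp_quasiMeasurePreserving
      (quasiMeasurePreserving_sub_left_of_right_invariant ν x)).sub aestronglyMeasurable_const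
  rw [heq]
  exact enorm_integral_smul_rpow_le φ.continuous_normed.aestronglyMeasurable
    (lintegral_enorm_normed φ).le hmeas hr

theorem eLpNorm_normed_convolution_sub_le {p : ℝ≥0∞} (hp1 : 1 ≤ p) (hp : p ≠ ∞) {G : E → F}
    (hG : MemLp G p ν) {ε : ℝ≥0∞} (φ : ContDiffBump (0 : E))
    (h : ∀ y, ‖y‖ < φ.rOut → eLpNorm (fun x => G (x - y) - G x) p ν ≤ ε) :
    eLpNorm (fun x => (φ.normed ν ⋆[lsmul ℝ ℝ, ν] G) x - G x) p ν ≤ ε := by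
  have hp0 : p ≠ 0 := (one_pos.trans_le hp1).ne'
  have hr1 : 1 ≤ p.toReal := by simpa using ENNReal.toReal_mono hp hp1
  have hr0 : 0 < p.toReal := by linarith
  have hle_iff : ∀ H : E → F, eLpNorm H p ν ≤ ε ↔ ∫⁻ x, ‖H x‖ₑ ^ p.toReal ∂ν ≤ ε ^ p.toReal :=
    fun H => by
      rw [eLpNorm_eq_lintegral_rpow_enorm_toReal hp0 hp, one_div, ENNReal.rpow_inv_le_iff hr0]
  have hsub : AEStronglyMeasurable (fun z : E × E => G (z.1 - z.2) - G z.1) (ν.prod ν) :=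
    (hG.1.comp_quasiMeasurePreserving (quasiMeasurePreserving_sub_of_right_invariant ν ν)).sub
      hG.1.comp_fst
  rw [hle_iff]
  calc ∫⁻ x, ‖(φ.normed ν ⋆[lsmul ℝ ℝ, ν] G) x - G x‖ₑ ^ p.toReal ∂ν
      ≤ ∫⁻ x, ∫⁻ y, ‖φ.normed ν y‖ₑ * ‖G (x - y) - G x‖ₑ ^ p.toReal ∂ν ∂ν :=
        lintegral_mono (enorm_normed_convolution_sub_rpow_le φ (hG.locallyIntegrable hp1) hr1)
    _ = ∫⁻ y, ∫⁻ x, ‖φ.normed ν y‖ₑ * ‖G (x - y) - G x‖ₑ ^ p.toReal ∂ν ∂ν :=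
        lintegral_lintegral_swap
          ((φ.continuous_normed.comp continuous_snd).enorm.aemeasurable.mul
            (hsub.enorm.pow_const _))
    _ = ∫⁻ y, ‖φ.normed ν y‖ₑ * ∫⁻ x, ‖G (x - y) - G x‖ₑ ^ p.toReal ∂ν ∂ν :=
        lintegral_congr fun y => lintegral_const_mul' _ _ enorm_ne_top
    _ ≤ ∫⁻ y, ‖φ.normed ν y‖ₑ * ε ^ p.toReal ∂ν := by
        refine lintegral_mono fun y => ?_
        by_cases hy : ‖y‖ < φ.rOut
        · gcongr
          exact (hle_iff _).1 (h y hy)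
        · have hy0 : φ.normed ν y = 0 := by
            rw [← Function.notMem_support, φ.support_normed_eq]
            simpa using hy
          simp [hy0]
    _ = ε ^ p.toReal := by
        rw [lintegral_mul_const _ φ.continuous_normed.enorm.measurable,
          lintegral_enorm_normed, one_mul]

end Mollification

/-! ### Weak gradients -/

section WeakGrad

open scoped Topology
open Filter

variable {n : ℕ} {Ω U : Set (Eu n)} {f f' η : Eu n → ℝ} {G G' : Eu n → Eu n}

theorem gradient_apply (f : Eu n → ℝ) (x : Eu n) (i : Fin n) :
    gradient f x i = fderiv ℝ f x (EuclideanSpace.single i 1) := by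
  simp [← inner_gradient_left, EuclideanSpace.inner_single_right]

theorem continuous_gradient (hf : ContDiff ℝ 1 f) : Continuous (gradient f) :=
  (InnerProductSpace.toDual ℝ (Eu n)).symm.continuous.comp (hf.continuous_fderiv one_ne_zero)

theorem gradient_of_notMem_tsupport {x : Eu n} (hx : x ∉ tsupport f) : gradient f x = 0 := by
  rw [gradient, fderiv_of_notMem_tsupport ℝ hx, map_zero]

theorem IsCc.eq_zero (hη : IsCc Ω η) {x : Eu n} (hx : x ∉ Ω) : η x = 0 :=
  image_eq_zero_of_notMem_tsupport (mt (@hη.2.2 x) hx)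

theorem IsTest.isCc (hη : IsTest Ω η) : IsCc Ω η :=
  ⟨hη.1.continuous, hη.2⟩

theorem IsTest.contDiff_one (hη : IsTest Ω η) : ContDiff ℝ 1 η :=
  hη.1.of_le (by exact_mod_cast le_top)

theorem IsTest.mono (hη : IsTest U η) (hU : U ⊆ Ω) : IsTest Ω η :=
  ⟨hη.1, hη.2.1, hη.2.2.trans hU⟩

theorem IsTest.tsupport (hη : IsTest Ω η) : IsTest (tsupport η) η :=
  ⟨hη.1, hη.2.1, subset_rfl⟩

theorem IsTest.fderiv_apply (hη : IsTest Ω η) (v : Eu n) : IsTest Ω (fderiv ℝ η · v) :=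
  ⟨(hη.1.fderiv_right (by norm_cast)).clm_apply contDiff_const, hη.2.1.fderiv_apply ℝ v,
    (tsupport_fderiv_apply_subset ℝ v).trans hη.2.2⟩

theorem IsCc.setIntegral_mul (hη : IsCc Ω η) (H : Eu n → ℝ) :
    ∫ x in Ω, H x * η x = ∫ x, H x * η x :=
  setIntegral_eq_integral_of_forall_compl_eq_zero fun x hx => by rw [hη.eq_zero hx, mul_zero]

theorem IsCc.integrable_mul (hη : IsCc Ω η) {H : Eu n → ℝ} (hH : LocallyIntegrableOn H Ω) :
    Integrable fun x => H x * η x := by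
  have hK : IntegrableOn (fun x => H x * η x) (tsupport η) :=
    (hH.integrableOn_compact_subset hη.2.2 hη.2.1).mul_continuousOn hη.1.continuousOn hη.2.1
  refine (integrableOn_iff_integrable_of_support_subset fun x hx => ?_).1 hK
  exact subset_tsupport η (right_ne_zero_of_mul hx)

theorem locallyIntegrableOn_apply (hG : LocallyIntegrableOn G U) (i : Fin n) :
    LocallyIntegrableOn (fun x => G x i) U := fun x hx => by
  obtain ⟨u, hu, h⟩ := hG x hx
  exact ⟨u, hu, (EuclideanSpace.proj i : Eu n →L[ℝ] ℝ).integrable_comp h⟩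

theorem HasWeakGrad.integral_eq (h : HasWeakGrad Ω f G) (hη : IsTest Ω η) (i : Fin n) :
    ∫ x, f x * fderiv ℝ η x (EuclideanSpace.single i 1) = -∫ x, G x i * η x := by
  rw [← (hη.fderiv_apply _).isCc.setIntegral_mul, h.2.2 η hη i, hη.isCc.setIntegral_mul]

theorem hasWeakGrad_of_integral_eq (hf : LocallyIntegrableOn f Ω) (hG : LocallyIntegrableOn G Ω)
    (h : ∀ η, IsTest Ω η → ∀ i : Fin n,
      ∫ x, f x * fderiv ℝ η x (EuclideanSpace.single i 1) = -∫ x, G x i * η x) :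
    HasWeakGrad Ω f G := by
  refine ⟨hf, hG, fun η hη i => ?_⟩
  rw [(hη.fderiv_apply _).isCc.setIntegral_mul, h η hη i, hη.isCc.setIntegral_mul]

theorem HasWeakGrad.mono (h : HasWeakGrad Ω f G) (hU : U ⊆ Ω) : HasWeakGrad U f G :=
  hasWeakGrad_of_integral_eq (h.1.mono_set hU) (h.2.1.mono_set hU)
    fun _ hη i => h.integral_eq (hη.mono hU) i

theorem HasWeakGrad.congr_left (hΩ : IsOpen Ω) (h : HasWeakGrad Ω f G) (hf : EqOn f f' Ω) :
    HasWeakGrad Ω f' G := by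
  refine ⟨h.1.congr (ae_restrict_of_forall_mem hΩ.measurableSet hf), h.2.1, fun η hη i => ?_⟩
  rw [← h.2.2 η hη i]
  exact setIntegral_congr_fun hΩ.measurableSet fun x hx => by simp only [hf hx]

theorem HasWeakGrad.ae_eq (hΩ : IsOpen Ω) (h : HasWeakGrad Ω f G) (h' : HasWeakGrad Ω f G') :
    G =ᵐ[volume.restrict Ω] G' := by
  have hcoord : ∀ i : Fin n, ∀ᵐ x ∂(volume : Measure (Eu n)), x ∈ Ω → G x i - G' x i = 0 := by
    intro i
    have hi := locallyIntegrableOn_apply h.2.1 i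
    have hi' := locallyIntegrableOn_apply h'.2.1 i
    refine hΩ.ae_eq_zero_of_integral_contDiff_smul_eq_zero (hi.sub hi') fun η hη hηc hηs => ?_
    have hη : IsTest Ω η := ⟨hη, hηc, hηs⟩
    have heq := neg_injective ((h.integral_eq hη i).symm.trans (h'.integral_eq hη i))
    simp only [smul_eq_mul, mul_comm (η _), sub_mul]
    rw [integral_sub (hη.isCc.integrable_mul hi) (hη.isCc.integrable_mul hi'), heq, sub_self]
  rw [EventuallyEq, ae_restrict_iff' hΩ.measurableSet]
  filter_upwards [ae_all_iff.2 hcoord] with x hx hxΩ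
  ext i
  exact sub_eq_zero.1 (hx i hxΩ)

theorem HasWeakGrad.weakGrad_self (h : HasWeakGrad Ω f G) : HasWeakGrad Ω f (weakGrad Ω f) := by
  have hex : ∃ G, HasWeakGrad Ω f G := ⟨G, h⟩
  rw [weakGrad, dif_pos hex]
  exact hex.choose_spec

theorem HasWeakGrad.weakGrad_ae_eq (hΩ : IsOpen Ω) (h : HasWeakGrad Ω f G) :
    weakGrad Ω f =ᵐ[volume.restrict Ω] G :=
  HasWeakGrad.ae_eq hΩ h.weakGrad_self h

theorem hasWeakGrad_zero : HasWeakGrad Ω (0 : Eu n → ℝ) 0 :=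
  ⟨locallyIntegrableOn_zero, locallyIntegrableOn_zero, fun η _ i => by simp⟩

theorem HasWeakGrad.ae_eq_zero (hΩ : IsOpen Ω) (h : HasWeakGrad Ω f G) {K : Set (Eu n)}
    (hK : IsClosed K) (hf : ∀ x ∉ K, f x = 0) : ∀ᵐ x ∂(volume.restrict Ω), x ∉ K → G x = 0 := by
  have hU : IsOpen (Ω ∩ Kᶜ) := hΩ.inter hK.isOpen_compl
  have h0 : HasWeakGrad (Ω ∩ Kᶜ) f 0 := hasWeakGrad_zero.congr_left hU fun x hx => (hf x hx.2).symm
  have hae := HasWeakGrad.ae_eq hU (h.mono inter_subset_left) h0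
  rw [EventuallyEq, ae_restrict_iff' hU.measurableSet] at hae
  rw [ae_restrict_iff' hΩ.measurableSet]
  filter_upwards [hae] with x hx h1 h2 using hx ⟨h1, h2⟩

theorem hasWeakGrad_of_hasGradientAt (hΩ : IsOpen Ω) (hf : ∀ x ∈ Ω, HasGradientAt f (G x) x)
    (hG : ContinuousOn G Ω) : HasWeakGrad Ω f G := by
  have hfc : ContinuousOn f Ω := fun x hx => (hf x hx).continuousAt.continuousWithinAt
  have hfl := hfc.locallyIntegrableOn hΩ.measurableSet (μ := volume)
  have hGl := hG.locallyIntegrableOn hΩ.measurableSet (μ := volume)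
  refine hasWeakGrad_of_integral_eq hfl hGl fun η hη i => ?_
  have hG_apply : ∀ x, G x i = InnerProductSpace.toDual ℝ _ (G x) (EuclideanSpace.single i 1) :=
    fun x => by simp [EuclideanSpace.inner_single_right]
  simp only [hG_apply]
  exact integral_bilinear_hasFDerivAt_right_eq_neg_left_of_integrable
    (B := ContinuousLinearMap.mul ℝ ℝ)
    (by simpa only [← hG_apply, ContinuousLinearMap.mul_apply'] using
      hη.isCc.integrable_mul (locallyIntegrableOn_apply hGl i))
    ((hη.fderiv_apply _).isCc.integrable_mul hfl) (hη.isCc.integrable_mul hfl)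
    (fun x hx => (hf x (hη.2.2 hx)).hasFDerivAt)
    fun x _ => (hη.contDiff_one.differentiable one_ne_zero x).hasFDerivAt

theorem hasWeakGrad_of_contDiff (hΩ : IsOpen Ω) (hf : ContDiff ℝ 1 f) :
    HasWeakGrad Ω f (gradient f) :=
  hasWeakGrad_of_hasGradientAt hΩ (fun x _ => (hf.differentiable one_ne_zero x).hasGradientAt)
    (continuous_gradient hf).continuousOn

end WeakGrad

section Approximation

open scoped Convolution Topology
open ContinuousLinearMap Filter

variable {n : ℕ} {Ω K : Set (Eu n)} {f : Eu n → ℝ} {G : Eu n → Eu n}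

theorem isTest_normed_comp_sub (φ : ContDiffBump (0 : Eu n)) {x : Eu n}
    (hx : Metric.closedBall x φ.rOut ⊆ K) : IsTest K fun t => φ.normed volume (x - t) := by
  have hsupp : tsupport (fun t => φ.normed volume (x - t)) = Metric.closedBall x φ.rOut := by
    have h := tsupport_comp_eq_preimage (φ.normed volume) (Homeomorph.subLeft x)
    rw [φ.tsupport_normed_eq] at h
    refine h.trans (ext fun t => ?_)
    simp [dist_eq_norm, norm_sub_rev]
  exact ⟨φ.contDiff_normed.comp (contDiff_const.sub contDiff_id),
    by rw [HasCompactSupport, hsupp]; exact isCompact_closedBall _ _, hsupp.trans_subset hx⟩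

theorem fderiv_convolution_left_apply {E : Type*} [NormedAddCommGroup E] [NormedSpace ℝ E]
    [FiniteDimensional ℝ E] [MeasurableSpace E] [BorelSpace E] {μ : Measure E}
    [μ.IsAddHaarMeasure] {ρ g : E → ℝ} (hρc : HasCompactSupport ρ) (hρ : ContDiff ℝ 1 ρ)
    (hg : LocallyIntegrable g μ) (x v : E) :
    fderiv ℝ (ρ ⋆[lsmul ℝ ℝ, μ] g) x v = ∫ t, fderiv ℝ ρ (x - t) v * g t ∂μ := by
  have hInt : Integrable
      (fun t => (lsmul ℝ ℝ).precompL E (fderiv ℝ ρ (x - t)) (g t)) μ :=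
    ((hρc.fderiv ℝ).convolutionExists_left _ (hρ.continuous_fderiv one_ne_zero) hg
      x).integrable_swap
  rw [(hρc.hasFDerivAt_convolution_left (lsmul ℝ ℝ) hρ hg x).fderiv, convolution_eq_swap,
    ContinuousLinearMap.integral_apply hInt]
  rfl

theorem fderiv_comp_sub_left {E F : Type*} [NormedAddCommGroup E] [NormedSpace ℝ E]
    [NormedAddCommGroup F] [NormedSpace ℝ F] (ρ : E → F) (x t : E) :
    fderiv ℝ (fun t => ρ (x - t)) t = -fderiv ℝ ρ (x - t) := by
  have h := (ContinuousLinearEquiv.neg ℝ : E ≃L[ℝ] E).comp_right_fderiv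
    (f := fun y => ρ (x + y)) (x := t)
  ext v
  simp only [ContinuousLinearEquiv.coe_neg, Function.comp_def, Pi.neg_apply, id_eq,
    ← sub_eq_add_neg, fderiv_comp_add_left] at h
  simp [h]

theorem HasWeakGrad.gradient_convolution (h : HasWeakGrad K f G) (hK : MeasurableSet K)
    (hf : LocallyIntegrable (K.indicator f)) (hG : LocallyIntegrable (K.indicator G))
    (φ : ContDiffBump (0 : Eu n)) {x : Eu n} (hx : Metric.closedBall x φ.rOut ⊆ K) :
    gradient (φ.normed volume ⋆[lsmul ℝ ℝ, volume] K.indicator f) x =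
      (φ.normed volume ⋆[lsmul ℝ ℝ, volume] K.indicator G) x := by
  have hη := isTest_normed_comp_sub φ hx
  ext i
  have hInt : Integrable fun t => φ.normed volume (x - t) • K.indicator G t :=
    (φ.hasCompactSupport_normed.convolutionExists_left (lsmul ℝ ℝ) φ.continuous_normed hG
      x).integrable_swap
  calc gradient (φ.normed volume ⋆[lsmul ℝ ℝ, volume] K.indicator f) x i
      = ∫ t, fderiv ℝ (φ.normed volume) (x - t) (EuclideanSpace.single i 1) * K.indicator f t := by
        rw [gradient_apply, fderiv_convolution_left_apply φ.hasCompactSupport_normed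
          φ.contDiff_normed hf]
    _ = -∫ t in K, f t * fderiv ℝ (fun t => φ.normed volume (x - t)) t
          (EuclideanSpace.single i 1) := by
        rw [← integral_indicator hK, ← integral_neg]
        refine integral_congr_ae (ae_of_all _ fun t => ?_)
        by_cases ht : t ∈ K <;> simp [ht, fderiv_comp_sub_left, mul_comm]
    _ = ∫ t in K, G t i * φ.normed volume (x - t) := by rw [h.2.2 _ hη i, neg_neg]
    _ = ∫ t, (φ.normed volume (x - t) • K.indicator G t) i := by
        rw [← integral_indicator hK]
        refine integral_congr_ae (ae_of_all _ fun t => ?_)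
        by_cases ht : t ∈ K <;> simp [ht, mul_comm]
    _ = (φ.normed volume ⋆[lsmul ℝ ℝ, volume] K.indicator G) x i := by
        rw [convolution_eq_swap]
        exact (EuclideanSpace.proj i : Eu n →L[ℝ] ℝ).integral_comp_comm hInt

theorem HasWeakGrad.exists_contDiff_approx (hΩ : IsOpen Ω) (h : HasWeakGrad Ω f G)
    (hf : ContinuousOn f Ω) {p : ℝ≥0∞} (hp1 : 1 ≤ p) (hp : p ≠ ∞)
    (hG : ∀ K : Set (Eu n), IsCompact K → K ⊆ Ω → MemLp G p (volume.restrict K))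
    (hK : IsCompact K) (hKΩ : K ⊆ Ω) {ε : ℝ} (hε : 0 < ε) :
    ∃ F : Eu n → ℝ, ContDiff ℝ ((⊤ : ℕ∞) : WithTop ℕ∞) F ∧ (∀ x ∈ K, dist (F x) (f x) ≤ ε) ∧
      eLpNorm (fun x => gradient F x - G x) p (volume.restrict K) ≤ ENNReal.ofReal ε := by
  obtain ⟨d, hd, hdΩ⟩ := hK.exists_cthickening_subset_open hΩ hKΩ
  set K' := Metric.cthickening d K
  have hK' : IsCompact K' := hK.cthickening
  have hKK' : K ⊆ K' := Metric.self_subset_cthickening K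
  have hf' : Integrable (K'.indicator f) :=
    ((hf.mono hdΩ).integrableOn_compact hK').integrable_indicator hK'.measurableSet
  have hG' : MemLp (K'.indicator G) p volume :=
    (memLp_indicator_iff_restrict hK'.measurableSet).2 (hG K' hK' hdΩ)
  have hconv := fun (φ : ContDiffBump (0 : Eu n)) x => (h.mono hdΩ).gradient_convolution (x := x)
    hK'.measurableSet hf'.locallyIntegrable (hG'.locallyIntegrable hp1) φ
  obtain ⟨d₁, hd₁, huc⟩ := Metric.uniformContinuousOn_iff.1
    (hK'.uniformContinuousOn_of_continuous (hf.mono hdΩ)) ε hε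
  obtain ⟨d₂, hd₂, htr⟩ := Metric.eventually_nhds_iff.1
    ((tendsto_eLpNorm_translate_sub hp1 hp hG').eventually_le_const (ENNReal.ofReal_pos.2 hε))
  set r := min d (min d₁ d₂)
  have hr : 0 < r := by positivity
  let φ : ContDiffBump (0 : Eu n) := ⟨r / 2, r, by linarith, by linarith⟩
  have hball : ∀ x ∈ K, Metric.closedBall x r ⊆ K' := fun x hx y hy =>
    Metric.mem_cthickening_of_dist_le y x d K hx (hy.trans (min_le_left _ _))
  refine ⟨φ.normed volume ⋆[lsmul ℝ ℝ, volume] K'.indicator f,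
    φ.hasCompactSupport_normed.contDiff_convolution_left _ φ.contDiff_normed hf'.locallyIntegrable,
    fun x hx => ?_, ?_⟩
  · rw [← indicator_of_mem (hKK' hx) f]
    refine φ.dist_normed_convolution_le hf'.aestronglyMeasurable fun y hy => ?_
    have hy' : y ∈ K' := hball x hx (Metric.ball_subset_closedBall hy)
    rw [indicator_of_mem (hKK' hx), indicator_of_mem hy']
    exact (huc y hy' x (hKK' hx) (hy.trans_le (by simp [φ, r]))).le
  · calc _ = eLpNorm (fun x => (φ.normed volume ⋆[lsmul ℝ ℝ, volume] K'.indicator G) x -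
            K'.indicator G x) p (volume.restrict K) := by
          refine eLpNorm_congr_ae (ae_restrict_of_forall_mem hK.measurableSet fun x hx => ?_)
          beta_reduce
          rw [hconv φ x (hball x hx), indicator_of_mem (hKK' hx)]
      _ ≤ _ := eLpNorm_mono_measure _ Measure.restrict_le_self
      _ ≤ _ := eLpNorm_normed_convolution_sub_le hp1 hp hG' φ fun y hy => htr
          (by simpa using hy.trans_le (by simp [φ, r]))

theorem HasWeakGrad.exists_contDiff_seq (hΩ : IsOpen Ω) (h : HasWeakGrad Ω f G)
    (hf : ContinuousOn f Ω) (hK : IsCompact K) (hKΩ : K ⊆ Ω) {d : ℝ} (hd : 0 < d) :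
    ∃ F : ℕ → Eu n → ℝ, (∀ k, ContDiff ℝ 1 (F k)) ∧ (∀ k, ∀ x ∈ K, dist (F k x) (f x) ≤ d) ∧
      (∀ x ∈ K, Tendsto (fun k => F k x) atTop (𝓝 (f x))) ∧
      Tendsto (fun k => eLpNorm (fun x => gradient (F k) x - G x) 1 (volume.restrict K)) atTop
        (𝓝 0) := by
  have hpos : ∀ k : ℕ, 0 < d * (1 / ((k : ℝ) + 1)) := fun k => by positivity
  choose F hF hFf hFG using fun k : ℕ => h.exists_contDiff_approx hΩ hf le_rfl ENNReal.one_ne_top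
    (fun K hK hKΩ => memLp_one_iff_integrable.2 (h.2.1.integrableOn_compact_subset hKΩ hK))
    hK hKΩ (hpos k)
  have hlim : Tendsto (fun k : ℕ => d * (1 / ((k : ℝ) + 1))) atTop (𝓝 0) := by
    simpa using tendsto_one_div_add_atTop_nhds_zero_nat.const_mul d
  refine ⟨F, fun k => (hF k).of_le (by exact_mod_cast le_top), fun k x hx => ?_, fun x hx => ?_, ?_⟩
  · refine (hFf k x hx).trans (mul_le_of_le_one_right hd.le ?_)
    rw [div_le_one (by positivity)]
    linarith [Nat.cast_nonneg (α := ℝ) k]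
  · rw [tendsto_iff_dist_tendsto_zero]
    exact squeeze_zero (fun _ => dist_nonneg) (fun k => hFf k x hx) hlim
  · refine tendsto_of_tendsto_of_tendsto_of_le_of_le tendsto_const_nhds ?_ (fun _ => zero_le) hFG
    simpa using ENNReal.tendsto_ofReal hlim

end Approximation

section ChainRule

open scoped Topology
open Filter

theorem tendsto_eLpNorm_smul_sub_smul {α E : Type*} [MeasurableSpace α] {μ : Measure α}
    [NormedAddCommGroup E] [NormedSpace ℝ E] {A : ℕ → α → ℝ} {A₀ : α → ℝ} {H : ℕ → α → E}
    {H₀ : α → E} {B : ℝ} (hA : ∀ k, AEStronglyMeasurable (A k) μ)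
    (hB : ∀ k, ∀ᵐ x ∂μ, ‖A k x‖ ≤ B)
    (hlim : ∀ᵐ x ∂μ, Tendsto (fun k => A k x) atTop (𝓝 (A₀ x)))
    (hH : ∀ k, AEStronglyMeasurable (H k) μ) (hH₀ : Integrable H₀ μ)
    (h : Tendsto (fun k => eLpNorm (fun x => H k x - H₀ x) 1 μ) atTop (𝓝 0)) :
    Tendsto (fun k => eLpNorm (fun x => A k x • H k x - A₀ x • H₀ x) 1 μ) atTop (𝓝 0) := by
  have hA₀ : AEStronglyMeasurable A₀ μ := aestronglyMeasurable_of_tendsto_ae _ hA hlim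
  have hfirst : Tendsto (fun k => ENNReal.ofReal B * eLpNorm (fun x => H k x - H₀ x) 1 μ) atTop
      (𝓝 0) := by
    simpa using ENNReal.Tendsto.const_mul h (.inr ENNReal.ofReal_ne_top)
  have hsecond : Tendsto (fun k => eLpNorm (fun x => A k x • H₀ x - A₀ x • H₀ x) 1 μ) atTop
      (𝓝 0) := by
    simp only [eLpNorm_one_eq_lintegral_enorm, ← ofReal_norm]
    refine tendsto_lintegral_norm_of_dominated_convergence (bound := fun x => B * ‖H₀ x‖)
      (fun k => (hA k).smul hH₀.1) (hH₀.norm.const_mul B).2 (fun k => ?_) ?_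
    · filter_upwards [hB k] with x hx
      exact (norm_smul_le _ _).trans (mul_le_mul_of_nonneg_right hx (norm_nonneg _))
    · filter_upwards [hlim] with x hx using hx.smul_const _
  refine tendsto_of_tendsto_of_tendsto_of_le_of_le tendsto_const_nhds
    (by simpa using hfirst.add hsecond) (fun _ => zero_le) fun k => ?_
  calc eLpNorm (fun x => A k x • H k x - A₀ x • H₀ x) 1 μ
      = eLpNorm ((fun x => A k x • (H k x - H₀ x)) + fun x => A k x • H₀ x - A₀ x • H₀ x) 1 μ := by
        congr 1
        ext1 x
        simp [smul_sub]
    _ ≤ eLpNorm (fun x => A k x • (H k x - H₀ x)) 1 μ +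
          eLpNorm (fun x => A k x • H₀ x - A₀ x • H₀ x) 1 μ :=
        eLpNorm_add_le ((hA k).smul ((hH k).sub hH₀.1))
          (((hA k).smul hH₀.1).sub (hA₀.smul hH₀.1)) le_rfl
    _ ≤ _ := by
        gcongr
        refine eLpNorm_le_mul_eLpNorm_of_ae_le_mul ?_ 1
        filter_upwards [hB k] with x hx
        exact (norm_smul_le _ _).trans (mul_le_mul_of_nonneg_right hx (norm_nonneg _))

variable {n : ℕ} {Ω K : Set (Eu n)}

theorem tendsto_setIntegral_mul_of_isCompact {F : ℕ → Eu n → ℝ} {f w : Eu n → ℝ}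
    (hK : IsCompact K) (hw : Continuous w) (hF : ∀ k, IntegrableOn (F k) K)
    (hf : IntegrableOn f K)
    (h : Tendsto (fun k => eLpNorm (fun x => F k x - f x) 1 (volume.restrict K)) atTop (𝓝 0)) :
    Tendsto (fun k => ∫ x in K, F k x * w x) atTop (𝓝 (∫ x in K, f x * w x)) := by
  obtain ⟨B, hB⟩ := hK.exists_bound_of_continuousOn hw.continuousOn
  simp only [mul_comm _ (w _)]
  exact tendsto_integral_of_L1' _ (hf.continuousOn_mul hw.continuousOn hK).1
    (Eventually.of_forall fun k => (hF k).continuousOn_mul hw.continuousOn hK)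
    (tendsto_eLpNorm_smul_sub_smul (fun _ => hw.aestronglyMeasurable)
      (fun _ => ae_restrict_of_forall_mem hK.measurableSet hB)
      (ae_of_all _ fun _ => tendsto_const_nhds) (fun k => (hF k).1) hf h)

theorem tendsto_eLpNorm_comp_smul_sub {X E : Type*} [TopologicalSpace X] [NormedAddCommGroup E]
    [NormedSpace ℝ E] {F : ℕ → Eu n → X} {f : Eu n → X} {Z : Set X} {Ψ : X → ℝ}
    {H : ℕ → Eu n → E} {H₀ : Eu n → E} (hK : IsCompact K) (hZ : IsCompact Z)
    (hΨ : ContinuousOn Ψ Z) (hF : ∀ k, ContinuousOn (F k) K) (hFZ : ∀ k, MapsTo (F k) K Z)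
    (hfZ : MapsTo f K Z) (hlim : ∀ x ∈ K, Tendsto (fun k => F k x) atTop (𝓝 (f x)))
    (hH : ∀ k, AEStronglyMeasurable (H k) (volume.restrict K)) (hH₀ : IntegrableOn H₀ K)
    (h : Tendsto (fun k => eLpNorm (fun x => H k x - H₀ x) 1 (volume.restrict K)) atTop (𝓝 0)) :
    Tendsto (fun k => eLpNorm (fun x => Ψ (F k x) • H k x - Ψ (f x) • H₀ x) 1
      (volume.restrict K)) atTop (𝓝 0) := by
  obtain ⟨B, hB⟩ := hZ.exists_bound_of_continuousOn hΨ
  refine tendsto_eLpNorm_smul_sub_smul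
    (fun k => (hΨ.comp (hF k) (hFZ k)).aestronglyMeasurable hK.measurableSet)
    (fun k => ae_restrict_of_forall_mem hK.measurableSet fun x hx => hB _ (hFZ k hx))
    (ae_restrict_of_forall_mem hK.measurableSet fun x hx => ?_) hH hH₀ h
  exact (hΨ _ (hfZ hx)).tendsto.comp (tendsto_nhdsWithin_iff.2
    ⟨hlim x hx, Eventually.of_forall fun k => hFZ k hx⟩)

theorem tendsto_eLpNorm_add_sub_add {α E : Type*} [MeasurableSpace α] [NormedAddCommGroup E]
    {μ : Measure α} {F G : ℕ → α → E} {f g : α → E} (hF : ∀ k, AEStronglyMeasurable (F k) μ)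
    (hG : ∀ k, AEStronglyMeasurable (G k) μ) (hf : AEStronglyMeasurable f μ)
    (hg : AEStronglyMeasurable g μ)
    (hFf : Tendsto (fun k => eLpNorm (fun x => F k x - f x) 1 μ) atTop (𝓝 0))
    (hGg : Tendsto (fun k => eLpNorm (fun x => G k x - g x) 1 μ) atTop (𝓝 0)) :
    Tendsto (fun k => eLpNorm (fun x => F k x + G k x - (f x + g x)) 1 μ) atTop (𝓝 0) := by
  refine tendsto_of_tendsto_of_tendsto_of_le_of_le tendsto_const_nhds
    (by simpa using hFf.add hGg) (fun _ => zero_le) fun k => ?_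
  simp only [add_sub_add_comm]
  exact eLpNorm_add_le ((hF k).sub hf) ((hG k).sub hg) le_rfl

theorem hasWeakGrad_of_tendsto {f : Eu n → ℝ} {G : Eu n → Eu n} (hf : LocallyIntegrableOn f Ω)
    (hG : LocallyIntegrableOn G Ω)
    (h : ∀ K : Set (Eu n), IsCompact K → K ⊆ Ω → ∃ (F : ℕ → Eu n → ℝ) (D : ℕ → Eu n → Eu n),
      (∀ k, HasWeakGrad K (F k) (D k)) ∧
      Tendsto (fun k => eLpNorm (fun x => F k x - f x) 1 (volume.restrict K)) atTop (𝓝 0) ∧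
      Tendsto (fun k => eLpNorm (fun x => D k x - G x) 1 (volume.restrict K)) atTop (𝓝 0)) :
    HasWeakGrad Ω f G := by
  refine hasWeakGrad_of_integral_eq hf hG fun η hη i => ?_
  set K := tsupport η
  have hK : IsCompact K := hη.2.1
  obtain ⟨F, D, hFD, hF, hD⟩ := h K hK hη.2.2
  have hD_apply : Tendsto (fun k => eLpNorm (fun x => D k x i - G x i) 1 (volume.restrict K)) atTop
      (𝓝 0) :=
    tendsto_of_tendsto_of_tendsto_of_le_of_le tendsto_const_nhds hD (fun _ => zero_le)
      fun k => eLpNorm_mono fun x => PiLp.norm_apply_le (D k x - G x) i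
  have hleft := tendsto_setIntegral_mul_of_isCompact hK
    (hη.fderiv_apply (EuclideanSpace.single i 1)).1.continuous
    (fun k => (hFD k).1.integrableOn_isCompact hK)
    (hf.integrableOn_compact_subset hη.2.2 hK) hF
  have hright := tendsto_setIntegral_mul_of_isCompact hK hη.1.continuous
    (fun k => (locallyIntegrableOn_apply (hFD k).2.1 i).integrableOn_isCompact hK)
    ((locallyIntegrableOn_apply hG i).integrableOn_compact_subset hη.2.2 hK) hD_apply
  have heq := tendsto_nhds_unique hleft
    (hright.neg.congr fun k => ((hFD k).2.2 η hη.tsupport i).symm)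
  rwa [(hη.tsupport.fderiv_apply _).isCc.setIntegral_mul, hη.tsupport.isCc.setIntegral_mul] at heq

variable {f₁ f₂ : Eu n → ℝ} {U : Set (ℝ × ℝ)} {Φ Φ₁ Φ₂ : ℝ × ℝ → ℝ}

theorem hasWeakGrad_comp₂_of_contDiff (hf₁ : ContDiff ℝ 1 f₁) (hf₂ : ContDiff ℝ 1 f₂)
    (hU : IsOpen U) (hΦ₁ : ContinuousOn Φ₁ U) (hΦ₂ : ContinuousOn Φ₂ U)
    (hΦ : ∀ z ∈ U, HasFDerivAt Φ (Φ₁ z • ContinuousLinearMap.fst ℝ ℝ ℝ +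
      Φ₂ z • ContinuousLinearMap.snd ℝ ℝ ℝ) z) :
    HasWeakGrad ((fun x => (f₁ x, f₂ x)) ⁻¹' U) (fun x => Φ (f₁ x, f₂ x))
      (fun x => Φ₁ (f₁ x, f₂ x) • gradient f₁ x + Φ₂ (f₁ x, f₂ x) • gradient f₂ x) := by
  have hf : Continuous fun x => (f₁ x, f₂ x) := hf₁.continuous.prodMk hf₂.continuous
  refine hasWeakGrad_of_hasGradientAt (hU.preimage hf) (fun x hx => ?_) ?_
  · have h₁ := (hf₁.differentiable one_ne_zero x).hasFDerivAt
    have h₂ := (hf₂.differentiable one_ne_zero x).hasFDerivAt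
    refine hasGradientAt_iff_hasFDerivAt.2 (((hΦ _ hx).comp x (h₁.prodMk h₂)).congr_fderiv ?_)
    ext v
    simp
  · exact ((hΦ₁.comp hf.continuousOn fun _ => id).smul (continuous_gradient hf₁).continuousOn).add
      ((hΦ₂.comp hf.continuousOn fun _ => id).smul (continuous_gradient hf₂).continuousOn)

theorem HasWeakGrad.comp₂ {G₁ G₂ : Eu n → Eu n} (hΩ : IsOpen Ω) (h₁ : HasWeakGrad Ω f₁ G₁)
    (h₂ : HasWeakGrad Ω f₂ G₂) (hf₁ : ContinuousOn f₁ Ω) (hf₂ : ContinuousOn f₂ Ω)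
    (hU : IsOpen U) (hΦ₁ : ContinuousOn Φ₁ U) (hΦ₂ : ContinuousOn Φ₂ U)
    (hΦ : ∀ z ∈ U, HasFDerivAt Φ (Φ₁ z • ContinuousLinearMap.fst ℝ ℝ ℝ +
      Φ₂ z • ContinuousLinearMap.snd ℝ ℝ ℝ) z)
    (hfU : ∀ x ∈ Ω, (f₁ x, f₂ x) ∈ U) :
    HasWeakGrad Ω (fun x => Φ (f₁ x, f₂ x))
      (fun x => Φ₁ (f₁ x, f₂ x) • G₁ x + Φ₂ (f₁ x, f₂ x) • G₂ x) := by
  have hΦc : ContinuousOn Φ U := fun z hz => (hΦ z hz).continuousAt.continuousWithinAt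
  have hf : ContinuousOn (fun x => (f₁ x, f₂ x)) Ω := hf₁.prodMk hf₂
  have hloc₁ := h₁.2.1.continuousOn_smul hΩ.isLocallyClosed (hΦ₁.comp hf hfU)
  have hloc₂ := h₂.2.1.continuousOn_smul hΩ.isLocallyClosed (hΦ₂.comp hf hfU)
  refine hasWeakGrad_of_tendsto ((hΦc.comp hf hfU).locallyIntegrableOn hΩ.measurableSet)
    (hloc₁.add hloc₂) fun K hK hKΩ => ?_
  obtain ⟨d, hd, hdU⟩ := (hK.image_of_continuousOn (hf.mono hKΩ)).exists_cthickening_subset_open hU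
    (image_subset_iff.2 fun x hx => hfU x (hKΩ hx))
  set Z := Metric.cthickening d ((fun x => (f₁ x, f₂ x)) '' K)
  have hZ : IsCompact Z := (hK.image_of_continuousOn (hf.mono hKΩ)).cthickening
  obtain ⟨F₁, hF₁, hF₁d, hF₁t, hF₁g⟩ := h₁.exists_contDiff_seq hΩ hf₁ hK hKΩ hd
  obtain ⟨F₂, hF₂, hF₂d, hF₂t, hF₂g⟩ := h₂.exists_contDiff_seq hΩ hf₂ hK hKΩ hd
  have hFc : ∀ k, ContinuousOn (fun x => (F₁ k x, F₂ k x)) K := fun k =>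
    ((hF₁ k).continuous.prodMk (hF₂ k).continuous).continuousOn
  have hFZ : ∀ k, MapsTo (fun x => (F₁ k x, F₂ k x)) K Z := fun k x hx =>
    Metric.mem_cthickening_of_dist_le _ (f₁ x, f₂ x) d _ (mem_image_of_mem _ hx)
      (max_le (hF₁d k x hx) (hF₂d k x hx))
  have hfZ : MapsTo (fun x => (f₁ x, f₂ x)) K Z := fun x hx =>
    Metric.self_subset_cthickening _ (mem_image_of_mem _ hx)
  have hlim : ∀ x ∈ K, Tendsto (fun k => (F₁ k x, F₂ k x)) atTop (𝓝 (f₁ x, f₂ x)) :=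
    fun x hx => (hF₁t x hx).prodMk_nhds (hF₂t x hx)
  have hmeas : ∀ {F : Eu n → ℝ}, ContDiff ℝ 1 F →
      AEStronglyMeasurable (gradient F) (volume.restrict K) := fun hF =>
    (continuous_gradient hF).aestronglyMeasurable
  have hcomp : ∀ {Ψ : ℝ × ℝ → ℝ}, ContinuousOn Ψ U → ∀ k,
      AEStronglyMeasurable (fun x => Ψ (F₁ k x, F₂ k x)) (volume.restrict K) := fun hΨ k =>
    ((hΨ.mono hdU).comp (hFc k) (hFZ k)).aestronglyMeasurable hK.measurableSet
  refine ⟨fun k x => Φ (F₁ k x, F₂ k x), fun k x => Φ₁ (F₁ k x, F₂ k x) • gradient (F₁ k) x +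
    Φ₂ (F₁ k x, F₂ k x) • gradient (F₂ k) x, fun k => ?_, ?_, ?_⟩
  · exact (hasWeakGrad_comp₂_of_contDiff (hF₁ k) (hF₂ k) hU hΦ₁ hΦ₂ hΦ).mono
      fun x hx => hdU (hFZ k hx)
  · simpa using tendsto_eLpNorm_comp_smul_sub (H := fun _ _ => (1 : ℝ)) (H₀ := fun _ => 1) hK hZ
      (hΦc.mono hdU) hFc hFZ hfZ hlim (fun _ => aestronglyMeasurable_const)
      (continuousOn_const.integrableOn_compact hK) (by simp)
  · have hlim₁ := tendsto_eLpNorm_comp_smul_sub hK hZ (hΦ₁.mono hdU) hFc hFZ hfZ hlim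
      (fun k => hmeas (hF₁ k)) (h₁.2.1.integrableOn_compact_subset hKΩ hK) hF₁g
    have hlim₂ := tendsto_eLpNorm_comp_smul_sub hK hZ (hΦ₂.mono hdU) hFc hFZ hfZ hlim
      (fun k => hmeas (hF₂ k)) (h₂.2.1.integrableOn_compact_subset hKΩ hK) hF₂g
    exact tendsto_eLpNorm_add_sub_add (fun k => (hcomp hΦ₁ k).smul (hmeas (hF₁ k)))
      (fun k => (hcomp hΦ₂ k).smul (hmeas (hF₂ k)))
      (hloc₁.integrableOn_compact_subset hKΩ hK).1
      (hloc₂.integrableOn_compact_subset hKΩ hK).1 hlim₁ hlim₂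

end ChainRule

section CompactSupport

open scoped Topology Manifold Convolution
open Filter ContinuousLinearMap

variable {n : ℕ} {Ω : Set (Eu n)} {f : Eu n → ℝ} {G : Eu n → Eu n}

theorem exists_test_eq_one (hΩ : IsOpen Ω) {K : Set (Eu n)} (hK : IsCompact K) (hKΩ : K ⊆ Ω) :
    ∃ χ : Eu n → ℝ, IsTest Ω χ ∧ ∀ x ∈ K, χ =ᶠ[𝓝 x] 1 := by
  obtain ⟨d, hd, hdΩ⟩ := hK.exists_cthickening_subset_open hΩ hKΩ
  obtain ⟨χ, hχ, -, hχ_supp, hχ_one⟩ := exists_contMDiff_support_eq_eq_one_iff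
    (𝓘(ℝ, Eu n)) (n := (⊤ : ℕ∞)) (s := Metric.thickening d K) (t := Metric.cthickening (d / 2) K)
    Metric.isOpen_thickening Metric.isClosed_cthickening
    (Metric.cthickening_subset_thickening' hd (by linarith) K)
  have hsub : tsupport χ ⊆ Metric.cthickening d K := by
    rw [tsupport, hχ_supp]
    exact Metric.closure_thickening_subset_cthickening d K
  refine ⟨χ, ⟨contMDiff_iff_contDiff.1 hχ, ?_, hsub.trans hdΩ⟩, fun x hx => ?_⟩
  · exact hK.cthickening.of_isClosed_subset (isClosed_tsupport _) hsub
  · filter_upwards [Metric.isOpen_thickening.mem_nhds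
      (Metric.self_subset_thickening (half_pos hd) K hx)] with y hy
    exact (hχ_one y).1 (Metric.thickening_subset_cthickening _ _ hy)

theorem HasWeakGrad.ae_eq_indicator_tsupport (hΩ : IsOpen Ω) (h : HasWeakGrad Ω f G) :
    G =ᵐ[volume.restrict Ω] (tsupport f).indicator G := by
  filter_upwards [h.ae_eq_zero hΩ (isClosed_tsupport f) fun _ => image_eq_zero_of_notMem_tsupport]
    with x hx
  by_cases hxK : x ∈ tsupport f
  · rw [indicator_of_mem hxK]
  · rw [indicator_of_notMem hxK, hx hxK]

theorem HasWeakGrad.univ_of_isCc (hΩ : IsOpen Ω) (h : HasWeakGrad Ω f G) (hf : IsCc Ω f) :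
    HasWeakGrad univ f ((tsupport f).indicator G) := by
  have hm := hf.2.1.measurableSet
  obtain ⟨χ, hχ, hχ_one⟩ := exists_test_eq_one hΩ hf.2.1 hf.2.2
  refine hasWeakGrad_of_integral_eq (hf.1.locallyIntegrable.locallyIntegrableOn _)
    (((h.2.1.integrableOn_compact_subset hf.2.2 hf.2.1).integrable_indicator
      hm).locallyIntegrable.locallyIntegrableOn _) fun η hη i => ?_
  have hχη : IsTest Ω (χ * η) := ⟨hχ.1.mul hη.1, hχ.2.1.mul_right,
    tsupport_mul_subset_left.trans hχ.2.2⟩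
  set e : Eu n := EuclideanSpace.single i 1
  calc ∫ x, f x * fderiv ℝ η x e = ∫ x, f x * fderiv ℝ (χ * η) x e := by
        refine integral_congr_ae (ae_of_all _ fun x => ?_)
        by_cases hx : x ∈ tsupport f
        · have heq : χ * η =ᶠ[𝓝 x] η := by
            filter_upwards [hχ_one x hx] with y hy
            simp [hy]
          simp only [heq.fderiv_eq]
        · simp [image_eq_zero_of_notMem_tsupport hx]
    _ = -∫ x in Ω, G x i * (χ * η) x := by
        rw [h.integral_eq hχη, hχη.isCc.setIntegral_mul]
    _ = -∫ x in Ω, (tsupport f).indicator G x i * η x := by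
        congr 1
        refine integral_congr_ae ?_
        filter_upwards [h.ae_eq_indicator_tsupport hΩ] with x hx
        by_cases hxK : x ∈ tsupport f
        · simp [hxK, (hχ_one x hxK).self_of_nhds]
        · simp [hx, hxK]
    _ = -∫ x, (tsupport f).indicator G x i * η x := by
        rw [setIntegral_eq_integral_of_forall_compl_eq_zero fun x hx => ?_]
        simp [indicator_of_notMem (mt (@hf.2.2 x) hx)]

theorem HasWeakGrad.memLp_of_isCc {p : ℝ≥0∞} (hΩ : IsOpen Ω) (h : HasWeakGrad Ω f G)
    (hf : IsCc Ω f) (hG : MemLp G p (volume.restrict (tsupport f))) :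
    MemLp G p (volume.restrict Ω) := by
  have hm := hf.2.1.measurableSet
  rwa [memLp_congr_ae (h.ae_eq_indicator_tsupport hΩ), memLp_indicator_iff_restrict hm,
    Measure.restrict_restrict hm, inter_eq_left.2 hf.2.2]

theorem HasWeakGrad.memW1p_of_isCc {p : ℝ} (hΩ : IsOpen Ω) (h : HasWeakGrad Ω f G)
    (hf : IsCc Ω f) (hG : MemLp G (ENNReal.ofReal p) (volume.restrict (tsupport f))) :
    MemW1p p Ω f :=
  ⟨(hf.1.memLp_of_hasCompactSupport hf.2.1).mono_measure Measure.restrict_le_self, G, h,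
    h.memLp_of_isCc hΩ hf hG⟩

theorem IsTest.memW1p {p : ℝ} (hΩ : IsOpen Ω) (h : IsTest Ω f) : MemW1p p Ω f :=
  (hasWeakGrad_of_contDiff hΩ h.contDiff_one).memW1p_of_isCc hΩ h.isCc
    (((continuous_gradient h.contDiff_one).memLp_of_hasCompactSupport (h.2.1.mono' fun _ =>
      not_imp_comm.1 gradient_of_notMem_tsupport)).mono_measure Measure.restrict_le_self)

theorem isCc_of_continuousOn (hΩ : IsOpen Ω) (hf : ContinuousOn f Ω) {K : Set (Eu n)}
    (hK : IsCompact K) (hKΩ : K ⊆ Ω) (hfK : ∀ x ∉ K, f x = 0) : IsCc Ω f := by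
  have hsub : tsupport f ⊆ K := closure_minimal (fun x => not_imp_comm.1 (hfK x)) hK.isClosed
  refine ⟨continuous_iff_continuousAt.2 fun x => ?_,
    hK.of_isClosed_subset (isClosed_tsupport _) hsub, hsub.trans hKΩ⟩
  by_cases hx : x ∈ Ω
  · exact hf.continuousAt (hΩ.mem_nhds hx)
  · have heq : f =ᶠ[𝓝 x] fun _ => 0 := by
      filter_upwards [hK.isClosed.isOpen_compl.mem_nhds fun hc => hx (hKΩ hc)] with y hy
      exact hfK y hy
    exact continuousAt_const.congr heq.symm

theorem tsupport_normed_convolution_subset (φ : ContDiffBump (0 : Eu n)) :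
    tsupport (φ.normed volume ⋆[lsmul ℝ ℝ, volume] f) ⊆
      Metric.cthickening φ.rOut (tsupport f) := by
  refine closure_minimal ((support_convolution_subset _).trans ?_) Metric.isClosed_cthickening
  rintro _ ⟨y, hy, z, hz, rfl⟩
  refine Metric.mem_cthickening_of_dist_le _ z _ _ (subset_tsupport f hz) ?_
  rw [φ.support_normed_eq, mem_ball_zero_iff] at hy
  simpa using hy.le

theorem HasWeakGrad.exists_test_approx (hΩ : IsOpen Ω) (h : HasWeakGrad Ω f G) (hf : IsCc Ω f)
    {p : ℝ≥0∞} (hp1 : 1 ≤ p) (hp : p ≠ ∞) (hG : MemLp G p (volume.restrict Ω)) :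
    ∃ K : Set (Eu n), IsCompact K ∧ K ⊆ Ω ∧ tsupport f ⊆ K ∧ ∀ ε : ℝ, 0 < ε →
      ∃ F : Eu n → ℝ, IsTest Ω F ∧ tsupport F ⊆ K ∧ (∀ x, dist (F x) (f x) ≤ ε) ∧
        eLpNorm (fun x => gradient F x - G x) p (volume.restrict Ω) ≤ ENNReal.ofReal ε := by
  obtain ⟨d, hd, hdΩ⟩ := hf.2.1.exists_cthickening_subset_open hΩ hf.2.2
  refine ⟨Metric.cthickening d (tsupport f), hf.2.1.cthickening, hdΩ,
    Metric.self_subset_cthickening _, fun ε hε => ?_⟩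
  set G' := (tsupport f).indicator G
  have h' : HasWeakGrad univ f G' := h.univ_of_isCc hΩ hf
  have hG' : MemLp G' p volume := (memLp_indicator_iff_restrict hf.2.1.measurableSet).2
    (hG.mono_measure (Measure.restrict_mono hf.2.2 le_rfl))
  obtain ⟨d₁, hd₁, huc⟩ := Metric.uniformContinuous_iff.1
    (hf.2.1.uniformContinuous_of_continuous hf.1) ε hε
  obtain ⟨d₂, hd₂, htr⟩ := Metric.eventually_nhds_iff.1
    ((tendsto_eLpNorm_translate_sub hp1 hp hG').eventually_le_const (ENNReal.ofReal_pos.2 hε))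
  set r := min d (min d₁ d₂)
  have hr : 0 < r := by positivity
  let φ : ContDiffBump (0 : Eu n) := ⟨r / 2, r, by linarith, by linarith⟩
  have hsub : tsupport (φ.normed volume ⋆[lsmul ℝ ℝ, volume] f) ⊆
      Metric.cthickening d (tsupport f) :=
    (tsupport_normed_convolution_subset φ).trans (Metric.cthickening_mono (min_le_left _ _) _)
  refine ⟨φ.normed volume ⋆[lsmul ℝ ℝ, volume] f, ⟨?_, ?_, hsub.trans hdΩ⟩, hsub, fun x => ?_, ?_⟩
  · exact φ.hasCompactSupport_normed.contDiff_convolution_left _ φ.contDiff_normed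
      hf.1.locallyIntegrable
  · exact hf.2.1.cthickening.of_isClosed_subset (isClosed_tsupport _) hsub
  · exact φ.dist_normed_convolution_le hf.1.aestronglyMeasurable fun y hy =>
      (huc (lt_of_lt_of_le hy (by simp [φ, r]))).le
  · calc _ = eLpNorm (fun x => (φ.normed volume ⋆[lsmul ℝ ℝ, volume] G') x - G' x) p
            (volume.restrict Ω) := by
          refine eLpNorm_congr_ae ?_
          filter_upwards [h.ae_eq_indicator_tsupport hΩ] with x hx
          have hconv := h'.gradient_convolution MeasurableSet.univ
            (by simpa using hf.1.locallyIntegrable) (by simpa using hG'.locallyIntegrable hp1) φ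
            (subset_univ (Metric.closedBall x φ.rOut))
          simp only [indicator_univ] at hconv
          rw [hx, hconv]
      _ ≤ _ := eLpNorm_mono_measure _ Measure.restrict_le_self
      _ ≤ _ := eLpNorm_normed_convolution_sub_le hp1 hp hG' φ fun y hy => htr
          (by simpa using hy.trans_le (by simp [φ, r]))

theorem MemW1p.hasWeakGrad {p : ℝ} (hf : MemW1p p Ω f) : HasWeakGrad Ω f (weakGrad Ω f) := by
  obtain ⟨-, G, hG, -⟩ := hf
  exact hG.weakGrad_self

theorem MemW1p.memLp_weakGrad {p : ℝ} (hΩ : IsOpen Ω) (hf : MemW1p p Ω f) :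
    MemLp (weakGrad Ω f) (ENNReal.ofReal p) (volume.restrict Ω) := by
  obtain ⟨-, G, hG, hGp⟩ := hf
  exact (memLp_congr_ae (hG.weakGrad_ae_eq hΩ)).2 hGp

theorem IsTest.weakGrad_ae_eq (hΩ : IsOpen Ω) (hf : IsTest Ω f) :
    weakGrad Ω f =ᵐ[volume.restrict Ω] gradient f :=
  (hasWeakGrad_of_contDiff hΩ hf.contDiff_one).weakGrad_ae_eq hΩ

theorem MemW1p.exists_test_seq {p : ℝ} (hp : 1 ≤ p) (hΩ : IsOpen Ω) (hf : MemW1p p Ω f)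
    (hc : IsCc Ω f) :
    ∃ (K : Set (Eu n)) (F : ℕ → Eu n → ℝ), IsCompact K ∧ K ⊆ Ω ∧ tsupport f ⊆ K ∧
      (∀ k, IsTest Ω (F k) ∧ tsupport (F k) ⊆ K) ∧ TendstoUniformly F f atTop ∧
      Tendsto (fun k => eLpNorm (weakGrad Ω (F k) - weakGrad Ω f) (ENNReal.ofReal p)
        (volume.restrict K)) atTop (𝓝 0) := by
  obtain ⟨K, hK, hKΩ, hfK, happrox⟩ := hf.hasWeakGrad.exists_test_approx hΩ hc
    (ENNReal.one_le_ofReal.2 hp) ENNReal.ofReal_ne_top (hf.memLp_weakGrad hΩ)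
  choose F hF hFK hFf hFG using fun k : ℕ => happrox (1 / ((k : ℝ) + 1)) (by positivity)
  have hlim := tendsto_one_div_add_atTop_nhds_zero_nat (𝕜 := ℝ)
  refine ⟨K, F, hK, hKΩ, hfK, fun k => ⟨hF k, hFK k⟩, ?_, ?_⟩
  · refine Metric.tendstoUniformly_iff.2 fun ε hε => ?_
    filter_upwards [hlim.eventually_lt_const hε] with k hk x
    exact (dist_comm _ _).trans_lt ((hFf k x).trans_lt hk)
  · have hlim' := ENNReal.ofReal_zero ▸ ENNReal.tendsto_ofReal hlim
    refine tendsto_of_tendsto_of_tendsto_of_le_of_le tendsto_const_nhds hlim'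
      (fun _ => zero_le) fun k => ?_
    refine (eLpNorm_mono_measure _ (Measure.restrict_mono hKΩ le_rfl)).trans ?_
    refine (eLpNorm_congr_ae ?_).trans_le (hFG k)
    filter_upwards [(hF k).weakGrad_ae_eq hΩ] with x hx
    rw [Pi.sub_apply, hx]

theorem MemW1p.ae_weakGrad_eq_zero {p : ℝ} (hΩ : IsOpen Ω) (hf : MemW1p p Ω f)
    {K : Set (Eu n)} (hK : IsClosed K) (hfK : tsupport f ⊆ K) :
    ∀ᵐ x, x ∈ Ω \ K → weakGrad Ω f x = 0 := by
  have h := hf.hasWeakGrad.ae_eq_zero hΩ hK fun x hx =>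
    image_eq_zero_of_notMem_tsupport fun hxf => hx (hfK hxf)
  filter_upwards [(ae_restrict_iff' hΩ.measurableSet).1 h] with x hx hxK using hx hxK.1 hxK.2

end CompactSupport

/-! ### The energy density -/

section HolderConvergence

open scoped Topology
open Filter

variable {α E : Type*} [MeasurableSpace α] {μ : Measure α} [NormedAddCommGroup E]

theorem tendsto_integral_norm_rpow {p : ℝ} (hp : 1 ≤ p) {f : ℕ → α → E} {f₀ : α → E}
    (hf : ∀ k, MemLp (f k) (ENNReal.ofReal p) μ) (hf₀ : MemLp f₀ (ENNReal.ofReal p) μ)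
    (h : Tendsto (fun k => eLpNorm (f k - f₀) (ENNReal.ofReal p) μ) atTop (𝓝 0)) :
    Tendsto (fun k => ∫ x, ‖f k x‖ ^ p ∂μ) atTop (𝓝 (∫ x, ‖f₀ x‖ ^ p ∂μ)) := by
  have hp0 : 0 < p := by linarith
  have : Fact (1 ≤ ENNReal.ofReal p) := ⟨by simpa using hp⟩
  have hnorm {g : α → E} (hg : MemLp g (ENNReal.ofReal p) μ) :
      ‖hg.toLp g‖ ^ p = ∫ x, ‖g x‖ ^ p ∂μ := by
    have hnonneg : 0 ≤ ∫ x, ‖g x‖ ^ p ∂μ := integral_nonneg fun x => by positivity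
    rw [Lp.norm_toLp, hg.eLpNorm_eq_integral_rpow_norm (ENNReal.ofReal_pos.2 hp0).ne'
      ENNReal.ofReal_ne_top, ENNReal.toReal_ofReal hp0.le, ENNReal.toReal_ofReal (by positivity),
      Real.rpow_inv_rpow hnonneg hp0.ne']
  simp only [← hnorm (hf _), ← hnorm hf₀]
  exact (((Lp.tendsto_Lp_iff_tendsto_eLpNorm'' f hf f₀ hf₀).2 h).norm).rpow_const (.inr hp0.le)

variable [InnerProductSpace ℝ E] {p q : ℝ≥0∞}

theorem integrable_inner [q.HolderTriple p 1] {A H : α → E} (hA : MemLp A q μ)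
    (hH : MemLp H p μ) : Integrable (fun x => inner ℝ (A x) (H x)) μ :=
  memLp_one_iff_integrable.1 <| hA.of_bilin (inner ℝ) 1 hH (hA.1.inner hH.1) <|
    ae_of_all _ fun x => by simpa using nnnorm_inner_le_nnnorm (𝕜 := ℝ) (A x) (H x)

theorem tendsto_integral_inner [q.HolderTriple p 1] {A H₀ : α → E} {H : ℕ → α → E}
    (hA : MemLp A q μ) (hH : ∀ k, MemLp (H k) p μ) (hH₀ : MemLp H₀ p μ)
    (h : Tendsto (fun k => eLpNorm (H k - H₀) p μ) atTop (𝓝 0)) :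
    Tendsto (fun k => ∫ x, inner ℝ (A x) (H k x) ∂μ) atTop (𝓝 (∫ x, inner ℝ (A x) (H₀ x) ∂μ)) := by
  refine tendsto_integral_of_L1' _ (hA.1.inner hH₀.1)
    (Eventually.of_forall fun k => integrable_inner hA (hH k)) ?_
  have hbound : Tendsto (fun k => eLpNorm A q μ * eLpNorm (H k - H₀) p μ) atTop (𝓝 0) := by
    simpa using ENNReal.Tendsto.const_mul h (.inr hA.2.ne)
  refine tendsto_of_tendsto_of_tendsto_of_le_of_le tendsto_const_nhds hbound
    (fun _ => zero_le) fun k => ?_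
  have hHolder := eLpNorm_le_eLpNorm_mul_eLpNorm'_of_norm (p := q) (q := p) (r := 1) hA.1
    ((hH k).1.sub hH₀.1) (inner ℝ) 1 (ae_of_all μ fun x => by
      simpa using norm_inner_le_norm (𝕜 := ℝ) (A x) ((H k - H₀) x))
  simpa only [Pi.sub_def, inner_sub_right, ENNReal.coe_one, one_mul] using hHolder

end HolderConvergence

open scoped Topology in
open Filter in
theorem tendsto_setIntegral_mul_comp {X : Type*} [TopologicalSpace X] [MeasurableSpace X]
    [OpensMeasurableSpace X] {μ : Measure X} {K : Set X} (hK : IsCompact K) (hKm : MeasurableSet K)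
    {w f : X → ℝ} {F : ℕ → X → ℝ} (hw : IntegrableOn w K μ) (hf : ContinuousOn f K)
    (hF : ∀ k, ContinuousOn (F k) K) (h : TendstoUniformlyOn F f atTop K) {ψ : ℝ → ℝ}
    (hψ : Continuous ψ) :
    Tendsto (fun k => ∫ x in K, w x * ψ (F k x) ∂μ) atTop (𝓝 (∫ x in K, w x * ψ (f x) ∂μ)) := by
  obtain ⟨M, hM⟩ := (hK.image_of_continuousOn hf).cthickening (r := 1)
    |>.exists_bound_of_continuousOn hψ.continuousOn
  refine tendsto_integral_filter_of_dominated_convergence (fun x => ‖w x‖ * M) ?_ ?_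
    (hw.norm.mul_const M) ?_
  · exact Eventually.of_forall fun k =>
      hw.1.mul ((hψ.comp_continuousOn (hF k)).aestronglyMeasurable_of_isCompact hK hKm)
  · filter_upwards [Metric.tendstoUniformlyOn_iff.1 h 1 one_pos] with k hk
    filter_upwards [ae_restrict_mem hKm] with x hx
    rw [norm_mul]
    refine mul_le_mul_of_nonneg_left (hM _ ?_) (norm_nonneg _)
    refine Metric.mem_cthickening_of_dist_le _ _ _ _ (mem_image_of_mem f hx) ?_
    exact (dist_comm _ _).trans_le (hk x hx).le
  · filter_upwards [ae_restrict_mem hKm] with x hx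
    exact ((hψ.tendsto _).comp (h.tendsto_at hx)).const_mul _

section Coeff

open scoped Topology
open Filter

variable {n : ℕ} {Ω K : Set (Eu n)} {p s : ℝ} {a : Eu n → Fin n → ℝ} {G : Eu n → Eu n}

theorem exists_isSubdom_ball (hΩ : IsOpen Ω) {x : Eu n} (hx : x ∈ Ω) :
    ∃ r : ℝ, 0 < r ∧ IsSubdom (Metric.ball x r) Ω := by
  obtain ⟨r, hr, hrΩ⟩ := Metric.nhds_basis_closedBall.mem_iff.1 (hΩ.mem_nhds hx)
  refine ⟨r, hr, ⟨Metric.isOpen_ball, ⟨⟨x, Metric.mem_ball_self hr⟩,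
    (convex_ball x r).isPreconnected⟩⟩, ?_, Metric.closure_ball_subset_closedBall.trans hrΩ⟩
  exact (isCompact_closedBall x r).of_isClosed_subset isClosed_closure
    Metric.closure_ball_subset_closedBall

theorem MemMorrey.locallyIntegrableOn {q : ℝ} {V : Eu n → ℝ} (h : MemMorrey p q Ω V) :
    LocallyIntegrableOn V Ω := by
  rcases h with h | h | h
  · exact h.2.2.1
  · exact h.2.2.1
  · exact h.2.2.locallyIntegrableOn

theorem MemMorreyLoc.locallyIntegrableOn {q : ℝ} {V : Eu n → ℝ} (hΩ : IsOpen Ω)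
    (h : MemMorreyLoc p q Ω V) : LocallyIntegrableOn V Ω := fun x hx => by
  obtain ⟨r, hr, hball⟩ := exists_isSubdom_ball hΩ hx
  have hx_ball := (h _ hball).locallyIntegrableOn x (Metric.mem_ball_self hr)
  rw [nhdsWithin_eq_nhds.2 (Metric.ball_mem_nhds x hr)] at hx_ball
  exact hx_ball.filter_mono nhdsWithin_le_nhds

theorem aemeasurable_apply (hG : AEStronglyMeasurable G (volume.restrict K)) (i : Fin n) :
    AEMeasurable (fun x => G x i) (volume.restrict K) :=
  ((EuclideanSpace.proj i : Eu n →L[ℝ] ℝ).continuous.comp_aestronglyMeasurable hG).aemeasurable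

namespace IsCoeff

theorem ae_pos (hΩ : IsOpen Ω) (ha : IsCoeff Ω a) (hKΩ : K ⊆ Ω) :
    ∀ᵐ x ∂(volume.restrict K), ∀ i, 0 < a x i :=
  ae_mono (Measure.restrict_mono hKΩ le_rfl) (ae_restrict_of_forall_mem hΩ.measurableSet ha.2.1)

theorem exists_le (hΩ : IsOpen Ω) (ha : IsCoeff Ω a) (hK : IsCompact K) (hKΩ : K ⊆ Ω) :
    ∃ C : ℝ, ∀ᵐ x ∂(volume.restrict K), ∀ i, a x i ≤ C := by
  refine hK.induction_on (p := fun K => ∃ C : ℝ, ∀ᵐ x ∂(volume.restrict K), ∀ i, a x i ≤ C)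
    ⟨0, by simp⟩ ?_ ?_ ?_
  · rintro A B hAB ⟨C, hC⟩
    exact ⟨C, ae_mono (Measure.restrict_mono hAB le_rfl) hC⟩
  · rintro A B ⟨C, hC⟩ ⟨D, hD⟩
    refine ⟨max C D, ae_restrict_union_iff A B _ |>.2 ⟨?_, ?_⟩⟩
    · filter_upwards [hC] with x hx i using (hx i).trans (le_max_left _ _)
    · filter_upwards [hD] with x hx i using (hx i).trans (le_max_right _ _)
  · intro x hx
    obtain ⟨r, hr, hball⟩ := exists_isSubdom_ball hΩ (hKΩ hx)
    obtain ⟨c, C, -, hC⟩ := ha.2.2 _ hball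
    refine ⟨_, mem_nhdsWithin_of_mem_nhds (Metric.ball_mem_nhds x hr), C, ?_⟩
    filter_upwards [hC] with y hy i using (hy i).2

theorem exists_saNorm_le (hs : 0 < s) (hΩ : IsOpen Ω) (ha : IsCoeff Ω a) (hK : IsCompact K)
    (hKΩ : K ⊆ Ω) : ∃ C : ℝ, 0 ≤ C ∧
      ∀ᵐ x ∂(volume.restrict K), ∀ ξ, saNorm s a x ξ ≤ C * ‖ξ‖ := by
  obtain ⟨C, hC⟩ := ha.exists_le hΩ hK hKΩ
  refine ⟨(∑ _i : Fin n, |C|) ^ (1 / s), by positivity, ?_⟩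
  filter_upwards [hC, ha.ae_pos hΩ hKΩ] with x hx hpos ξ
  refine (saNorm_le_mul_norm hs hpos ξ).trans (mul_le_mul_of_nonneg_right ?_ (norm_nonneg _))
  exact Real.rpow_le_rpow (Finset.sum_nonneg fun i _ => (hpos i).le)
    (Finset.sum_le_sum fun i _ => (hx i).trans (le_abs_self C)) (by positivity)

theorem aemeasurable_saNorm (ha : IsCoeff Ω a) (hKΩ : K ⊆ Ω)
    (hG : AEStronglyMeasurable G (volume.restrict K)) :
    AEMeasurable (fun x => saNorm s a x (G x)) (volume.restrict K) :=
  (Finset.aemeasurable_fun_sum _ fun i _ =>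
    ((ha.1 i).mono_measure (Measure.restrict_mono hKΩ le_rfl)).mul
      ((measurable_norm.comp_aemeasurable (aemeasurable_apply hG i)).pow_const s)).pow_const _

theorem aemeasurable_opA (hp : 1 < p) (hs : 1 < s) (hΩ : IsOpen Ω) (ha : IsCoeff Ω a)
    (hKΩ : K ⊆ Ω) (hG : AEStronglyMeasurable G (volume.restrict K)) :
    AEMeasurable (fun x => opA p s a x (G x)) (volume.restrict K) := by
  have hN := ha.aemeasurable_saNorm (s := s) hKΩ hG
  have hsaGrad : AEMeasurable (fun x => saGrad s a x (G x)) (volume.restrict K) := by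
    refine (WithLp.measurable_toLp 2 _).comp_aemeasurable (aemeasurable_pi_lambda _ fun i => ?_)
    have hGi := aemeasurable_apply hG i
    exact (hN.pow_const _).mul (((ha.1 i).mono_measure (Measure.restrict_mono hKΩ le_rfl)).mul
      (((measurable_norm.comp_aemeasurable hGi).pow_const _).mul hGi))
  refine ((hN.pow_const (p - 1)).smul hsaGrad).congr ?_
  filter_upwards [ha.ae_pos hΩ hKΩ] with x hx
  exact (opA_eq hp hs hx _).symm

theorem memLp_saNorm (hs : 0 < s) (hΩ : IsOpen Ω) (ha : IsCoeff Ω a) (hK : IsCompact K)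
    (hKΩ : K ⊆ Ω) {P : ℝ≥0∞} (hG : MemLp G P (volume.restrict K)) :
    MemLp (fun x => saNorm s a x (G x)) P (volume.restrict K) := by
  obtain ⟨C, -, hC⟩ := ha.exists_saNorm_le hs hΩ hK hKΩ
  refine hG.of_le_mul (ha.aemeasurable_saNorm hKΩ hG.1).aestronglyMeasurable (c := C) ?_
  filter_upwards [hC, ha.ae_pos hΩ hKΩ] with x hx hpos
  rw [Real.norm_of_nonneg (saNorm_nonneg hpos _)]
  exact hx _

theorem integrableOn_saNorm_rpow (hp : 0 < p) (hs : 0 < s) (hΩ : IsOpen Ω) (ha : IsCoeff Ω a)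
    (hK : IsCompact K) (hKΩ : K ⊆ Ω) (hG : MemLp G (ENNReal.ofReal p) (volume.restrict K)) :
    IntegrableOn (fun x => saNorm s a x (G x) ^ p) K := by
  have h := (ha.memLp_saNorm hs hΩ hK hKΩ hG).integrable_norm_rpow
    (ENNReal.ofReal_pos.2 hp).ne' ENNReal.ofReal_ne_top
  rw [ENNReal.toReal_ofReal hp.le] at h
  refine Integrable.congr h ?_
  filter_upwards [ha.ae_pos hΩ hKΩ] with x hpos
  rw [Real.norm_of_nonneg (saNorm_nonneg hpos _)]

theorem memLp_opA (hp : 1 < p) (hs : 1 < s) (hΩ : IsOpen Ω) (ha : IsCoeff Ω a)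
    (hK : IsCompact K) (hKΩ : K ⊆ Ω) (hG : MemLp G (ENNReal.ofReal p) (volume.restrict K)) :
    MemLp (fun x => opA p s a x (G x)) (ENNReal.ofReal p.conjExponent) (volume.restrict K) := by
  have hs0 : 0 < s := by linarith
  obtain ⟨C, hC0, hC⟩ := ha.exists_saNorm_le hs0 hΩ hK hKΩ
  have hN := (ha.memLp_saNorm hs0 hΩ hK hKΩ hG).norm_rpow_div (ENNReal.ofReal (p - 1))
  rw [ENNReal.toReal_ofReal (by linarith), ← ENNReal.ofReal_div_of_pos (by linarith)] at hN
  refine hN.of_le_mul (c := C) (ha.aemeasurable_opA hp hs hΩ hKΩ hG.1).aestronglyMeasurable ?_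
  filter_upwards [hC, ha.ae_pos hΩ hKΩ] with x hx hpos
  have hN0 := saNorm_nonneg (s := s) hpos (G x)
  rw [Real.norm_of_nonneg (by positivity), Real.norm_of_nonneg hN0]
  set A := opA p s a x (G x)
  rcases (norm_nonneg A).eq_or_lt with hA | hA
  · rw [← hA]
    positivity
  refine le_of_mul_le_mul_right ?_ hA
  calc ‖A‖ * ‖A‖ = inner ℝ A A := (real_inner_self_eq_norm_mul_norm A).symm
    _ ≤ saNorm s a x (G x) ^ (p - 1) * saNorm s a x A :=
      (le_abs_self _).trans (abs_inner_opA_le hp hs hpos _ _)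
    _ ≤ saNorm s a x (G x) ^ (p - 1) * (C * ‖A‖) := by gcongr; exact hx A
    _ = C * saNorm s a x (G x) ^ (p - 1) * ‖A‖ := by ring

theorem tendsto_setIntegral_saNorm_rpow (hp : 1 ≤ p) (hs : 1 ≤ s) (hΩ : IsOpen Ω)
    (ha : IsCoeff Ω a) (hK : IsCompact K) (hKΩ : K ⊆ Ω) {H : ℕ → Eu n → Eu n}
    (hH : ∀ k, MemLp (H k) (ENNReal.ofReal p) (volume.restrict K))
    (hG : MemLp G (ENNReal.ofReal p) (volume.restrict K))
    (h : Tendsto (fun k => eLpNorm (H k - G) (ENNReal.ofReal p) (volume.restrict K)) atTop (𝓝 0)) :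
    Tendsto (fun k => ∫ x in K, saNorm s a x (H k x) ^ p) atTop
      (𝓝 (∫ x in K, saNorm s a x (G x) ^ p)) := by
  have hs0 : 0 < s := by linarith
  obtain ⟨C, -, hC⟩ := ha.exists_saNorm_le hs0 hΩ hK hKΩ
  have habs (H : Eu n → Eu n) :
      ∫ x in K, saNorm s a x (H x) ^ p = ∫ x in K, ‖saNorm s a x (H x)‖ ^ p := by
    refine integral_congr_ae ?_
    filter_upwards [ha.ae_pos hΩ hKΩ] with x hpos
    rw [Real.norm_of_nonneg (saNorm_nonneg hpos _)]
  simp only [habs]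
  refine tendsto_integral_norm_rpow hp (fun k => ha.memLp_saNorm hs0 hΩ hK hKΩ (hH k))
    (ha.memLp_saNorm hs0 hΩ hK hKΩ hG) ?_
  have hbound : Tendsto (fun k => ENNReal.ofReal C *
      eLpNorm (H k - G) (ENNReal.ofReal p) (volume.restrict K)) atTop (𝓝 0) := by
    simpa using ENNReal.Tendsto.const_mul h (.inr ENNReal.ofReal_ne_top)
  refine tendsto_of_tendsto_of_tendsto_of_le_of_le tendsto_const_nhds hbound
    (fun _ => zero_le) fun k => eLpNorm_le_mul_eLpNorm_of_ae_le_mul ?_ _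
  filter_upwards [hC, ha.ae_pos hΩ hKΩ] with x hx hpos
  exact (abs_sub_map_le_sub (saSeminorm hs hpos) (H k x) (G x)).trans (hx _)

end IsCoeff

end Coeff

/-! ### Positive solutions and Picone's identity -/

/-- The standing assumptions, with local integrability in place of the Morrey condition on `V`, and
without connectedness of `Ω`: `u` is a positive continuous weak solution of `Q'[u] = 0` in `Ω`. -/
structure IsPosSol {n : ℕ} (p s : ℝ) (Ω : Set (Eu n)) (a : Eu n → Fin n → ℝ) (V u : Eu n → ℝ) :
    Prop where
  one_lt_p : 1 < p
  one_lt_s : 1 < s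
  isOpen : IsOpen Ω
  isCoeff : IsCoeff Ω a
  locallyIntegrableOn : LocallyIntegrableOn V Ω
  continuousOn : ContinuousOn u Ω
  pos : ∀ x ∈ Ω, 0 < u x
  isWeakSol : IsWeakSol p s Ω a V u

section Energy

open scoped Topology
open Filter

variable {n : ℕ} {p s : ℝ} {Ω K : Set (Eu n)} {a : Eu n → Fin n → ℝ} {V u φ : Eu n → ℝ}

theorem memLp_continuousOn_smul {P : ℝ≥0∞} (hK : IsCompact K) {c : Eu n → ℝ}
    (hc : ContinuousOn c K) {G : Eu n → Eu n} (hG : MemLp G P (volume.restrict K)) :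
    MemLp (fun x => c x • G x) P (volume.restrict K) := by
  obtain ⟨B, hB⟩ := hK.exists_bound_of_continuousOn hc
  refine hG.of_le_mul ((hc.aestronglyMeasurable hK.measurableSet).smul hG.1) (c := B) ?_
  filter_upwards [ae_restrict_mem hK.measurableSet] with x hx
  rw [norm_smul]
  exact mul_le_mul_of_nonneg_right (hB x hx) (norm_nonneg _)

theorem setIntegral_mul_of_tsupport_subset (hΩ : IsOpen Ω) (hKΩ : K ⊆ Ω) (hφK : tsupport φ ⊆ K)
    (w : Eu n → ℝ) {ψ : ℝ → ℝ} (hψ : ψ 0 = 0) :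
    ∫ x in Ω, w x * ψ (φ x) = ∫ x in K, w x * ψ (φ x) :=
  setIntegral_eq_of_subset_of_forall_sdiff_eq_zero hΩ.measurableSet hKΩ fun x hx => by
    rw [image_eq_zero_of_notMem_tsupport fun hxφ => hx.2 (hφK hxφ), hψ, mul_zero]

theorem MemW1p.setIntegral_comp_weakGrad (hΩ : IsOpen Ω) (hφ : MemW1p p Ω φ) (hK : IsClosed K)
    (hKΩ : K ⊆ Ω) (hφK : tsupport φ ⊆ K) {F : Eu n → Eu n → ℝ} (hF : ∀ x ∈ Ω, F x 0 = 0) :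
    ∫ x in Ω, F x (weakGrad Ω φ x) = ∫ x in K, F x (weakGrad Ω φ x) := by
  refine setIntegral_eq_of_subset_of_ae_sdiff_eq_zero hΩ.measurableSet.nullMeasurableSet hKΩ ?_
  filter_upwards [hφ.ae_weakGrad_eq_zero hΩ hK hφK] with x hx hxK
  rw [hx hxK, hF x hxK.1]

namespace IsPosSol

theorem hasWeakGrad (h : IsPosSol p s Ω a V u) : HasWeakGrad Ω u (weakGrad Ω u) := by
  obtain ⟨G, hG, -⟩ := h.isWeakSol.1
  exact hG.weakGrad_self

theorem memLp_weakGrad (h : IsPosSol p s Ω a V u) (hK : IsCompact K) (hKΩ : K ⊆ Ω) :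
    MemLp (weakGrad Ω u) (ENNReal.ofReal p) (volume.restrict K) := by
  obtain ⟨G, hG, hGp⟩ := h.isWeakSol.1
  exact (memLp_congr_ae (ae_mono (Measure.restrict_mono hKΩ le_rfl)
    (hG.weakGrad_ae_eq h.isOpen))).2 (hGp K hK hKΩ).2

theorem memLp_opA_weakGrad (h : IsPosSol p s Ω a V u) (hK : IsCompact K) (hKΩ : K ⊆ Ω) :
    MemLp (fun x => opA p s a x (weakGrad Ω u x)) (ENNReal.ofReal p.conjExponent)
      (volume.restrict K) :=
  h.isCoeff.memLp_opA h.one_lt_p h.one_lt_s h.isOpen hK hKΩ (h.memLp_weakGrad hK hKΩ)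

theorem continuousOn_rpow (h : IsPosSol p s Ω a V u) (r : ℝ) :
    ContinuousOn (fun x => u x ^ r) Ω :=
  h.continuousOn.rpow_const fun x hx => .inl (h.pos x hx).ne'

theorem weak_eq_of_isTest (h : IsPosSol p s Ω a V u) (hφ : IsTest Ω φ) :
    (∫ x in Ω, inner ℝ (opA p s a x (weakGrad Ω u x)) (weakGrad Ω φ x)) +
      ∫ x in Ω, V x * u x ^ (p - 1) * φ x = 0 := by
  rw [← h.isWeakSol.2 φ hφ]
  congr 1
  · refine integral_congr_ae ?_
    filter_upwards [hφ.weakGrad_ae_eq h.isOpen] with x hx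
    rw [hx]
  · refine setIntegral_congr_fun h.isOpen.measurableSet fun x hx => ?_
    have hu := h.pos x hx
    simp only [abs_of_pos hu, ← Real.rpow_add_one hu.ne']
    ring_nf

theorem weak_eq (h : IsPosSol p s Ω a V u) (hφ : MemW1p p Ω φ) (hc : IsCc Ω φ) :
    (∫ x in Ω, inner ℝ (opA p s a x (weakGrad Ω u x)) (weakGrad Ω φ x)) +
      ∫ x in Ω, V x * u x ^ (p - 1) * φ x = 0 := by
  obtain ⟨K, F, hK, hKΩ, hφK, hF, hlim, hlimG⟩ := hφ.exists_test_seq h.one_lt_p.le h.isOpen hc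
  have hrestrict {ψ : Eu n → ℝ} (hψ : MemW1p p Ω ψ) (hψK : tsupport ψ ⊆ K) :=
    congrArg₂ (· + ·)
      (hψ.setIntegral_comp_weakGrad h.isOpen hK.isClosed hKΩ hψK
        (F := fun x ξ => inner ℝ (opA p s a x (weakGrad Ω u x)) ξ) fun _ _ => inner_zero_right _)
      (setIntegral_mul_of_tsupport_subset h.isOpen hKΩ hψK (fun x => V x * u x ^ (p - 1))
        (ψ := fun y => y) rfl)
  have hLp {ψ : Eu n → ℝ} (hψ : MemW1p p Ω ψ) :
      MemLp (weakGrad Ω ψ) (ENNReal.ofReal p) (volume.restrict K) :=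
    (hψ.memLp_weakGrad h.isOpen).mono_measure (Measure.restrict_mono hKΩ le_rfl)
  have hFp (k : ℕ) : MemW1p p Ω (F k) := (hF k).1.memW1p h.isOpen
  have := (Real.HolderConjugate.conjExponent h.one_lt_p).symm.ennrealOfReal
  have hlim_inner := tendsto_integral_inner (h.memLp_opA_weakGrad hK hKΩ) (fun k => hLp (hFp k))
    (hLp hφ) hlimG
  have hlim_mul := tendsto_setIntegral_mul_comp hK hK.measurableSet
    ((h.locallyIntegrableOn.integrableOn_compact_subset hKΩ hK).mul_continuousOn
      ((h.continuousOn_rpow (p - 1)).mono hKΩ) hK) hc.1.continuousOn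
    (fun k => (hF k).1.1.continuous.continuousOn) hlim.tendstoUniformlyOn continuous_id
  refine (hrestrict hφ hφK).trans (tendsto_nhds_unique (hlim_inner.add hlim_mul) ?_)
  refine tendsto_const_nhds.congr fun k => ?_
  exact (h.weak_eq_of_isTest (hF k).1).symm.trans (hrestrict (hFp k) (hF k).2)

end IsPosSol

end Energy

section Picone

variable {n : ℕ} {p s : ℝ} {Ω K : Set (Eu n)} {a : Eu n → Fin n → ℝ} {V u φ : Eu n → ℝ}

theorem continuous_abs_rpow (hp : 0 ≤ p) : Continuous fun y : ℝ => |y| ^ p :=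
  continuous_abs.rpow_const fun _ => .inr hp

theorem continuous_abs_rpow_sub_two_mul (hp : 1 < p) :
    Continuous fun y : ℝ => p * |y| ^ (p - 2) * y := by
  have hderiv := (contDiff_norm_rpow (E := ℝ) hp).continuous_deriv le_rfl
  convert hderiv using 1
  exact funext fun y => (hasDerivAt_abs_rpow y hp).deriv.symm

theorem integrableOn_mul_abs_rpow (hp : 0 ≤ p) (hK : IsCompact K) {w f : Eu n → ℝ}
    (hw : IntegrableOn w K) (hf : ContinuousOn f K) : IntegrableOn (fun x => w x * |f x| ^ p) K :=
  hw.mul_continuousOn ((continuous_abs_rpow hp).comp_continuousOn hf) hK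

theorem MemW1p.integrableOn_saNorm_rpow (hp : 0 < p) (hs : 0 < s) (hΩ : IsOpen Ω)
    (ha : IsCoeff Ω a) (hφ : MemW1p p Ω φ) (hK : IsCompact K) (hKΩ : K ⊆ Ω) :
    IntegrableOn (fun x => saNorm s a x (weakGrad Ω φ x) ^ p) K :=
  ha.integrableOn_saNorm_rpow hp hs hΩ hK hKΩ
    ((hφ.memLp_weakGrad hΩ).mono_measure (Measure.restrict_mono hKΩ le_rfl))

theorem energy_eq_add (hp : 0 < p) (hs : 0 < s) (hΩ : IsOpen Ω) (ha : IsCoeff Ω a)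
    (hV : LocallyIntegrableOn V Ω) (hφ : MemW1p p Ω φ) (hc : Continuous φ) (hK : IsCompact K)
    (hKΩ : K ⊆ Ω) (hφK : tsupport φ ⊆ K) :
    energy p s Ω a V φ =
      (∫ x in K, saNorm s a x (weakGrad Ω φ x) ^ p) + ∫ x in K, V x * |φ x| ^ p := by
  rw [← integral_add (hφ.integrableOn_saNorm_rpow hp hs hΩ ha hK hKΩ)
    (integrableOn_mul_abs_rpow hp.le hK (hV.integrableOn_compact_subset hKΩ hK)
      hc.continuousOn)]
  refine setIntegral_eq_of_subset_of_ae_sdiff_eq_zero hΩ.measurableSet.nullMeasurableSet hKΩ ?_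
  filter_upwards [hφ.ae_weakGrad_eq_zero hΩ hK.isClosed hφK] with x hx hxK
  rw [hx hxK, image_eq_zero_of_notMem_tsupport fun h => hxK.2 (hφK h), saNorm_zero hs, abs_zero,
    Real.zero_rpow hp.ne', mul_zero, add_zero]

/-- The function `|φ|^p u^{1-p}` of Picone's identity, the test function which compares the energy
of `φ` with the equation for `u`. -/
def picone (p : ℝ) (u φ : Eu n → ℝ) (x : Eu n) : ℝ := |φ x| ^ p * u x ^ (1 - p)

/-- The Bregman distance, for `|·|_{s,a}^p`, of `∇φ` from `(φ / u) ∇u`. It vanishes if `φ / u` is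
constant, and for a positive solution `u` its integral is `Q[φ]`. -/
def density (p s : ℝ) (Ω : Set (Eu n)) (a : Eu n → Fin n → ℝ) (u φ : Eu n → ℝ) (x : Eu n) : ℝ :=
  bregman p s a x ((φ x / u x) • weakGrad Ω u x) (weakGrad Ω φ x - (φ x / u x) • weakGrad Ω u x)

theorem tsupport_picone_subset (hp : p ≠ 0) : tsupport (picone p u φ) ⊆ tsupport φ :=
  closure_mono fun x hx hφx => hx <| by
    rw [picone, hφx, abs_zero, Real.zero_rpow hp, zero_mul]

theorem bregman_picone (hp : 1 < p) (hs : 1 < s) {x : Eu n} (ha : ∀ i, 0 < a x i) {y w : ℝ}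
    (hw : 0 < w) (ξ ζ : Eu n) :
    bregman p s a x ((y / w) • ξ) (ζ - (y / w) • ξ) = saNorm s a x ζ ^ p -
      inner ℝ (opA p s a x ξ) ((p * |y| ^ (p - 2) * y * w ^ (1 - p)) • ζ +
        (|y| ^ p * ((1 - p) * w ^ (1 - p - 1))) • ξ) := by
  have hdiv (r : ℝ) : |y / w| ^ r = |y| ^ r * w ^ (-r) := by
    rw [abs_div, abs_of_pos hw, Real.div_rpow (abs_nonneg _) hw.le, Real.rpow_neg hw.le,
      div_eq_mul_inv]
  have hw₁ : w ^ (1 - p) = w ^ (-(p - 2)) / w := by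
    rw [← Real.rpow_sub_one hw.ne']
    ring_nf
  have hy := abs_rpow_sub_two_mul_sq (show 0 < p by linarith) y
  have hw₂ : w ^ (1 - p - 1) = w ^ (-(p - 2)) / w / w := by
    rw [Real.rpow_sub_one hw.ne', hw₁]
  rw [bregman, add_sub_cancel, saNorm_smul (by linarith) ha, opA_smul hp hs ha,
    Real.mul_rpow (abs_nonneg _) (saNorm_nonneg ha _), ← inner_opA_self hp hs ha ξ, hdiv, hdiv,
    show -p = 1 - p - 1 by ring, hw₁, hw₂, ← hy]
  simp only [inner_smul_left, inner_sub_right, inner_add_right, inner_smul_right, conj_trivial]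
  ring

namespace IsPosSol

theorem density_nonneg (h : IsPosSol p s Ω a V u) (φ : Eu n → ℝ) {x : Eu n} (hx : x ∈ Ω) :
    0 ≤ density p s Ω a u φ x :=
  bregman_nonneg h.one_lt_p h.one_lt_s (h.isCoeff.2.1 x hx) _ _

theorem isCc_picone (h : IsPosSol p s Ω a V u) (hc : IsCc Ω φ) : IsCc Ω (picone p u φ) := by
  have hp := h.one_lt_p
  exact isCc_of_continuousOn h.isOpen
    (((continuous_abs_rpow (by linarith)).comp hc.1).continuousOn.mul (h.continuousOn_rpow _))
    hc.2.1 hc.2.2 fun x hx => image_eq_zero_of_notMem_tsupport fun hx' =>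
      hx (tsupport_picone_subset (by linarith) hx')

theorem hasWeakGrad_picone (h : IsPosSol p s Ω a V u) {G : Eu n → Eu n} (hφ : ContinuousOn φ Ω)
    (hG : HasWeakGrad Ω φ G) :
    HasWeakGrad Ω (picone p u φ) fun x =>
      (p * |φ x| ^ (p - 2) * φ x * u x ^ (1 - p)) • G x +
        (|φ x| ^ p * ((1 - p) * u x ^ (1 - p - 1))) • weakGrad Ω u x := by
  have hp := h.one_lt_p
  have hrpow (r : ℝ) : ContinuousOn (fun z : ℝ × ℝ => z.2 ^ r) {z | 0 < z.2} :=
    continuousOn_snd.rpow_const fun z hz => .inl (ne_of_gt hz)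
  refine HasWeakGrad.comp₂ h.isOpen hG h.hasWeakGrad hφ h.continuousOn
    (isOpen_lt continuous_const continuous_snd)
    (Φ := fun z : ℝ × ℝ => |z.1| ^ p * z.2 ^ (1 - p))
    (Φ₁ := fun z => p * |z.1| ^ (p - 2) * z.1 * z.2 ^ (1 - p))
    (Φ₂ := fun z => |z.1| ^ p * ((1 - p) * z.2 ^ (1 - p - 1))) ?_ ?_ (fun z hz => ?_) h.pos
  · exact ((continuous_abs_rpow_sub_two_mul hp).comp continuous_fst).continuousOn.mul (hrpow _)
  · exact ((continuous_abs_rpow (by linarith)).comp continuous_fst).continuousOn.mul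
      (continuousOn_const.mul (hrpow _))
  · have hy := (hasDerivAt_abs_rpow z.1 hp).comp_hasFDerivAt z (hasFDerivAt_fst (𝕜 := ℝ))
    have hw := (Real.hasDerivAt_rpow_const (p := 1 - p) (.inl (ne_of_gt hz))).comp_hasFDerivAt z
      (hasFDerivAt_snd (𝕜 := ℝ))
    refine (hy.mul hw).congr_fderiv ?_
    ext
    · simp
      ring
    · simp

theorem memW1p_picone (h : IsPosSol p s Ω a V u) (hφ : MemW1p p Ω φ) (hc : IsCc Ω φ) :
    MemW1p p Ω (picone p u φ) := by
  have hp := h.one_lt_p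
  obtain ⟨hK, hKΩ⟩ := (h.isCc_picone hc).2
  refine (h.hasWeakGrad_picone hc.1.continuousOn hφ.hasWeakGrad).memW1p_of_isCc h.isOpen
    (h.isCc_picone hc) (MemLp.add ?_ ?_)
  · exact memLp_continuousOn_smul hK
      (((continuous_abs_rpow_sub_two_mul hp).comp hc.1).continuousOn.mul
        ((h.continuousOn_rpow _).mono hKΩ))
      ((hφ.memLp_weakGrad h.isOpen).mono_measure (Measure.restrict_mono hKΩ le_rfl))
  · exact memLp_continuousOn_smul hK
      (((continuous_abs_rpow (by linarith)).comp hc.1).continuousOn.mul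
        (continuousOn_const.mul ((h.continuousOn_rpow _).mono hKΩ))) (h.memLp_weakGrad hK hKΩ)

theorem density_ae_eq (h : IsPosSol p s Ω a V u) (hφ : MemW1p p Ω φ) (hc : IsCc Ω φ) :
    density p s Ω a u φ =ᵐ[volume.restrict Ω] fun x => saNorm s a x (weakGrad Ω φ x) ^ p -
      inner ℝ (opA p s a x (weakGrad Ω u x)) (weakGrad Ω (picone p u φ) x) := by
  have hG := (h.hasWeakGrad_picone hc.1.continuousOn hφ.hasWeakGrad).weakGrad_ae_eq h.isOpen
  filter_upwards [hG, ae_restrict_mem h.isOpen.measurableSet] with x hx hxΩ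
  rw [hx]
  exact bregman_picone h.one_lt_p h.one_lt_s (h.isCoeff.2.1 x hxΩ) (h.pos x hxΩ) _ _

theorem integrableOn_inner_opA (h : IsPosSol p s Ω a V u) (hφ : MemW1p p Ω φ) (hK : IsCompact K)
    (hKΩ : K ⊆ Ω) :
    IntegrableOn (fun x => inner ℝ (opA p s a x (weakGrad Ω u x)) (weakGrad Ω φ x)) K :=
  have := (Real.HolderConjugate.conjExponent h.one_lt_p).symm.ennrealOfReal
  integrable_inner (h.memLp_opA_weakGrad hK hKΩ)
    ((hφ.memLp_weakGrad h.isOpen).mono_measure (Measure.restrict_mono hKΩ le_rfl))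

theorem ae_density_eq_zero (h : IsPosSol p s Ω a V u) (hφ : MemW1p p Ω φ) :
    ∀ᵐ x, x ∈ Ω \ tsupport φ → density p s Ω a u φ x = 0 := by
  filter_upwards [hφ.ae_weakGrad_eq_zero h.isOpen (isClosed_tsupport φ) subset_rfl] with x hx hxK
  rw [density, hx hxK, image_eq_zero_of_notMem_tsupport hxK.2, zero_div, zero_smul, sub_zero,
    bregman_zero_right]

theorem integrableOn_density (h : IsPosSol p s Ω a V u) (hφ : MemW1p p Ω φ) (hc : IsCc Ω φ) :
    IntegrableOn (density p s Ω a u φ) Ω := by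
  have hp := h.one_lt_p
  have hs := h.one_lt_s
  obtain ⟨hK, hKΩ⟩ := hc.2
  have hPic := h.memW1p_picone hφ hc
  refine IntegrableOn.of_ae_sdiff_eq_zero (s := tsupport φ) ?_
    h.isOpen.measurableSet.nullMeasurableSet (h.ae_density_eq_zero hφ)
  exact ((hφ.integrableOn_saNorm_rpow (by linarith) (by linarith) h.isOpen h.isCoeff hK hKΩ).sub
    (h.integrableOn_inner_opA hPic hK hKΩ)).congr
    (ae_mono (Measure.restrict_mono hKΩ le_rfl) (h.density_ae_eq hφ hc).symm)

theorem energy_eq_integral_density (h : IsPosSol p s Ω a V u) (hφ : MemW1p p Ω φ)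
    (hc : IsCc Ω φ) : energy p s Ω a V φ = ∫ x in Ω, density p s Ω a u φ x := by
  have hp₀ : 0 < p := zero_lt_one.trans h.one_lt_p
  have hs₀ : 0 < s := zero_lt_one.trans h.one_lt_s
  obtain ⟨hK, hKΩ⟩ := hc.2
  have hPic := h.memW1p_picone hφ hc
  have hV : ∫ x in Ω, V x * u x ^ (p - 1) * picone p u φ x = ∫ x in Ω, V x * |φ x| ^ p := by
    refine setIntegral_congr_fun h.isOpen.measurableSet fun x hx => ?_
    have hu : u x ^ (p - 1) * u x ^ (1 - p) = 1 := by
      rw [← Real.rpow_add (h.pos x hx), sub_add_sub_cancel, sub_self, Real.rpow_zero]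
    simp only [picone]
    linear_combination (V x * |φ x| ^ p) * hu
  have hweak := h.weak_eq hPic (h.isCc_picone hc)
  rw [hV, hPic.setIntegral_comp_weakGrad h.isOpen hK.isClosed hKΩ (tsupport_picone_subset hp₀.ne')
      (F := fun x ξ => inner ℝ (opA p s a x (weakGrad Ω u x)) ξ) fun _ _ => inner_zero_right _,
    setIntegral_mul_of_tsupport_subset h.isOpen hKΩ subset_rfl V (ψ := fun y => |y| ^ p)
      (by rw [abs_zero, Real.zero_rpow hp₀.ne'])] at hweak
  rw [energy_eq_add hp₀ hs₀ h.isOpen h.isCoeff h.locallyIntegrableOn hφ hc.1 hK hKΩ subset_rfl,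
    setIntegral_eq_of_subset_of_ae_sdiff_eq_zero h.isOpen.measurableSet.nullMeasurableSet hKΩ
      (h.ae_density_eq_zero hφ),
    integral_congr_ae (ae_mono (Measure.restrict_mono hKΩ le_rfl) (h.density_ae_eq hφ hc)),
    integral_sub (hφ.integrableOn_saNorm_rpow hp₀ hs₀ h.isOpen h.isCoeff hK hKΩ)
      (h.integrableOn_inner_opA hPic hK hKΩ)]
  linarith

theorem energy_nonneg (h : IsPosSol p s Ω a V u) (hφ : MemW1p p Ω φ) (hc : IsCc Ω φ) :
    0 ≤ energy p s Ω a V φ := by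
  rw [h.energy_eq_integral_density hφ hc]
  exact setIntegral_nonneg h.isOpen.measurableSet fun x hx => h.density_nonneg φ hx

theorem ofReal_energy (h : IsPosSol p s Ω a V u) (hφ : MemW1p p Ω φ) (hc : IsCc Ω φ) :
    ENNReal.ofReal (energy p s Ω a V φ) = ∫⁻ x in Ω, ENNReal.ofReal (density p s Ω a u φ x) := by
  rw [h.energy_eq_integral_density hφ hc,
    ofReal_integral_eq_lintegral_ofReal (h.integrableOn_density hφ hc)]
  filter_upwards [ae_restrict_mem h.isOpen.measurableSet] with x hx using h.density_nonneg φ hx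

end IsPosSol

end Picone

/-! ### Truncation and the capacitary inequality -/

/-- The dyadic shell `{t ≤ |f| < 2t}`. -/
def shell {X : Type*} (f : X → ℝ) (t : ℝ) : Set X := {x | t ≤ |f x| ∧ |f x| < 2 * t}

section Shell

variable {X : Type*} {f : X → ℝ}

theorem measurableSet_shell [MeasurableSpace X] (hf : Measurable f) (t : ℝ) :
    MeasurableSet (shell f t) :=
  (measurableSet_le measurable_const hf.abs).inter (measurableSet_lt hf.abs measurable_const)

theorem pairwise_disjoint_shell :
    Pairwise (Function.onFun Disjoint fun j : ℤ => shell f ((2 : ℝ) ^ j)) := by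
  intro i j hij
  refine Set.disjoint_left.2 fun x hi hj => hij ?_
  simp only [shell, mem_ofPred_eq, ← zpow_one_add₀ (two_ne_zero (α := ℝ))] at hi hj
  have hi' := (zpow_lt_zpow_iff_right₀ one_lt_two).1 (hi.1.trans_lt hj.2)
  have hj' := (zpow_lt_zpow_iff_right₀ one_lt_two).1 (hj.1.trans_lt hi.2)
  omega

theorem iUnion_shell : ⋃ j : ℤ, shell f ((2 : ℝ) ^ j) = {x | f x ≠ 0} := by
  ext x
  simp only [shell, mem_iUnion, mem_ofPred_eq]
  constructor
  · rintro ⟨j, hj, -⟩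
    exact abs_pos.1 ((by positivity : (0 : ℝ) < 2 ^ j).trans_le hj)
  · intro hx
    obtain ⟨j, hj, hj'⟩ := exists_mem_Ico_zpow (abs_pos.2 hx) (one_lt_two (α := ℝ))
    exact ⟨j, hj, by rwa [← zpow_one_add₀ two_ne_zero, add_comm]⟩

theorem tsum_lintegral_shell [MeasurableSpace X] (μ : Measure X) (hf : Measurable f)
    (F : X → ℝ≥0∞) :
    ∑' j : ℤ, ∫⁻ x in shell f ((2 : ℝ) ^ j), F x ∂μ = ∫⁻ x in {x | f x ≠ 0}, F x ∂μ := by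
  rw [← lintegral_iUnion (fun _ => measurableSet_shell hf _) pairwise_disjoint_shell, iUnion_shell]

end Shell

/-- Post-composition with `f` of the ground state transform `φ / u` of `φ`. For `f` vanishing near
`0` and equal to `1` far out, it truncates `φ` between two multiples of `u`. -/
def groundComp {n : ℕ} (f : ℝ → ℝ) (u φ : Eu n → ℝ) (x : Eu n) : ℝ := u x * f (φ x / u x)

section Truncation

variable {n : ℕ} {p s t : ℝ} {k : ℕ} {f : ℝ → ℝ} {Ω : Set (Eu n)} {a : Eu n → Fin n → ℝ}
  {V u φ : Eu n → ℝ}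

namespace IsPosSol

theorem isCc_div (h : IsPosSol p s Ω a V u) (hc : IsCc Ω φ) : IsCc Ω fun x => φ x / u x :=
  isCc_of_continuousOn h.isOpen
    (hc.1.continuousOn.div h.continuousOn fun x hx => (h.pos x hx).ne') hc.2.1 hc.2.2
    fun x hx => by rw [image_eq_zero_of_notMem_tsupport hx, zero_div]

theorem isCc_groundComp (h : IsPosSol p s Ω a V u) (hf : Continuous f) (hf₀ : f 0 = 0)
    (hc : IsCc Ω φ) : IsCc Ω (groundComp f u φ) :=
  isCc_of_continuousOn h.isOpen
    (h.continuousOn.mul (hf.comp (h.isCc_div hc).1).continuousOn) hc.2.1 hc.2.2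
    fun x hx => by rw [groundComp, image_eq_zero_of_notMem_tsupport hx, zero_div, hf₀, mul_zero]

theorem hasWeakGrad_groundComp (h : IsPosSol p s Ω a V u) (hf : ContDiff ℝ 1 f) {G : Eu n → Eu n}
    (hφ : ContinuousOn φ Ω) (hG : HasWeakGrad Ω φ G) :
    HasWeakGrad Ω (groundComp f u φ) fun x => deriv f (φ x / u x) • G x +
      (f (φ x / u x) - φ x / u x * deriv f (φ x / u x)) • weakGrad Ω u x := by
  have hf' : Continuous (deriv f) := hf.continuous_deriv le_rfl
  have hdiv : ContinuousOn (fun z : ℝ × ℝ => z.1 / z.2) {z | 0 < z.2} :=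
    continuousOn_fst.div continuousOn_snd fun z hz => ne_of_gt hz
  refine HasWeakGrad.comp₂ h.isOpen hG h.hasWeakGrad hφ h.continuousOn
    (isOpen_lt continuous_const continuous_snd)
    (Φ := fun z : ℝ × ℝ => z.2 * f (z.1 / z.2)) (Φ₁ := fun z => deriv f (z.1 / z.2))
    (Φ₂ := fun z => f (z.1 / z.2) - z.1 / z.2 * deriv f (z.1 / z.2))
    (hf'.comp_continuousOn hdiv)
    ((hf.continuous.comp_continuousOn hdiv).sub (hdiv.mul (hf'.comp_continuousOn hdiv)))
    (fun z hz => ?_) h.pos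
  have hz₀ : z.2 ≠ 0 := ne_of_gt hz
  have hquot := (hasFDerivAt_fst (𝕜 := ℝ) (p := z)).mul
    ((hasDerivAt_inv hz₀).comp_hasFDerivAt z (hasFDerivAt_snd (𝕜 := ℝ)))
  have hcomp := (hf.differentiable one_ne_zero (z.1 / z.2)).hasDerivAt.comp_hasFDerivAt z hquot
  refine ((hasFDerivAt_snd (𝕜 := ℝ)).mul hcomp).congr_fderiv ?_
  ext
  · simp
    field_simp
  · simp
    field_simp
    ring

theorem memW1p_groundComp (h : IsPosSol p s Ω a V u) (hf : ContDiff ℝ 1 f) (hf₀ : f 0 = 0)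
    (hφ : MemW1p p Ω φ) (hc : IsCc Ω φ) : MemW1p p Ω (groundComp f u φ) := by
  have hf' : Continuous (deriv f) := hf.continuous_deriv le_rfl
  have hψ := (h.isCc_div hc).1
  have hτ := h.isCc_groundComp hf.continuous hf₀ hc
  obtain ⟨hK, hKΩ⟩ := hτ.2
  refine (h.hasWeakGrad_groundComp hf hc.1.continuousOn hφ.hasWeakGrad).memW1p_of_isCc h.isOpen
    hτ (MemLp.add ?_ ?_)
  · exact memLp_continuousOn_smul hK (hf'.comp hψ).continuousOn
      ((hφ.memLp_weakGrad h.isOpen).mono_measure (Measure.restrict_mono hKΩ le_rfl))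
  · exact memLp_continuousOn_smul hK
      ((hf.continuous.comp hψ).sub (hψ.mul (hf'.comp hψ))).continuousOn (h.memLp_weakGrad hK hKΩ)

theorem density_groundComp (h : IsPosSol p s Ω a V u) (hf : ContDiff ℝ 1 f) (hφ : MemW1p p Ω φ)
    (hc : Continuous φ) :
    ∀ᵐ x ∂(volume.restrict Ω), density p s Ω a u (groundComp f u φ) x =
      bregman p s a x (f (φ x / u x) • weakGrad Ω u x)
        (deriv f (φ x / u x) • (weakGrad Ω φ x - (φ x / u x) • weakGrad Ω u x)) := by
  filter_upwards [(h.hasWeakGrad_groundComp hf hc.continuousOn hφ.hasWeakGrad).weakGrad_ae_eq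
    h.isOpen, ae_restrict_mem h.isOpen.measurableSet] with x hx hxΩ
  have hquot : groundComp f u φ x / u x = f (φ x / u x) :=
    mul_div_cancel_left₀ _ (h.pos x hxΩ).ne'
  rw [density, hquot, hx]
  congr 1
  module

theorem capacity_le (h : IsPosSol p s Ω a V u) (hφ : MemW1p p Ω φ) (hc : IsCc Ω φ)
    {K : Set (Eu n)} (hK : ∀ x ∈ K, u x ≤ φ x) :
    capacity p s Ω a V u K ≤ energy p s Ω a V φ := by
  refine csInf_le ⟨0, ?_⟩ ⟨φ, hφ, hc, hK, rfl⟩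
  rintro e ⟨φ', hφ', hc', -, rfl⟩
  exact h.energy_nonneg hφ' hc'

end IsPosSol

end Truncation

/-- A smooth truncation from `0` at `|r| ≤ 1` to `1` at `|r| ≥ 2` for which the Bregman distance
satisfies, up to the constant `C`, the locality and contraction bound that makes the energy density
of `u f(φ / u)` controlled by that of `φ`. -/
structure IsTruncProfile (p s C : ℝ) (f : ℝ → ℝ) : Prop where
  contDiff : ContDiff ℝ 1 f
  eq_zero : ∀ r, |r| ≤ 1 → f r = 0
  eq_one : ∀ r, 2 ≤ |r| → f r = 1
  bregman_le : ∀ (n : ℕ) (a : Eu n → Fin n → ℝ) (x : Eu n), (∀ i, 0 < a x i) →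
    ∀ (ξ η : Eu n) (r : ℝ), bregman p s a x (f r • ξ) (deriv f r • η) ≤
      if 1 ≤ |r| ∧ |r| < 2 then C * bregman p s a x (r • ξ) η else 0

theorem exists_isTruncProfile {p s : ℝ} (hp : 1 < p) (hs : 1 < s) :
    ∃ (C : ℝ) (f : ℝ → ℝ), 0 < C ∧ IsTruncProfile p s C f := by
  obtain ⟨k, C, hk, hC, hbregman⟩ := exists_bregman_cutoff_le hp hs
  exact ⟨C, cutoff k, hC, contDiff_cutoff k, fun _ => cutoff_eq_zero hk, fun _ => cutoff_eq_one k,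
    hbregman⟩

/-- `∫_K |g| |u|^p ≤ L cap(K, u)` for all compact `K ⊆ Ω`: the capacitary inequality whose best
constant is `‖g‖_u`. -/
def CapBound {n : ℕ} (p s : ℝ) (Ω : Set (Eu n)) (a : Eu n → Fin n → ℝ) (V u g : Eu n → ℝ)
    (L : ℝ≥0) : Prop :=
  ∀ K : Set (Eu n), IsCompact K → K ⊆ Ω →
    ∫ x in K, |g x| * |u x| ^ p ≤ L * capacity p s Ω a V u K

section Mazya

variable {n : ℕ} {p s t C : ℝ} {f : ℝ → ℝ} {Ω K : Set (Eu n)} {a : Eu n → Fin n → ℝ}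
  {V u g φ : Eu n → ℝ}

namespace IsTruncProfile

theorem isCc (hf : IsTruncProfile p s C f) (h : IsPosSol p s Ω a V u) (hc : IsCc Ω φ) :
    IsCc Ω (groundComp (fun r => f (r / t)) u φ) :=
  h.isCc_groundComp (hf.contDiff.continuous.comp (continuous_id.div_const t))
    (hf.eq_zero _ (by simp)) hc

theorem memW1p (hf : IsTruncProfile p s C f) (h : IsPosSol p s Ω a V u) (hφ : MemW1p p Ω φ)
    (hc : IsCc Ω φ) : MemW1p p Ω (groundComp (fun r => f (r / t)) u φ) :=
  h.memW1p_groundComp (hf.contDiff.comp (contDiff_id.div_const t)) (hf.eq_zero _ (by simp)) hφ hc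

theorem rpow_mul_density_le (hf : IsTruncProfile p s C f) (h : IsPosSol p s Ω a V u)
    (hφ : MemW1p p Ω φ) (hc : Continuous φ) (ht : 0 < t) :
    ∀ᵐ x ∂(volume.restrict Ω),
      t ^ p * density p s Ω a u (groundComp (fun r => f (r / t)) u φ) x ≤
        (shell (fun x => φ x / u x) t).indicator (fun x => C * density p s Ω a u φ x) x := by
  have hdensity := h.density_groundComp (f := fun r => f (r / t))
    (hf.contDiff.comp (contDiff_id.div_const t)) hφ hc
  filter_upwards [hdensity, ae_restrict_mem h.isOpen.measurableSet] with x hx hxΩ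
  set r := φ x / u x
  set ξ := weakGrad Ω u x
  set η := weakGrad Ω φ x - r • ξ
  have ha := h.isCoeff.2.1 x hxΩ
  have hderiv : deriv (fun r => f (r / t)) r = t⁻¹ * deriv f (r / t) := by
    simpa [div_eq_inv_mul] using deriv_comp_mul_left t⁻¹ f r
  have hhom : t ^ p * bregman p s a x ((r / t) • ξ) (t⁻¹ • η) = density p s Ω a u φ x := by
    have hscale := bregman_smul h.one_lt_p h.one_lt_s ha t ((r / t) • ξ) (t⁻¹ • η)
    rwa [smul_smul, mul_div_cancel₀ _ ht.ne', smul_inv_smul₀ ht.ne', abs_of_pos ht, eq_comm]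
      at hscale
  have hle := mul_le_mul_of_nonneg_left (hf.bregman_le n a x ha ξ (t⁻¹ • η) (r / t))
    (Real.rpow_nonneg ht.le p)
  have hmem : x ∈ shell (fun x => φ x / u x) t ↔ 1 ≤ |r / t| ∧ |r / t| < 2 := by
    rw [abs_div, abs_of_pos ht, one_le_div ht, div_lt_iff₀ ht]
    rfl
  rw [hx, hderiv, mul_comm t⁻¹, mul_smul]
  refine hle.trans ?_
  by_cases hr : x ∈ shell (fun x => φ x / u x) t
  · rw [indicator_of_mem hr, if_pos (hmem.1 hr), mul_left_comm, hhom]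
  · rw [indicator_of_notMem hr, if_neg (mt hmem.2 hr), mul_zero]

theorem ofReal_energy_le (hf : IsTruncProfile p s C f) (hC : 0 ≤ C) (h : IsPosSol p s Ω a V u)
    (hφ : MemW1p p Ω φ) (hc : IsCc Ω φ) (ht : 0 < t) :
    ENNReal.ofReal (t ^ p) *
        ENNReal.ofReal (energy p s Ω a V (groundComp (fun r => f (r / t)) u φ)) ≤
      ENNReal.ofReal C *
        ∫⁻ x in shell (fun x => φ x / u x) t, ENNReal.ofReal (density p s Ω a u φ x) := by
  have hshell := measurableSet_shell (h.isCc_div hc).1.measurable t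
  have htp : 0 ≤ t ^ p := Real.rpow_nonneg ht.le p
  rw [h.ofReal_energy (hf.memW1p h hφ hc) (hf.isCc h hc),
    ← lintegral_const_mul' _ _ ENNReal.ofReal_ne_top,
    ← lintegral_const_mul' _ _ ENNReal.ofReal_ne_top, ← lintegral_indicator hshell]
  refine (lintegral_mono_ae ?_).trans (setLIntegral_le_lintegral Ω _)
  filter_upwards [hf.rpow_mul_density_le h hφ hc.1 ht] with x hx
  rw [← ENNReal.ofReal_mul htp]
  refine (ENNReal.ofReal_le_ofReal hx).trans_eq ?_
  by_cases hxA : x ∈ shell (fun x => φ x / u x) t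
  · rw [indicator_of_mem hxA, indicator_of_mem hxA, ENNReal.ofReal_mul hC]
  · rw [indicator_of_notMem hxA, indicator_of_notMem hxA, ENNReal.ofReal_zero]

theorem capacity_le (hf : IsTruncProfile p s C f) (h : IsPosSol p s Ω a V u)
    (hφ : MemW1p p Ω φ) (hc : IsCc Ω φ) (ht : 0 < t) :
    capacity p s Ω a V u {x | 2 * t ≤ |φ x / u x|} ≤
      energy p s Ω a V (groundComp (fun r => f (r / t)) u φ) :=
  h.capacity_le (hf.memW1p h hφ hc) (hf.isCc h hc) fun x hx => by
    rw [groundComp, hf.eq_one _ (by rwa [abs_div, abs_of_pos ht, le_div_iff₀ ht]), mul_one]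

end IsTruncProfile

theorem IsPosSol.integrableOn_mul_rpow (h : IsPosSol p s Ω a V u) (hg : LocallyIntegrableOn g Ω)
    (hK : IsCompact K) (hKΩ : K ⊆ Ω) : IntegrableOn (fun x => |g x| * |u x| ^ p) K :=
  integrableOn_mul_abs_rpow (zero_le_one.trans h.one_lt_p.le) hK
    (hg.integrableOn_compact_subset hKΩ hK).abs (h.continuousOn.mono hKΩ)

theorem subset_tsupport_of_le_abs_div (ht : 0 < t) : {x | t ≤ |φ x / u x|} ⊆ tsupport φ := by
  refine fun x hx => by_contra fun hxφ => ?_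
  have hx' : t ≤ |φ x / u x| := hx
  rw [image_eq_zero_of_notMem_tsupport hxφ, zero_div, abs_zero] at hx'
  exact ht.not_ge hx'

theorem IsPosSol.isCompact_le_abs_div (h : IsPosSol p s Ω a V u) (hc : IsCc Ω φ) (ht : 0 < t) :
    IsCompact {x | t ≤ |φ x / u x|} :=
  hc.2.1.of_isClosed_subset (isClosed_le continuous_const (h.isCc_div hc).1.abs)
    (subset_tsupport_of_le_abs_div ht)

theorem IsPosSol.lintegral_shell_le (h : IsPosSol p s Ω a V u) (hg : LocallyIntegrableOn g Ω)
    (hc : IsCc Ω φ) (ht : 0 < t) :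
    ∫⁻ x in shell (fun x => φ x / u x) t, ENNReal.ofReal (|g x| * |φ x| ^ p) ≤
      ENNReal.ofReal ((2 * t) ^ p) *
        ENNReal.ofReal (∫ x in {x | t ≤ |φ x / u x|}, |g x| * |u x| ^ p) := by
  have hsub := subset_tsupport_of_le_abs_div (u := u) (φ := φ) ht
  have htp : 0 ≤ (2 * t) ^ p := Real.rpow_nonneg (by positivity) p
  rw [ofReal_integral_eq_lintegral_ofReal
      (h.integrableOn_mul_rpow hg (h.isCompact_le_abs_div hc ht) (hsub.trans hc.2.2))
      (ae_of_all _ fun x => by positivity),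
    ← lintegral_const_mul' _ _ ENNReal.ofReal_ne_top]
  refine (setLIntegral_mono_ae' (measurableSet_shell (h.isCc_div hc).1.measurable t)
    (ae_of_all _ fun x hx => ?_)).trans (lintegral_mono_set fun x hx => hx.1)
  have hφu : |φ x| = |φ x / u x| * |u x| := by
    rw [← abs_mul, div_mul_cancel₀ _ (h.pos x (hc.2.2 (hsub hx.1))).ne']
  rw [← ENNReal.ofReal_mul htp, hφu, Real.mul_rpow (abs_nonneg _) (abs_nonneg _), mul_left_comm]
  have hp : 0 ≤ p := zero_le_one.trans h.one_lt_p.le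
  gcongr
  exact hx.2.le

theorem CapBound.lintegral_shell_two_mul_le {L : ℝ≥0} (hL : CapBound p s Ω a V u g L)
    (hf : IsTruncProfile p s C f) (hC : 0 ≤ C) (h : IsPosSol p s Ω a V u)
    (hg : LocallyIntegrableOn g Ω) (hφ : MemW1p p Ω φ) (hc : IsCc Ω φ) (ht : 0 < t) :
    ∫⁻ x in shell (fun x => φ x / u x) (2 * t), ENNReal.ofReal (|g x| * |φ x| ^ p) ≤
      ENNReal.ofReal (4 ^ p * C) * L *
        ∫⁻ x in shell (fun x => φ x / u x) t, ENNReal.ofReal (density p s Ω a u φ x) := by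
  have h2t : 0 < 2 * t := by positivity
  set E := energy p s Ω a V (groundComp (fun r => f (r / t)) u φ)
  have hlevel : ∫ x in {x | 2 * t ≤ |φ x / u x|}, |g x| * |u x| ^ p ≤ L * E :=
    (hL _ (h.isCompact_le_abs_div hc h2t) ((subset_tsupport_of_le_abs_div h2t).trans hc.2.2)).trans
      (mul_le_mul_of_nonneg_left (hf.capacity_le h hφ hc ht) L.coe_nonneg)
  have hscale : (2 * (2 * t)) ^ p = 4 ^ p * t ^ p := by
    rw [← Real.mul_rpow (by norm_num) ht.le]
    ring_nf
  calc ∫⁻ x in shell (fun x => φ x / u x) (2 * t), ENNReal.ofReal (|g x| * |φ x| ^ p)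
      ≤ ENNReal.ofReal ((2 * (2 * t)) ^ p) * ENNReal.ofReal (L * E) :=
        (h.lintegral_shell_le hg hc h2t).trans (by gcongr)
    _ = ENNReal.ofReal (4 ^ p) * L * (ENNReal.ofReal (t ^ p) * ENNReal.ofReal E) := by
        rw [hscale, ENNReal.ofReal_mul (by positivity), ENNReal.ofReal_mul L.coe_nonneg,
          ENNReal.ofReal_coe_nnreal]
        ring
    _ ≤ ENNReal.ofReal (4 ^ p) * L * (ENNReal.ofReal C *
          ∫⁻ x in shell (fun x => φ x / u x) t, ENNReal.ofReal (density p s Ω a u φ x)) := by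
        gcongr _ * ?_
        exact hf.ofReal_energy_le hC h hφ hc ht
    _ = _ := by
        rw [ENNReal.ofReal_mul (by positivity)]
        ring

theorem div_ne_zero_subset (hc : IsCc Ω φ) : {x | φ x / u x ≠ 0} ⊆ Ω :=
  fun _ hx => hc.2.2 (subset_tsupport φ fun h0 => hx (by rw [h0, zero_div]))

theorem IsPosSol.setLIntegral_div_ne_zero (h : IsPosSol p s Ω a V u) (hc : IsCc Ω φ) :
    ∫⁻ x in {x | φ x / u x ≠ 0}, ENNReal.ofReal (|g x| * |φ x| ^ p) =
      ∫⁻ x in Ω, ENNReal.ofReal (|g x| * |φ x| ^ p) := by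
  have hp : p ≠ 0 := (zero_lt_one.trans h.one_lt_p).ne'
  have hsupport : Function.support (fun x => ENNReal.ofReal (|g x| * |φ x| ^ p)) ⊆
      Function.support φ := fun x hx h0 => hx (by simp [h0, hp])
  have hφΩ : Function.support φ ⊆ Ω := (subset_tsupport φ).trans hc.2.2
  have hne : Function.support φ ⊆ {x | φ x / u x ≠ 0} := fun x hx =>
    div_ne_zero hx (h.pos x (hφΩ hx)).ne'
  rw [setLIntegral_eq_of_support_subset (hsupport.trans hne),
    setLIntegral_eq_of_support_subset (hsupport.trans hφΩ)]

theorem exists_lintegral_le_of_capBound {p s : ℝ} (hp : 1 < p) (hs : 1 < s) :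
    ∃ C : ℝ, 0 < C ∧ ∀ (n : ℕ) (Ω : Set (Eu n)) (a : Eu n → Fin n → ℝ) (V u : Eu n → ℝ),
      IsPosSol p s Ω a V u → ∀ g : Eu n → ℝ, LocallyIntegrableOn g Ω → ∀ L : ℝ≥0,
      CapBound p s Ω a V u g L → ∀ φ : Eu n → ℝ, MemW1p p Ω φ → IsCc Ω φ →
        ∫⁻ x in Ω, ENNReal.ofReal (|g x| * |φ x| ^ p) ≤
          ENNReal.ofReal C * L * ENNReal.ofReal (energy p s Ω a V φ) := by
  obtain ⟨C, f, hC, hf⟩ := exists_isTruncProfile hp hs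
  refine ⟨4 ^ p * C, by positivity, fun n Ω a V u h g hg L hL φ hφ hc => ?_⟩
  have hψ : Measurable fun x => φ x / u x := (h.isCc_div hc).1.measurable
  have hlevel (j : ℤ) := hL.lintegral_shell_two_mul_le hf hC.le h hg hφ hc
    (by positivity : (0 : ℝ) < 2 ^ j)
  simp only [← zpow_one_add₀ (two_ne_zero (α := ℝ))] at hlevel
  calc ∫⁻ x in Ω, ENNReal.ofReal (|g x| * |φ x| ^ p)
      = ∑' j : ℤ, ∫⁻ x in shell (fun x => φ x / u x) ((2 : ℝ) ^ (1 + j)),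
          ENNReal.ofReal (|g x| * |φ x| ^ p) := by
        rw [← h.setLIntegral_div_ne_zero hc, ← tsum_lintegral_shell _ hψ]
        exact ((Equiv.addLeft (1 : ℤ)).tsum_eq _).symm
    _ ≤ ∑' j : ℤ, ENNReal.ofReal (4 ^ p * C) * L *
          ∫⁻ x in shell (fun x => φ x / u x) ((2 : ℝ) ^ j),
            ENNReal.ofReal (density p s Ω a u φ x) := ENNReal.tsum_le_tsum hlevel
    _ = ENNReal.ofReal (4 ^ p * C) * L *
          ∫⁻ x in {x | φ x / u x ≠ 0}, ENNReal.ofReal (density p s Ω a u φ x) := by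
        rw [ENNReal.tsum_mul_left, tsum_lintegral_shell _ hψ]
    _ ≤ _ := by
        rw [h.ofReal_energy hφ hc]
        gcongr
        exact div_ne_zero_subset hc

end Mazya

/-! ### The Hardy inequality for Sobolev functions -/

section Extension

open scoped Topology
open Filter

variable {n : ℕ} {p s : ℝ} {Ω : Set (Eu n)} {a : Eu n → Fin n → ℝ} {V u g φ : Eu n → ℝ}

theorem integrableOn_abs_mul_abs_rpow (hp : 0 < p) (hg : LocallyIntegrableOn g Ω)
    (hc : IsCc Ω φ) : IntegrableOn (fun x => |g x| * |φ x| ^ p) Ω := by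
  refine ((integrableOn_iff_integrable_of_support_subset fun x hx => ?_).1
    (integrableOn_mul_abs_rpow hp.le hc.2.1 (hg.integrableOn_compact_subset hc.2.2 hc.2.1).abs
      hc.1.continuousOn)).integrableOn
  exact subset_tsupport φ fun h0 => hx (by simp [h0, hp.ne'])

theorem hardy_of_forall_isTest (hp : 1 < p) (hs : 1 < s) (hΩ : IsOpen Ω) (ha : IsCoeff Ω a)
    (hV : LocallyIntegrableOn V Ω) (hg : LocallyIntegrableOn g Ω) {C : ℝ}
    (hardy : ∀ φ, IsTest Ω φ → C * ∫ x in Ω, |g x| * |φ x| ^ p ≤ energy p s Ω a V φ)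
    (hφ : MemW1p p Ω φ) (hc : IsCc Ω φ) :
    C * ∫ x in Ω, |g x| * |φ x| ^ p ≤ energy p s Ω a V φ := by
  have hp0 : 0 < p := zero_lt_one.trans hp
  have hs0 : 0 < s := zero_lt_one.trans hs
  obtain ⟨K, F, hK, hKΩ, hφK, hF, hunif, hgrad⟩ := hφ.exists_test_seq hp.le hΩ hc
  have hFW (k) : MemW1p p Ω (F k) := (hF k).1.memW1p hΩ
  have hlim {w : Eu n → ℝ} (hw : IntegrableOn w K) :
      Tendsto (fun k => ∫ x in K, w x * |F k x| ^ p) atTop (𝓝 (∫ x in K, w x * |φ x| ^ p)) :=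
    tendsto_setIntegral_mul_comp hK hK.measurableSet hw hc.1.continuousOn
      (fun k => (hF k).1.isCc.1.continuousOn) hunif.tendstoUniformlyOn
      (continuous_abs_rpow hp0.le)
  have hlimG := ha.tendsto_setIntegral_saNorm_rpow hp.le hs.le hΩ hK hKΩ
    (fun k => ((hFW k).memLp_weakGrad hΩ).mono_measure (Measure.restrict_mono hKΩ le_rfl))
    ((hφ.memLp_weakGrad hΩ).mono_measure (Measure.restrict_mono hKΩ le_rfl)) hgrad
  have hrestrict {f : Eu n → ℝ} (hf : tsupport f ⊆ K) :
      ∫ x in Ω, |g x| * |f x| ^ p = ∫ x in K, |g x| * |f x| ^ p :=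
    setIntegral_mul_of_tsupport_subset hΩ hKΩ hf (fun x => |g x|) (ψ := fun y => |y| ^ p)
      (by simp [hp0.ne'])
  rw [energy_eq_add hp0 hs0 hΩ ha hV hφ hc.1 hK hKΩ hφK, hrestrict hφK]
  refine le_of_tendsto_of_tendsto'
    ((hlim (hg.integrableOn_compact_subset hKΩ hK).abs).const_mul C)
    (hlimG.add (hlim (hV.integrableOn_compact_subset hKΩ hK))) fun k => ?_
  rw [← hrestrict (hF k).2,
    ← energy_eq_add hp0 hs0 hΩ ha hV (hFW k) (hF k).1.isCc.1 hK hKΩ (hF k).2]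
  exact hardy (F k) (hF k).1

end Extension

/-! ### Comparison of the two norms -/

section Norms

variable {n : ℕ} {p s : ℝ} {Ω K : Set (Eu n)} {a : Eu n → Fin n → ℝ} {V u g φ : Eu n → ℝ}

theorem lintegral_mul_abs_rpow_eq (hp : 0 < p) (hg : LocallyIntegrableOn g Ω) (hc : IsCc Ω φ) :
    ∫⁻ x in Ω, ENNReal.ofReal (|g x| * |φ x| ^ p) =
      ENNReal.ofReal (∫ x in Ω, |g x| * |φ x| ^ p) :=
  (ofReal_integral_eq_lintegral_ofReal (integrableOn_abs_mul_abs_rpow hp hg hc)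
    (ae_of_all _ fun x => by positivity)).symm

theorem lintegral_mul_abs_rpow_ne_top (hp : 0 < p) (hg : LocallyIntegrableOn g Ω)
    (hc : IsCc Ω φ) : ∫⁻ x in Ω, ENNReal.ofReal (|g x| * |φ x| ^ p) ≠ ∞ := by
  rw [lintegral_mul_abs_rpow_eq hp hg hc]
  exact ENNReal.ofReal_ne_top

theorem IsPosSol.capacity_nonneg (h : IsPosSol p s Ω a V u) (K : Set (Eu n)) :
    0 ≤ capacity p s Ω a V u K := by
  refine Real.sInf_nonneg ?_
  rintro e ⟨φ, hφ, hc, -, rfl⟩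
  exact h.energy_nonneg hφ hc

theorem CapBound.uNorm_le {L : ℝ≥0} (hL : CapBound p s Ω a V u g L) : uNorm p s Ω a V u g ≤ L :=
  iInf₂_le L hL

theorem IsPosSol.capBound_of_uNorm_le (h : IsPosSol p s Ω a V u) {L : ℝ≥0}
    (hL : uNorm p s Ω a V u g ≤ L) : CapBound p s Ω a V u g L := by
  intro K hK hKΩ
  rcases (h.capacity_nonneg K).eq_or_lt with h0 | h0
  · obtain ⟨M, hM⟩ := iInf_lt_iff.1 (hL.trans_lt ENNReal.coe_lt_top)
    obtain ⟨hM, -⟩ := iInf_lt_iff.1 hM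
    simpa [← h0] using hM K hK hKΩ
  · have hle : ENNReal.ofReal ((∫ x in K, |g x| * |u x| ^ p) / capacity p s Ω a V u K) ≤
        uNorm p s Ω a V u g :=
      le_iInf₂ fun M hM => by
        rw [ENNReal.ofReal_le_coe, div_le_iff₀ h0]
        exact hM K hK hKΩ
    rw [← div_le_iff₀ h0, ← ENNReal.ofReal_le_coe]
    exact hle.trans hL

theorem IsPosSol.uNorm_le_iff (h : IsPosSol p s Ω a V u) {L : ℝ≥0} :
    uNorm p s Ω a V u g ≤ L ↔ CapBound p s Ω a V u g L :=
  ⟨h.capBound_of_uNorm_le, CapBound.uNorm_le⟩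

theorem IsPosSol.exists_memW1p_isCc_ge (h : IsPosSol p s Ω a V u) (hK : IsCompact K)
    (hKΩ : K ⊆ Ω) : ∃ φ, MemW1p p Ω φ ∧ IsCc Ω φ ∧ ∀ x ∈ K, u x ≤ φ x := by
  obtain ⟨χ, hχ, hχ₁⟩ := exists_test_eq_one h.isOpen hK hKΩ
  have hχc := hχ.isCc
  have hgrad : HasWeakGrad Ω (fun x => χ x * u x)
      (fun x => u x • gradient χ x + χ x • weakGrad Ω u x) :=
    HasWeakGrad.comp₂ h.isOpen (hasWeakGrad_of_contDiff h.isOpen hχ.contDiff_one)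
      h.hasWeakGrad hχc.1.continuousOn h.continuousOn isOpen_univ
      (Φ := fun z => z.1 * z.2) (Φ₁ := fun z => z.2) (Φ₂ := fun z => z.1)
      continuousOn_snd continuousOn_fst
      (fun z _ => (hasFDerivAt_fst.mul hasFDerivAt_snd).congr_fderiv (add_comm _ _))
      fun _ _ => mem_univ _
  have hc : IsCc Ω fun x => χ x * u x :=
    isCc_of_continuousOn h.isOpen (hχc.1.continuousOn.mul h.continuousOn) hχc.2.1 hχc.2.2
      fun x hx => by rw [image_eq_zero_of_notMem_tsupport hx, zero_mul]
  refine ⟨_, hgrad.memW1p_of_isCc h.isOpen hc (MemLp.add ?_ ?_), hc, fun x hx => ?_⟩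
  · refine memLp_continuousOn_smul hc.2.1 (h.continuousOn.mono hc.2.2) ?_
    refine ((continuous_gradient hχ.contDiff_one).memLp_of_hasCompactSupport ?_).restrict _
    exact HasCompactSupport.intro hχc.2.1 fun x => gradient_of_notMem_tsupport
  · exact memLp_continuousOn_smul hc.2.1 hχc.1.continuousOn (h.memLp_weakGrad hc.2.1 hc.2.2)
  · simp [(hχ₁ x hx).self_of_nhds]

theorem IsPosSol.capBound_of_forall_integral_le (h : IsPosSol p s Ω a V u)
    (hg : LocallyIntegrableOn g Ω) {L : ℝ≥0} (hL : ∀ φ, MemW1p p Ω φ → IsCc Ω φ →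
      ∫ x in Ω, |g x| * |φ x| ^ p ≤ L * energy p s Ω a V φ) : CapBound p s Ω a V u g L := by
  intro K hK hKΩ
  have hp : 0 < p := zero_lt_one.trans h.one_lt_p
  have hcompare {φ : Eu n → ℝ} (hφ : MemW1p p Ω φ) (hc : IsCc Ω φ) (hKφ : ∀ x ∈ K, u x ≤ φ x) :
      ∫ x in K, |g x| * |u x| ^ p ≤ L * energy p s Ω a V φ := by
    have hInt := integrableOn_abs_mul_abs_rpow hp hg hc
    calc ∫ x in K, |g x| * |u x| ^ p ≤ ∫ x in K, |g x| * |φ x| ^ p := by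
          refine setIntegral_mono_on (h.integrableOn_mul_rpow hg hK hKΩ) (hInt.mono_set hKΩ)
            hK.measurableSet fun x hx => ?_
          have habs := abs_le_abs_of_nonneg (h.pos x (hKΩ hx)).le (hKφ x hx)
          gcongr
      _ ≤ ∫ x in Ω, |g x| * |φ x| ^ p :=
          setIntegral_mono_set hInt (ae_of_all _ fun x => by positivity) hKΩ.eventuallyLE
      _ ≤ L * energy p s Ω a V φ := hL φ hφ hc
  obtain ⟨φ₀, hφ₀, hc₀, hK₀⟩ := h.exists_memW1p_isCc_ge hK hKΩ
  rcases eq_zero_or_pos L with rfl | hLpos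
  · simpa using hcompare hφ₀ hc₀ hK₀
  · have hLpos : (0 : ℝ) < L := hLpos
    rw [← div_le_iff₀' hLpos]
    refine le_csInf ⟨_, φ₀, hφ₀, hc₀, hK₀, rfl⟩ ?_
    rintro e ⟨φ, hφ, hc, hKφ, rfl⟩
    rw [div_le_iff₀' hLpos]
    exact hcompare hφ hc hKφ

theorem hNorm_lt_top (hp : 1 < p) (hs : 1 < s) (hΩ : IsOpen Ω) (ha : IsCoeff Ω a)
    (hV : LocallyIntegrableOn V Ω) (hg : IsHardyWeight p s Ω a V g) :
    hNorm p s Ω a V g < ∞ := by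
  have hp0 : 0 < p := zero_lt_one.trans hp
  obtain ⟨hgi, C, hC, hardy⟩ := hg
  rw [hNorm, ENNReal.inv_lt_top]
  refine (ENNReal.ofReal_pos.2 hC).trans_le (le_iInf fun φ => le_iInf fun hφ => le_iInf fun hc =>
    le_iInf fun hI => ?_)
  rw [ENNReal.le_div_iff_mul_le (.inl hI.ne') (.inl (lintegral_mul_abs_rpow_ne_top hp0 hgi hc)),
    lintegral_mul_abs_rpow_eq hp0 hgi hc, ← ENNReal.ofReal_mul hC.le]
  exact ENNReal.ofReal_le_ofReal (hardy_of_forall_isTest hp hs hΩ ha hV hgi hardy hφ hc)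

theorem lintegral_le_hNorm_mul_energy (hp : 0 < p) (hg : LocallyIntegrableOn g Ω)
    (hφ : MemW1p p Ω φ) (hc : IsCc Ω φ) (hfin : hNorm p s Ω a V g < ∞) :
    ∫⁻ x in Ω, ENNReal.ofReal (|g x| * |φ x| ^ p) ≤
      hNorm p s Ω a V g * ENNReal.ofReal (energy p s Ω a V φ) := by
  have hItop := lintegral_mul_abs_rpow_ne_top hp hg hc
  set I := ∫⁻ x in Ω, ENNReal.ofReal (|g x| * |φ x| ^ p)
  rcases eq_or_ne I 0 with h0 | h0
  · rw [h0]
    exact zero_le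
  have hquot : I / ENNReal.ofReal (energy p s Ω a V φ) ≤ hNorm p s Ω a V g := by
    rw [hNorm, ← ENNReal.inv_div (.inl hItop) (.inl h0)]
    exact ENNReal.inv_le_inv.2 (iInf₂_le_of_le φ hφ (iInf₂_le hc (pos_iff_ne_zero.2 h0)))
  have hE : ENNReal.ofReal (energy p s Ω a V φ) ≠ 0 := fun hE => by
    rw [hE, ENNReal.div_zero h0] at hquot
    exact hfin.not_ge hquot
  exact (ENNReal.div_le_iff_le_mul (.inl hE) (.inl ENNReal.ofReal_ne_top)).1 hquot

theorem hNorm_le_of_forall_lintegral_le (hp : 0 < p) (hg : LocallyIntegrableOn g Ω) {M : ℝ≥0∞}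
    (hM : ∀ φ, MemW1p p Ω φ → IsCc Ω φ → ∫⁻ x in Ω, ENNReal.ofReal (|g x| * |φ x| ^ p) ≤
      M * ENNReal.ofReal (energy p s Ω a V φ)) : hNorm p s Ω a V g ≤ M := by
  rw [hNorm, ENNReal.inv_le_iff_inv_le]
  refine le_iInf fun φ => le_iInf fun hφ => le_iInf fun hc => le_iInf fun hI => ?_
  have hle := hM φ hφ hc
  have hM₀ : M ≠ 0 := fun h0 => hI.not_ge (by rwa [h0, zero_mul] at hle)
  rw [ENNReal.le_div_iff_mul_le (.inl hI.ne') (.inl (lintegral_mul_abs_rpow_ne_top hp hg hc))]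
  rcases eq_or_ne M ∞ with rfl | hMtop
  · simp
  · exact (ENNReal.inv_mul_le_iff hM₀ hMtop).2 hle

theorem IsPosSol.integral_le_of_lintegral_le (h : IsPosSol p s Ω a V u)
    (hg : LocallyIntegrableOn g Ω) (hφ : MemW1p p Ω φ) (hc : IsCc Ω φ) {M : ℝ} (hM : 0 ≤ M)
    (hle : ∫⁻ x in Ω, ENNReal.ofReal (|g x| * |φ x| ^ p) ≤
      ENNReal.ofReal M * ENNReal.ofReal (energy p s Ω a V φ)) :
    ∫ x in Ω, |g x| * |φ x| ^ p ≤ M * energy p s Ω a V φ := by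
  rwa [lintegral_mul_abs_rpow_eq (zero_lt_one.trans h.one_lt_p) hg hc, ← ENNReal.ofReal_mul hM,
    ENNReal.ofReal_le_ofReal_iff (mul_nonneg hM (h.energy_nonneg hφ hc))] at hle

theorem IsPosSol.isHardyWeight_of_forall_integral_le (h : IsPosSol p s Ω a V u)
    (hg : LocallyIntegrableOn g Ω) {M : ℝ} (hM : ∀ φ, MemW1p p Ω φ → IsCc Ω φ →
      ∫ x in Ω, |g x| * |φ x| ^ p ≤ M * energy p s Ω a V φ) : IsHardyWeight p s Ω a V g := by
  refine ⟨hg, (max M 1)⁻¹, by positivity, fun φ hφ => ?_⟩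
  have hφ' : MemW1p p Ω φ := hφ.memW1p h.isOpen
  rw [inv_mul_le_iff₀ (by positivity)]
  exact (hM φ hφ' hφ.isCc).trans
    (mul_le_mul_of_nonneg_right (le_max_left M 1) (h.energy_nonneg hφ' hφ.isCc))

theorem IsPosSol.hNorm_lt_top (h : IsPosSol p s Ω a V u) (hg : IsHardyWeight p s Ω a V g) :
    hNorm p s Ω a V g < ∞ :=
  HardyMazya.hNorm_lt_top h.one_lt_p h.one_lt_s h.isOpen h.isCoeff h.locallyIntegrableOn hg

theorem IsPosSol.uNorm_le_hNorm (h : IsPosSol p s Ω a V u) (hg : IsHardyWeight p s Ω a V g) :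
    uNorm p s Ω a V u g ≤ hNorm p s Ω a V g := by
  have hfin := h.hNorm_lt_top hg
  rw [← ENNReal.coe_toNNReal hfin.ne, h.uNorm_le_iff]
  refine h.capBound_of_forall_integral_le hg.1 fun φ hφ hc =>
    h.integral_le_of_lintegral_le hg.1 hφ hc NNReal.zero_le_coe ?_
  rw [ENNReal.ofReal_coe_nnreal, ENNReal.coe_toNNReal hfin.ne]
  exact lintegral_le_hNorm_mul_energy (zero_lt_one.trans h.one_lt_p) hg.1 hφ hc hfin

theorem exists_hNorm_le_uNorm (hp : 1 < p) (hs : 1 < s) :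
    ∃ C : ℝ, 0 < C ∧ ∀ (n : ℕ) (Ω : Set (Eu n)) (a : Eu n → Fin n → ℝ) (V u : Eu n → ℝ),
      IsPosSol p s Ω a V u → ∀ g : Eu n → ℝ, LocallyIntegrableOn g Ω → uNorm p s Ω a V u g < ∞ →
        IsHardyWeight p s Ω a V g ∧
        hNorm p s Ω a V g ≤ ENNReal.ofReal C * uNorm p s Ω a V u g := by
  obtain ⟨C, hC, hhardy⟩ := exists_lintegral_le_of_capBound hp hs
  refine ⟨C, hC, fun n Ω a V u h g hg hlt => ?_⟩
  lift uNorm p s Ω a V u g to ℝ≥0 using hlt.ne with L hL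
  have hle := hhardy n Ω a V u h g hg L (h.capBound_of_uNorm_le hL.ge)
  refine ⟨h.isHardyWeight_of_forall_integral_le hg fun φ hφ hc =>
    h.integral_le_of_lintegral_le hg hφ hc (M := C * L) (by positivity) ?_,
    hNorm_le_of_forall_lintegral_le (zero_lt_one.trans hp) hg hle⟩
  rw [ENNReal.ofReal_mul hC.le, ENNReal.ofReal_coe_nnreal]
  exact hle φ hφ hc

theorem IsPosSol.isHardyWeight_iff (h : IsPosSol p s Ω a V u) (hg : LocallyIntegrableOn g Ω) :
    IsHardyWeight p s Ω a V g ↔ uNorm p s Ω a V u g < ∞ := by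
  obtain ⟨C, -, hC⟩ := exists_hNorm_le_uNorm h.one_lt_p h.one_lt_s
  exact ⟨fun hw => (h.uNorm_le_hNorm hw).trans_lt (h.hNorm_lt_top hw),
    fun hlt => (hC n Ω a V u h g hg hlt).1⟩

end Norms

/-! ### Completeness of the space of Hardy-weights -/

section Banach

open Filter
open scoped Topology

theorem isBanachNorm_of_core {X : Type*} [AddCommGroup X] [Module ℝ X] {N : X → ℝ}
    (core : @NormedSpace.Core ℝ X _ _ _ ⟨N⟩)
    (hlim : ∀ f : ℕ → X, (∀ k l m, k ≤ l → k ≤ m → N (f l - f m) ≤ (1 / 2) ^ k) →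
      ∃ x, ∀ k, N (f k - x) ≤ (1 / 2) ^ k) : IsBanachNorm X N := by
  refine ⟨core, ?_⟩
  let _ : NormedAddCommGroup X := @NormedAddCommGroup.ofCore ℝ X _ _ _ ⟨N⟩ core
  have hdist (x y : X) : dist x y = N (x - y) := dist_eq_norm x y
  refine Metric.complete_of_convergent_controlled_sequences (fun k => (1 / 2 : ℝ) ^ k)
    (fun k => by positivity) fun f hf => ?_
  obtain ⟨x, hx⟩ := hlim f fun k l m hl hm => hdist (f l) (f m) ▸ (hf k l m hl hm).le
  refine ⟨x, tendsto_iff_dist_tendsto_zero.2 ?_⟩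
  exact squeeze_zero (fun _ => dist_nonneg) (fun k => (hdist (f k) x).trans_le (hx k))
    (tendsto_pow_atTop_nhds_zero_of_lt_one (by norm_num) (by norm_num))

variable {n : ℕ} {p s : ℝ} {Ω K : Set (Eu n)} {a : Eu n → Fin n → ℝ} {V u g g' : Eu n → ℝ}
  {L L' : ℝ≥0}

theorem ae_restrict_of_forall_isCompact (hΩ : IsOpen Ω) {P : Eu n → Prop}
    (h : ∀ K, IsCompact K → K ⊆ Ω → ∀ᵐ x ∂volume.restrict K, P x) :
    ∀ᵐ x ∂volume.restrict Ω, P x := by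
  have : LocallyCompactSpace Ω := hΩ.isLocallyClosed.locallyCompactSpace
  obtain ⟨K, hK, hKΩ⟩ := isSigmaCompact_iff_sigmaCompactSpace.2
    (inferInstance : SigmaCompactSpace Ω)
  rw [← hKΩ, ae_restrict_iUnion_iff]
  exact fun i => h _ (hK i) (hKΩ ▸ subset_iUnion K i)

theorem CapBound.congr (hL : CapBound p s Ω a V u g L) (hgg' : g =ᵐ[volume.restrict Ω] g') :
    CapBound p s Ω a V u g' L := fun K hK hKΩ => by
  rw [← integral_congr_ae (f := fun x => |g x| * |u x| ^ p)]
  · exact hL K hK hKΩ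
  · filter_upwards [ae_mono (Measure.restrict_mono hKΩ le_rfl) hgg'] with x hx
    rw [hx]

theorem CapBound.smul (hL : CapBound p s Ω a V u g L) (c : ℝ) :
    CapBound p s Ω a V u (c • g) (‖c‖₊ * L) := fun K hK hKΩ => by
  have habs (x : Eu n) : |(c • g) x| * |u x| ^ p = |c| * (|g x| * |u x| ^ p) := by
    rw [Pi.smul_apply, smul_eq_mul, abs_mul, mul_assoc]
  simp_rw [habs, integral_const_mul]
  rw [NNReal.coe_mul, coe_nnnorm, Real.norm_eq_abs, mul_assoc]
  exact mul_le_mul_of_nonneg_left (hL K hK hKΩ) (abs_nonneg c)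

namespace IsPosSol

theorem capBound_zero (h : IsPosSol p s Ω a V u) : CapBound p s Ω a V u 0 L := fun K _ _ => by
  simpa using mul_nonneg L.coe_nonneg (h.capacity_nonneg K)

theorem capBound_add (h : IsPosSol p s Ω a V u) (hg : LocallyIntegrableOn g Ω)
    (hg' : LocallyIntegrableOn g' Ω) (hL : CapBound p s Ω a V u g L)
    (hL' : CapBound p s Ω a V u g' L') : CapBound p s Ω a V u (g + g') (L + L') := by
  intro K hK hKΩ
  have hInt := h.integrableOn_mul_rpow hg hK hKΩ
  have hInt' := h.integrableOn_mul_rpow hg' hK hKΩ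
  calc ∫ x in K, |(g + g') x| * |u x| ^ p
      ≤ ∫ x in K, (|g x| * |u x| ^ p + |g' x| * |u x| ^ p) := by
        refine integral_mono (h.integrableOn_mul_rpow (hg.add hg') hK hKΩ) (hInt.add hInt')
          fun x => ?_
        beta_reduce
        rw [← add_mul]
        exact mul_le_mul_of_nonneg_right (abs_add_le _ _) (by positivity)
    _ = (∫ x in K, |g x| * |u x| ^ p) + ∫ x in K, |g' x| * |u x| ^ p := integral_add hInt hInt'
    _ ≤ L * capacity p s Ω a V u K + L' * capacity p s Ω a V u K :=
        add_le_add (hL K hK hKΩ) (hL' K hK hKΩ)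
    _ = ↑(L + L') * capacity p s Ω a V u K := by rw [NNReal.coe_add, add_mul]

theorem ae_eq_zero_of_capBound_zero (h : IsPosSol p s Ω a V u)
    (hg : LocallyIntegrableOn g Ω) (h₀ : CapBound p s Ω a V u g 0) :
    g =ᵐ[volume.restrict Ω] 0 := by
  refine ae_restrict_of_forall_isCompact h.isOpen fun K hK hKΩ => ?_
  have hnonneg (x : Eu n) : 0 ≤ |g x| * |u x| ^ p := by positivity
  have hzero : ∫ x in K, |g x| * |u x| ^ p = 0 :=
    le_antisymm (by simpa using h₀ K hK hKΩ) (integral_nonneg hnonneg)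
  rw [integral_eq_zero_iff_of_nonneg hnonneg (h.integrableOn_mul_rpow hg hK hKΩ)] at hzero
  filter_upwards [hzero, ae_restrict_mem hK.measurableSet] with x hx hxK
  have hu : |u x| ^ p ≠ 0 := (Real.rpow_pos_of_pos (abs_pos.2 (h.pos x (hKΩ hxK)).ne') p).ne'
  exact abs_eq_zero.1 ((mul_eq_zero.1 hx).resolve_right hu)

theorem ofReal_integral_eq_eLpNorm (h : IsPosSol p s Ω a V u) (hK : MeasurableSet K)
    (hKΩ : K ⊆ Ω) (hInt : IntegrableOn (fun x => g x * u x ^ p) K) :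
    ENNReal.ofReal (∫ x in K, |g x| * |u x| ^ p) =
      eLpNorm (fun x => g x * u x ^ p) 1 (volume.restrict K) := by
  rw [eLpNorm_one_eq_lintegral_enorm, ← ofReal_integral_norm_eq_lintegral_enorm hInt]
  congr 1
  refine setIntegral_congr_fun hK fun x hx => ?_
  have hux := h.pos x (hKΩ hx)
  rw [norm_mul, Real.norm_eq_abs, Real.norm_of_nonneg (Real.rpow_nonneg hux.le p),
    abs_of_pos hux]

theorem eLpNorm_le_of_capBound (h : IsPosSol p s Ω a V u) (hg : LocallyIntegrableOn g Ω)
    (hL : CapBound p s Ω a V u g L) (hK : IsCompact K) (hKΩ : K ⊆ Ω) :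
    eLpNorm (fun x => g x * u x ^ p) 1 (volume.restrict K) ≤
      ENNReal.ofReal (L * capacity p s Ω a V u K) := by
  rw [← h.ofReal_integral_eq_eLpNorm hK.measurableSet hKΩ
    ((hg.integrableOn_compact_subset hKΩ hK).mul_continuousOn
      ((h.continuousOn_rpow p).mono hKΩ) hK)]
  exact ENNReal.ofReal_le_ofReal (hL K hK hKΩ)

theorem locallyIntegrableOn_and_capBound_of_eLpNorm_le (h : IsPosSol p s Ω a V u)
    (hg : AEStronglyMeasurable g (volume.restrict Ω))
    (hL : ∀ K, IsCompact K → K ⊆ Ω → eLpNorm (fun x => g x * u x ^ p) 1 (volume.restrict K) ≤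
      ENNReal.ofReal (L * capacity p s Ω a V u K)) :
    LocallyIntegrableOn g Ω ∧ CapBound p s Ω a V u g L := by
  have hInt (K : Set (Eu n)) (hK : IsCompact K) (hKΩ : K ⊆ Ω) :
      IntegrableOn (fun x => g x * u x ^ p) K := by
    refine memLp_one_iff_integrable.1 ⟨?_, (hL K hK hKΩ).trans_lt ENNReal.ofReal_lt_top⟩
    exact (hg.mono_measure (Measure.restrict_mono hKΩ le_rfl)).mul
      (((h.continuousOn_rpow p).mono hKΩ).aestronglyMeasurable hK.measurableSet)
  refine ⟨(locallyIntegrableOn_iff h.isOpen.isLocallyClosed).2 fun K hKΩ hK => ?_,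
    fun K hK hKΩ => ?_⟩
  · refine Integrable.congr ((hInt K hK hKΩ).mul_continuousOn
      ((h.continuousOn_rpow (-p)).mono hKΩ) hK) ?_
    refine ae_restrict_of_forall_mem hK.measurableSet fun x hx => ?_
    beta_reduce
    rw [mul_assoc, ← Real.rpow_add (h.pos x (hKΩ hx)), add_neg_cancel, Real.rpow_zero, mul_one]
  · rw [← ENNReal.ofReal_le_ofReal_iff (mul_nonneg L.coe_nonneg (h.capacity_nonneg K)),
      h.ofReal_integral_eq_eLpNorm hK.measurableSet hKΩ (hInt K hK hKΩ)]
    exact hL K hK hKΩ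

theorem locallyIntegrableOn_and_capBound_of_tendsto_ae (h : IsPosSol p s Ω a V u)
    {f : ℕ → Eu n → ℝ} (hf : ∀ k, LocallyIntegrableOn (f k) Ω)
    (hL : ∀ᶠ k in atTop, CapBound p s Ω a V u (f k) L)
    (hfg : ∀ᵐ x ∂volume.restrict Ω, Tendsto (fun k => f k x) atTop (𝓝 (g x))) :
    LocallyIntegrableOn g Ω ∧ CapBound p s Ω a V u g L := by
  refine h.locallyIntegrableOn_and_capBound_of_eLpNorm_le
    (aestronglyMeasurable_of_tendsto_ae _ (fun k => (hf k).aestronglyMeasurable) hfg)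
    fun K hK hKΩ => ?_
  have hmeas (k : ℕ) :
      AEStronglyMeasurable (fun x => f k x * u x ^ p) (volume.restrict K) :=
    ((hf k).aestronglyMeasurable.mono_measure (Measure.restrict_mono hKΩ le_rfl)).mul
      (((h.continuousOn_rpow p).mono hKΩ).aestronglyMeasurable hK.measurableSet)
  refine (Lp.eLpNorm_lim_le_liminf_eLpNorm hmeas _ ?_).trans
    (liminf_le_of_le (by isBoundedDefault) fun b hb => ?_)
  · filter_upwards [ae_mono (Measure.restrict_mono hKΩ le_rfl) hfg] with x hx
    exact hx.mul_const _
  · obtain ⟨k, hk, hLk⟩ := (hb.and hL).exists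
    exact hk.trans (h.eLpNorm_le_of_capBound (hf k) hLk hK hKΩ)

theorem ae_exists_tendsto (h : IsPosSol p s Ω a V u) {f : ℕ → Eu n → ℝ}
    (hf : ∀ k, LocallyIntegrableOn (f k) Ω)
    (hcauchy : ∀ k l m, k ≤ l → k ≤ m → CapBound p s Ω a V u (f l - f m) ((1 / 2) ^ k)) :
    ∀ᵐ x ∂volume.restrict Ω, ∃ y, Tendsto (fun k => f k x) atTop (𝓝 y) := by
  refine ae_restrict_of_forall_isCompact h.isOpen fun K hK hKΩ => ?_
  have hcap := h.capacity_nonneg K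
  have hlim : ∀ᵐ x ∂volume.restrict K, ∃ y, Tendsto (fun k => f k x * u x ^ p) atTop (𝓝 y) := by
    refine Lp.ae_tendsto_of_cauchy_eLpNorm (p := 1)
      (B := fun k => ENNReal.ofReal ((1 / 2 : ℝ) ^ k * (capacity p s Ω a V u K + 1)))
      (fun k => ((hf k).aestronglyMeasurable.mono_measure
        (Measure.restrict_mono hKΩ le_rfl)).mul
          (((h.continuousOn_rpow p).mono hKΩ).aestronglyMeasurable hK.measurableSet))
      le_rfl ?_ fun k l m hl hm => ?_
    · exact (summable_geometric_two.mul_right _).tsum_ofReal_ne_top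
    · have hle := h.eLpNorm_le_of_capBound ((hf l).sub (hf m)) (hcauchy k l m hl hm) hK hKΩ
      simp only [Pi.sub_apply, sub_mul] at hle
      refine hle.trans_lt ((ENNReal.ofReal_lt_ofReal_iff (by positivity)).2 ?_)
      push_cast
      gcongr
      exact lt_add_one _
  filter_upwards [hlim, ae_restrict_mem hK.measurableSet] with x ⟨y, hy⟩ hx
  refine ⟨y / u x ^ p, (hy.div_const (u x ^ p)).congr fun k => ?_⟩
  exact mul_div_cancel_right₀ _ (Real.rpow_pos_of_pos (h.pos x (hKΩ hx)) p).ne'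

theorem exists_limit (h : IsPosSol p s Ω a V u) {f : ℕ → Eu n → ℝ}
    (hf : ∀ k, LocallyIntegrableOn (f k) Ω)
    (hcauchy : ∀ k l m, k ≤ l → k ≤ m → CapBound p s Ω a V u (f l - f m) ((1 / 2) ^ k)) :
    ∃ g, LocallyIntegrableOn g Ω ∧ ∀ k, CapBound p s Ω a V u (f k - g) ((1 / 2) ^ k) := by
  obtain ⟨g, -, hg⟩ := exists_stronglyMeasurable_limit_of_tendsto_ae
    (fun k => (hf k).aestronglyMeasurable) (h.ae_exists_tendsto hf hcauchy)
  have hsub (k : ℕ) :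
      LocallyIntegrableOn (f k - g) Ω ∧ CapBound p s Ω a V u (f k - g) ((1 / 2) ^ k) := by
    refine h.locallyIntegrableOn_and_capBound_of_tendsto_ae (fun m => (hf k).sub (hf m)) ?_
      (hg.mono fun x hx => tendsto_const_nhds.sub hx)
    exact (eventually_ge_atTop k).mono fun m hm => hcauchy k k m le_rfl hm
  exact ⟨g, by simpa using (hf 0).sub (hsub 0).1, fun k => (hsub k).2⟩

theorem isHardyWeight_iff_exists_capBound (h : IsPosSol p s Ω a V u) :
    IsHardyWeight p s Ω a V g ↔ LocallyIntegrableOn g Ω ∧ ∃ L, CapBound p s Ω a V u g L := by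
  refine ⟨fun hg => ⟨hg.1, ?_⟩, fun ⟨hg, L, hL⟩ => ?_⟩
  · have hlt := (h.isHardyWeight_iff hg.1).1 hg
    exact ⟨_, h.capBound_of_uNorm_le (ENNReal.coe_toNNReal hlt.ne).ge⟩
  · exact (h.isHardyWeight_iff hg).2 (hL.uNorm_le.trans_lt ENNReal.coe_lt_top)

theorem isHardyWeight_congr (h : IsPosSol p s Ω a V u) (hg : IsHardyWeight p s Ω a V g)
    (hgg' : g =ᵐ[volume.restrict Ω] g') : IsHardyWeight p s Ω a V g' := by
  obtain ⟨hInt, L, hL⟩ := h.isHardyWeight_iff_exists_capBound.1 hg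
  exact h.isHardyWeight_iff_exists_capBound.2 ⟨hInt.congr hgg', L, hL.congr hgg'⟩

end IsPosSol

theorem uNorm_congr (hgg' : g =ᵐ[volume.restrict Ω] g') :
    uNorm p s Ω a V u g = uNorm p s Ω a V u g' :=
  le_antisymm (le_iInf₂ fun _ hL => CapBound.uNorm_le (CapBound.congr (g := g') hL hgg'.symm))
    (le_iInf₂ fun _ hL => CapBound.uNorm_le (CapBound.congr (g := g) hL hgg'))

namespace IsPosSol

theorem uNorm_lt_top (h : IsPosSol p s Ω a V u) (hg : IsHardyWeight p s Ω a V g) :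
    uNorm p s Ω a V u g < ∞ :=
  (h.isHardyWeight_iff hg.1).1 hg

theorem capBound_toNNReal_uNorm (h : IsPosSol p s Ω a V u) (hg : IsHardyWeight p s Ω a V g) :
    CapBound p s Ω a V u g (uNorm p s Ω a V u g).toNNReal :=
  h.capBound_of_uNorm_le (ENNReal.coe_toNNReal (h.uNorm_lt_top hg).ne).ge

theorem uNorm_add_le (h : IsPosSol p s Ω a V u) (hg : IsHardyWeight p s Ω a V g)
    (hg' : IsHardyWeight p s Ω a V g') :
    uNorm p s Ω a V u (g + g') ≤ uNorm p s Ω a V u g + uNorm p s Ω a V u g' := by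
  have hle := (h.capBound_add hg.1 hg'.1 (h.capBound_toNNReal_uNorm hg)
    (h.capBound_toNNReal_uNorm hg')).uNorm_le
  rwa [ENNReal.coe_add, ENNReal.coe_toNNReal (h.uNorm_lt_top hg).ne,
    ENNReal.coe_toNNReal (h.uNorm_lt_top hg').ne] at hle

theorem uNorm_smul_le (h : IsPosSol p s Ω a V u) (hg : IsHardyWeight p s Ω a V g) (c : ℝ) :
    uNorm p s Ω a V u (c • g) ≤ ‖c‖₊ * uNorm p s Ω a V u g := by
  have hle := ((h.capBound_toNNReal_uNorm hg).smul c).uNorm_le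
  rwa [ENNReal.coe_mul, ENNReal.coe_toNNReal (h.uNorm_lt_top hg).ne] at hle

/-- The space `ℋ(Ω)` of Hardy-weights, each being identified with its class modulo equality a.e.
in `Ω`. The positive solution enters only through the proofs that this is a subspace: it turns
Hardy-weights into the functions satisfying some capacitary bound `CapBound`. -/
def hardySpace (h : IsPosSol p s Ω a V u) : Submodule ℝ (Eu n →ₘ[volume.restrict Ω] ℝ) where
  carrier := {g | IsHardyWeight p s Ω a V g}
  zero_mem' := by
    refine h.isHardyWeight_congr (g := 0) ?_ AEEqFun.coeFn_zero.symm
    exact h.isHardyWeight_iff_exists_capBound.2 ⟨locallyIntegrableOn_zero, 0, h.capBound_zero⟩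
  add_mem' {g g'} hg hg' := by
    refine h.isHardyWeight_congr ?_ (AEEqFun.coeFn_add g g').symm
    obtain ⟨hInt, L, hL⟩ := h.isHardyWeight_iff_exists_capBound.1 hg
    obtain ⟨hInt', L', hL'⟩ := h.isHardyWeight_iff_exists_capBound.1 hg'
    exact h.isHardyWeight_iff_exists_capBound.2
      ⟨hInt.add hInt', _, h.capBound_add hInt hInt' hL hL'⟩
  smul_mem' c g hg := by
    refine h.isHardyWeight_congr ?_ (AEEqFun.coeFn_smul c g).symm
    obtain ⟨hInt, L, hL⟩ := h.isHardyWeight_iff_exists_capBound.1 hg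
    exact h.isHardyWeight_iff_exists_capBound.2 ⟨hInt.smul c, _, hL.smul c⟩

theorem mem_hardySpace (h : IsPosSol p s Ω a V u) {g : Eu n →ₘ[volume.restrict Ω] ℝ} :
    g ∈ h.hardySpace ↔ IsHardyWeight p s Ω a V g :=
  Iff.rfl

theorem toReal_uNorm_smul_le (h : IsPosSol p s Ω a V u) (c : ℝ) (g : h.hardySpace) :
    (uNorm p s Ω a V u (c • g : h.hardySpace).1).toReal ≤
      ‖c‖ * (uNorm p s Ω a V u g.1).toReal := by
  have hle := h.uNorm_smul_le (h.mem_hardySpace.1 g.2) c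
  rw [← uNorm_congr (AEEqFun.coeFn_smul c g.1)] at hle
  simpa [ENNReal.toReal_mul] using ENNReal.toReal_mono
    (ENNReal.mul_ne_top ENNReal.coe_ne_top (h.uNorm_lt_top g.2).ne) hle

theorem toReal_uNorm_add_le (h : IsPosSol p s Ω a V u) (g g' : h.hardySpace) :
    (uNorm p s Ω a V u (g + g' : h.hardySpace).1).toReal ≤
      (uNorm p s Ω a V u g.1).toReal + (uNorm p s Ω a V u g'.1).toReal := by
  have hfin := (h.uNorm_lt_top g.2).ne
  have hfin' := (h.uNorm_lt_top g'.2).ne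
  have hle := h.uNorm_add_le (h.mem_hardySpace.1 g.2) (h.mem_hardySpace.1 g'.2)
  rw [← uNorm_congr (AEEqFun.coeFn_add g.1 g'.1)] at hle
  rw [← ENNReal.toReal_add hfin hfin']
  exact ENNReal.toReal_mono (ENNReal.add_ne_top.2 ⟨hfin, hfin'⟩) hle

theorem eq_zero_of_toReal_uNorm_eq_zero (h : IsPosSol p s Ω a V u) {g : h.hardySpace}
    (hg : (uNorm p s Ω a V u g.1).toReal = 0) : g = 0 := by
  have hw := h.mem_hardySpace.1 g.2
  have hzero : uNorm p s Ω a V u g.1 = 0 :=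
    ((ENNReal.toReal_eq_zero_iff _).1 hg).resolve_right (h.uNorm_lt_top hw).ne
  have hae := h.ae_eq_zero_of_capBound_zero hw.1 (h.capBound_of_uNorm_le (L := 0) hzero.le)
  exact Subtype.ext (AEEqFun.ext (hae.trans AEEqFun.coeFn_zero.symm))

theorem normedSpaceCore (h : IsPosSol p s Ω a V u) :
    @NormedSpace.Core ℝ h.hardySpace _ _ _ ⟨fun g => (uNorm p s Ω a V u g.1).toReal⟩ := by
  let _ : Norm h.hardySpace := ⟨fun g => (uNorm p s Ω a V u g.1).toReal⟩
  have hsmul (c : ℝ) (g : h.hardySpace) : ‖c • g‖ ≤ ‖c‖ * ‖g‖ := h.toReal_uNorm_smul_le c g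
  have hzero : ‖(0 : h.hardySpace)‖ = 0 :=
    le_antisymm (by simpa using hsmul 0 0) ENNReal.toReal_nonneg
  refine { norm_nonneg := fun g => ENNReal.toReal_nonneg, norm_smul := fun c g => ?_,
           norm_triangle := h.toReal_uNorm_add_le,
           norm_eq_zero_iff := fun g => ⟨h.eq_zero_of_toReal_uNorm_eq_zero, ?_⟩ }
  · refine le_antisymm (hsmul c g) ?_
    rcases eq_or_ne c 0 with rfl | hc
    · rw [zero_smul, hzero, norm_zero, zero_mul]
    · have hinv := hsmul c⁻¹ (c • g)
      rw [smul_smul, inv_mul_cancel₀ hc, one_smul, norm_inv] at hinv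
      rwa [← le_inv_mul_iff₀ (norm_pos_iff.2 hc)]
  · rintro rfl
    exact hzero

theorem exists_hardySpace_limit (h : IsPosSol p s Ω a V u) (f : ℕ → h.hardySpace)
    (hcauchy : ∀ k l m, k ≤ l → k ≤ m →
      (uNorm p s Ω a V u (f l - f m).1).toReal ≤ (1 / 2) ^ k) :
    ∃ g : h.hardySpace, ∀ k, (uNorm p s Ω a V u (f k - g).1).toReal ≤ (1 / 2) ^ k := by
  have hw (k : ℕ) := h.mem_hardySpace.1 (f k).2
  have hcap (k l m : ℕ) (hl : k ≤ l) (hm : k ≤ m) :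
      CapBound p s Ω a V u (⇑(f l).1 - ⇑(f m).1) ((1 / 2) ^ k) := by
    have hlt := h.uNorm_lt_top (h.mem_hardySpace.1 (f l - f m).2)
    refine CapBound.congr (h.capBound_of_uNorm_le ?_) (AEEqFun.coeFn_sub (f l).1 (f m).1)
    refine (ENNReal.toReal_le_toReal hlt.ne ENNReal.coe_ne_top).1 ?_
    simpa using hcauchy k l m hl hm
  obtain ⟨g, hg, hlim⟩ := h.exists_limit (fun k => (hw k).1) hcap
  have hmk := AEEqFun.coeFn_mk g hg.aestronglyMeasurable
  have hgw : IsHardyWeight p s Ω a V (AEEqFun.mk g hg.aestronglyMeasurable) := by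
    refine h.isHardyWeight_congr (h.isHardyWeight_iff_exists_capBound.2 ⟨hg, ?_⟩) hmk.symm
    have hadd := h.capBound_add (hw 0).1 (((hw 0).1.sub hg).smul (-1 : ℝ))
      (h.capBound_toNNReal_uNorm (hw 0)) ((hlim 0).smul (-1))
    exact ⟨_, hadd.congr (.of_eq (by simp))⟩
  refine ⟨⟨_, hgw⟩, fun k => ?_⟩
  have hsub : CapBound p s Ω a V u (f k - ⟨_, hgw⟩ : h.hardySpace).1 ((1 / 2) ^ k) :=
    (hlim k).congr (((EventuallyEq.refl _ _).sub hmk.symm).trans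
      (AEEqFun.coeFn_sub (f k).1 _).symm)
  simpa using ENNReal.toReal_mono ENNReal.coe_ne_top hsub.uNorm_le

theorem isBanachNorm (h : IsPosSol p s Ω a V u) :
    IsBanachNorm h.hardySpace fun g => (uNorm p s Ω a V u g.1).toReal :=
  isBanachNorm_of_core h.normedSpaceCore h.exists_hardySpace_limit

end IsPosSol

end Banach

end HardyMazya

end

theorem theorem3p13_general {p s : ℝ} (hp : 1 < p) (hs : 1 < s) :
    ∃ C : ℝ, 0 < C ∧
      ∀ {n : ℕ} {Ω : Set (Eu n)}, IsOpen Ω → ∀ {a : Eu n → Fin n → ℝ}, IsCoeff Ω a →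
      ∀ {V : Eu n → ℝ}, LocallyIntegrableOn V Ω →
      ∀ {u : Eu n → ℝ}, ContinuousOn u Ω → (∀ x ∈ Ω, 0 < u x) → IsWeakSol p s Ω a V u →
        (∀ g : Eu n → ℝ, LocallyIntegrableOn g Ω →
          (IsHardyWeight p s Ω a V g ↔ uNorm p s Ω a V u g < ∞)) ∧
        (∀ g : Eu n → ℝ, IsHardyWeight p s Ω a V g →
          uNorm p s Ω a V u g ≤ hNorm p s Ω a V g ∧
          hNorm p s Ω a V g ≤ ENNReal.ofReal C * uNorm p s Ω a V u g) ∧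
        ∃ W : Submodule ℝ (Eu n →ₘ[volume.restrict Ω] ℝ),
          (∀ g : Eu n →ₘ[volume.restrict Ω] ℝ, g ∈ W ↔ IsHardyWeight p s Ω a V g) ∧
          IsBanachNorm W
            (fun g => (uNorm p s Ω a V u (g : Eu n →ₘ[volume.restrict Ω] ℝ)).toReal) := by
  obtain ⟨C, hC, hcompare⟩ := exists_hNorm_le_uNorm hp hs
  refine ⟨C, hC, fun {n Ω} hΩ {a} ha {V} hV {u} hu hpos hsol => ?_⟩
  have h : IsPosSol p s Ω a V u := ⟨hp, hs, hΩ, ha, hV, hu, hpos, hsol⟩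
  exact ⟨fun g hg => h.isHardyWeight_iff hg,
    fun g hg => ⟨h.uNorm_le_hNorm hg, (hcompare n Ω a V u h g hg.1 (h.uNorm_lt_top hg)).2⟩,
    h.hardySpace, fun g => h.mem_hardySpace, h.isBanachNorm⟩

theorem theorem3p13 (p s : ℝ) (hp : 1 < p) (hs : 1 < s) :
    -- the constant depends on `p`, `s`, `n` only, and not on `n` if `p ≤ s`
    ∃ C : ℕ → ℝ, (∀ n, 0 < C n) ∧ (p ≤ s → ∀ m n, C m = C n) ∧
      ∀ (n : ℕ), 2 ≤ n → ∀ (Ω : Set (Eu n)), IsDom Ω →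
      ∀ (a : Eu n → Fin n → ℝ), IsCoeff Ω a →
      ∀ (q : ℝ) (V : Eu n → ℝ), MemMorreyLoc p q Ω V →
      ∀ (u : Eu n → ℝ), ContinuousOn u Ω → (∀ x ∈ Ω, 0 < u x) → IsWeakSol p s Ω a V u →
        (∀ g : Eu n → ℝ, LocallyIntegrableOn g Ω →
          (IsHardyWeight p s Ω a V g ↔ uNorm p s Ω a V u g < ∞)) ∧
        (∀ g : Eu n → ℝ, IsHardyWeight p s Ω a V g →
          uNorm p s Ω a V u g ≤ hNorm p s Ω a V g ∧
          hNorm p s Ω a V g ≤ ENNReal.ofReal (C n) * uNorm p s Ω a V u g) ∧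
        -- the Hardy-weights, modulo equality a.e. in `Ω`, form a Banach space under `‖·‖_u`
        ∃ W : Submodule ℝ (Eu n →ₘ[volume.restrict Ω] ℝ),
          (∀ g : Eu n →ₘ[volume.restrict Ω] ℝ, g ∈ W ↔ IsHardyWeight p s Ω a V g) ∧
          IsBanachNorm W
            (fun g => (uNorm p s Ω a V u (g : Eu n →ₘ[volume.restrict Ω] ℝ)).toReal) := by
  obtain ⟨C, hC, H⟩ := theorem3p13_general hp hs
  exact ⟨fun _ => C, fun _ => hC, fun _ _ _ => rfl, fun n _ Ω hΩ a ha q V hV u hu hpos hsol =>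
    H hΩ.1 ha (hV.locallyIntegrableOn hΩ.1) hu hpos hsol⟩
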